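/- All theories are theories in many-sorted first-order logic with equality; free variables in axioms are read universally, and no sort of a structure is empty. The signature of second-order arithmetic has a sort of numbers and a sort of sets of numbers, symbols $0,s,+,\times,\le$ on numbers, and a membership relation between numbers and sets. The theory $\mathsf{PA}^2$ consists of the axioms of Robinson's $\mathsf{Q}$, that is, $sx\neq 0$; $sx=sy\to x=y$; $x\neq 0\to\exists w\,(x=sw)$; $x+0=x$; $x+sy=s(x+y)$; $x\cdot 0=0$; $x\cdot sy=x\cdot y+x$; $x\le y\leftrightarrow\exists z\,(x+z=y)$; together with the induction axiom $\forall F\,[F(0)\wedge\forall n\,(F(n)\to F(sn))\to\forall n\,F(n)]$, extensionality for sets, and the comprehension schema $\exists F\,\forall n\,(n\in F\leftrightarrow\varphi(n))$ for all formulas $\varphi$ (with number and set parameters) in which $F$ is not free. The signature of Hume's Principle has a sort of objects, for each $m\ge 1$ a sort of $m$-ary relations on objects (unary relations are called sets) with a membership symbol between $m$-tuples of objects and $m$-ary relations, and one function symbol $\#$ from sets to objects. The theory $\mathsf{HP}^2$ consists of Hume's Principle $$\#X=\#Y\;\leftrightarrow\;\text{there is a binary relation that is the graph of a bijection } X\to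 Y,$$ extensionality for relations of each arity, and the comprehension schema $\exists R\,\forall\bar n\,(\bar n\in R\leftrightarrow\varphi(\bar n))$ for $R$ of every arity $m\ge1$ and all formulas $\varphi$ (with object and relation parameters) in which $R$ is not free. A formula is $\Pi^1_0$, equivalently $\Sigma^1_0$, if it binds no set or relation variable. For $n\ge 1$, a $\Sigma^1_n$-formula is a non-empty block of existential set or relation quantifiers followed by a $\Pi^1_{n-1}$-formula, and a $\Pi^1_n$-formula is a non-empty block of universal set or relation quantifiers followed by a $\Sigma^1_{n-1}$-formula. The theories $\Pi^1_n\text{-}\mathsf{CA}_0$ and $\Pi^1_n\text{-}\mathsf{HP}_0$ are obtained from $\mathsf{PA}^2$ and $\mathsf{HP}^2$ by restricting the comprehension schema to $\Pi^1_n$-formulas $\varphi$. A theory $S$ is interpretable in a theory $T$ if every model of $T$ uniformly defines, without parameters, a model of $S$: there is one assignment to each sort of $S$ of a sort of $T$ and of a parameter-free formula defining the domain of that sort, and to each relation symbol and (graph of a) function symbol of $S$ of a parameter-free formula defining it, such that in every model of $T$ these formulas define a model of $S$, equality being interpreted as equality. Two theories are mutually interpretable if each is interpretable in the other. **Theorem.**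 $\mathsf{PA}^2$ and $\mathsf{HP}^2$ are mutually interpretable. Moreover, for every $n>0$, the theories $\Pi^1_n\text{-}\mathsf{CA}_0$ and $\Pi^1_n\text{-}\mathsf{HP}_0$ are mutually interpretable. -/

import Mathlib

universe u

/-! ## Many-sorted first-order logic with equality -/

/-- A many-sorted signature. The function symbol `f` takes `fnAr f` arguments, the `i`-th one of
sort `fnArg f i`, and has values of sort `fnRes f`; constants are function symbols without
arguments. The relation symbol `r` takes `rlAr r` arguments, the `i`-th one of sort `rlArg r i`. -/
structure Signature where
  Srt : Type
  Fn : Type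
  fnAr : Fn → ℕ
  fnArg : (f : Fn) → Fin (fnAr f) → Srt
  fnRes : Fn → Srt
  Rl : Type
  rlAr : Rl → ℕ
  rlArg : (r : Rl) → Fin (rlAr r) → Srt

/-- Each sort has its own countable stock of variables: `(σ, i)` is the `i`-th variable of
sort `σ`. -/
abbrev Signature.Vrb (L : Signature) : Type := L.Srt × ℕ

/-- Terms, indexed by their sort. -/
inductive Term (L : Signature) : L.Srt → Type
  | var (p : L.Vrb) : Term L p.1
  | app (f : L.Fn) (ts : (i : Fin (L.fnAr f)) → Term L (L.fnArg f i)) : Term L (L.fnRes f)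

/-- Formulas. -/
inductive Formula (L : Signature) : Type
  | fal : Formula L
  | eq {σ : L.Srt} (s t : Term L σ) : Formula L
  | rel (r : L.Rl) (ts : (i : Fin (L.rlAr r)) → Term L (L.rlArg r i)) : Formula L
  | imp (φ ψ : Formula L) : Formula L
  | all (p : L.Vrb) (φ : Formula L) : Formula L
  | ex (p : L.Vrb) (φ : Formula L) : Formula L

namespace Formula

variable {L : Signature}

def neg (φ : Formula L) : Formula L := imp φ fal

def and (φ ψ : Formula L) : Formula L := neg (imp φ (neg ψ))

def iff (φ ψ : Formula L) : Formula L := and (imp φ ψ) (imp ψ φ)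

/-- `∀ p₁ ⋯ ∀ pₙ φ` for a list `[p₁, …, pₙ]` of variables. -/
def alls (ps : List L.Vrb) (φ : Formula L) : Formula L := ps.foldr all φ

end Formula

/-- The variables of a term. -/
def Term.vars {L : Signature} : {σ : L.Srt} → Term L σ → Set L.Vrb
  | _, .var p => {p}
  | _, .app _ ts => {q | ∃ i, q ∈ (ts i).vars}

/-- The free variables of a formula. -/
def Formula.free {L : Signature} : Formula L → Set L.Vrb
  | .fal => ∅
  | .eq s t => s.vars ∪ t.vars
  | .rel _ ts => {q | ∃ i, q ∈ (ts i).vars}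
  | .imp φ ψ => φ.free ∪ ψ.free
  | .all p φ => φ.free \ {p}
  | .ex p φ => φ.free \ {p}

/-- Structures for a many-sorted signature; as usual in first-order logic, no sort is empty. -/
structure Struc (L : Signature) where
  carrier : L.Srt → Type u
  nonempty : ∀ σ, Nonempty (carrier σ)
  fn : (f : L.Fn) → ((i : Fin (L.fnAr f)) → carrier (L.fnArg f i)) → carrier (L.fnRes f)
  rl : (r : L.Rl) → ((i : Fin (L.rlAr r)) → carrier (L.rlArg r i)) → Prop

namespace Struc

variable {L : Signature}

/-- Assignments of elements of the right sort to all variables. -/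
abbrev Assign (M : Struc.{u} L) : Type u := (p : L.Vrb) → M.carrier p.1

/-- The value of a term. -/
def val (M : Struc.{u} L) (v : M.Assign) : {σ : L.Srt} → Term L σ → M.carrier σ
  | _, .var p => v p
  | _, .app f ts => M.fn f (fun i => M.val v (ts i))

open Classical in
/-- Tarski's satisfaction relation. -/
def Sat (M : Struc.{u} L) : M.Assign → Formula L → Prop
  | _, .fal => False
  | v, .eq s t => M.val v s = M.val v t
  | v, .rel r ts => M.rl r (fun i => M.val v (ts i))
  | v, .imp φ ψ => M.Sat v φ → M.Sat v ψ
  | v, .all p φ => ∀ a : M.carrier p.1, M.Sat (Function.update v p a) φ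
  | v, .ex p φ => ∃ a : M.carrier p.1, M.Sat (Function.update v p a) φ

/-- `M` is a model of the theory `T`. Free variables in axioms are read universally. -/
def Models (M : Struc.{u} L) (T : Set (Formula L)) : Prop :=
  ∀ φ ∈ T, ∀ v : M.Assign, M.Sat v φ

end Struc

/-! ## Interpretability -/

/-- A parameter-free definition scheme for structures of signature `K` inside structures of
signature `L`. Each sort `σ` of `K` is sent to a sort of `L`, with a formula `dom σ` in the
variable number `0` of that sort for the domain. A relation symbol `r` is defined by the formula
`rl r` in the variables number `0, …, rlAr r - 1` (of the sorts that belong to its arguments), a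
function symbol `f` by the formula `fn f` for its graph, where the variables number
`0, …, fnAr f - 1` stand for the arguments and the variable number `fnAr f` for the value. -/
structure Scheme (K L : Signature) where
  srt : K.Srt → L.Srt
  dom : K.Srt → Formula L
  rl : K.Rl → Formula L
  fn : K.Fn → Formula L
  dom_free : ∀ σ, (dom σ).free ⊆ {(srt σ, 0)}
  rl_free : ∀ r, (rl r).free ⊆ {q | ∃ i : Fin (K.rlAr r), q = (srt (K.rlArg r i), (i : ℕ))}
  fn_free : ∀ f, (fn f).free ⊆
    {q | (∃ i : Fin (K.fnAr f), q = (srt (K.fnArg f i), (i : ℕ))) ∨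
      q = (srt (K.fnRes f), K.fnAr f)}

/-- The scheme `I` defines in `M` the structure `N`: up to the identification of the elements of
`N` with elements of `M` by injections `ι`, the domains of `N` are the sets defined by `I.dom`, and
its relations and (graphs of) functions are defined by `I.rl` and `I.fn`. Equality in `N` is
equality in `M`. -/
def Scheme.Defines {K L : Signature} (I : Scheme K L) (M : Struc.{u} L) (N : Struc.{u} K) : Prop :=
  ∃ ι : (σ : K.Srt) → N.carrier σ → M.carrier (I.srt σ),
    (∀ σ, Function.Injective (ι σ)) ∧
    (∀ σ (v : M.Assign), v (I.srt σ, 0) ∈ Set.range (ι σ) ↔ M.Sat v (I.dom σ)) ∧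
    (∀ r (a : (i : Fin (K.rlAr r)) → N.carrier (K.rlArg r i)) (v : M.Assign),
      (∀ i, v (I.srt (K.rlArg r i), (i : ℕ)) = ι _ (a i)) →
        (N.rl r a ↔ M.Sat v (I.rl r))) ∧
    (∀ f (a : (i : Fin (K.fnAr f)) → N.carrier (K.fnArg f i)) (b : N.carrier (K.fnRes f))
      (v : M.Assign),
      (∀ i, v (I.srt (K.fnArg f i), (i : ℕ)) = ι _ (a i)) →
      v (I.srt (K.fnRes f), K.fnAr f) = ι _ b →
        (N.fn f a = b ↔ M.Sat v (I.fn f)))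

/-- `S` is interpretable in `T`: every model of `T` uniformly defines, without parameters, a model
of `S`. -/
def Interpretable {K L : Signature} (S : Set (Formula K)) (T : Set (Formula L)) : Prop :=
  ∃ I : Scheme K L, ∀ M : Struc.{u} L, M.Models T → ∃ N : Struc.{u} K, N.Models S ∧ I.Defines M N

def MutuallyInterpretable {K L : Signature} (S : Set (Formula K)) (T : Set (Formula L)) : Prop :=
  Interpretable.{u} S T ∧ Interpretable.{u} T S

/-! ## The hierarchy of second-order formulas

`ob` is the sort of objects; all other sorts are sorts of sets or relations. -/

/-- Arithmetical formulas: no variable of a set or relation sort is bound. -/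
def Formula.Arithmetical {L : Signature} (ob : L.Srt) : Formula L → Prop
  | .fal => True
  | .eq _ _ => True
  | .rel _ _ => True
  | .imp φ ψ => φ.Arithmetical ob ∧ ψ.Arithmetical ob
  | .all p φ => p.1 = ob ∧ φ.Arithmetical ob
  | .ex p φ => p.1 = ob ∧ φ.Arithmetical ob

mutual

/-- `Σ¹ₙ`-formulas. -/
inductive IsSigma {L : Signature} (ob : L.Srt) : ℕ → Formula L → Prop
  | arith {φ : Formula L} : φ.Arithmetical ob → IsSigma ob 0 φ
  | ex_same {n : ℕ} {φ : Formula L} {p : L.Vrb} :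
      p.1 ≠ ob → IsSigma ob (n + 1) φ → IsSigma ob (n + 1) (.ex p φ)
  | ex_succ {n : ℕ} {φ : Formula L} {p : L.Vrb} :
      p.1 ≠ ob → IsPi ob n φ → IsSigma ob (n + 1) (.ex p φ)

/-- `Π¹ₙ`-formulas. -/
inductive IsPi {L : Signature} (ob : L.Srt) : ℕ → Formula L → Prop
  | arith {φ : Formula L} : φ.Arithmetical ob → IsPi ob 0 φ
  | all_same {n : ℕ} {φ : Formula L} {p : L.Vrb} :
      p.1 ≠ ob → IsPi ob (n + 1) φ → IsPi ob (n + 1) (.all p φ)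
  | all_succ {n : ℕ} {φ : Formula L} {p : L.Vrb} :
      p.1 ≠ ob → IsSigma ob n φ → IsPi ob (n + 1) (.all p φ)

end

/-! ## Second-order Peano arithmetic -/

namespace PA

inductive Srts
  | num
  | set

inductive Fns
  | zero
  | succ
  | add
  | mul

inductive Rls
  | le
  | mem

/-- The signature `0, s, +, ×, ≤, E` with a sort of numbers and a sort of sets of numbers. -/
abbrev sig : Signature where
  Srt := Srts
  Fn := Fns
  fnAr
    | .zero => 0
    | .succ => 1
    | .add => 2
    | .mul => 2
  fnArg _ _ := .num
  fnRes _ := .num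
  Rl := Rls
  rlAr _ := 2
  rlArg
    | .le => ![.num, .num]
    | .mem => ![.num, .set]

abbrev Num : sig.Srt := Srts.num

abbrev Sets : sig.Srt := Srts.set

/-- The `i`-th number variable. -/
def x (i : ℕ) : Term sig Num := .var (Num, i)

/-- The `i`-th set variable. -/
def X (i : ℕ) : Term sig Sets := .var (Sets, i)

def zero : Term sig Num := .app (L := sig) Fns.zero (fun i => i.elim0)

def succ (t : Term sig Num) : Term sig Num := .app (L := sig) Fns.succ (fun _ => t)

def add (s t : Term sig Num) : Term sig Num := .app (L := sig) Fns.add ![s, t]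

def mul (s t : Term sig Num) : Term sig Num := .app (L := sig) Fns.mul ![s, t]

def le (s t : Term sig Num) : Formula sig :=
  .rel (L := sig) Rls.le (fun | ⟨0, _⟩ => s | ⟨1, _⟩ => t)

/-- `t ∈ A`. -/
def mem (t : Term sig Num) (A : Term sig Sets) : Formula sig :=
  .rel (L := sig) Rls.mem (fun | ⟨0, _⟩ => t | ⟨1, _⟩ => A)

def q1 : Formula sig := .neg (.eq (succ (x 0)) zero)

def q2 : Formula sig := .imp (.eq (succ (x 0)) (succ (x 1))) (.eq (x 0) (x 1))

def q3 : Formula sig :=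
  .imp (.neg (.eq (x 0) zero)) (.ex (Num, 1) (.eq (x 0) (succ (x 1))))

def q4 : Formula sig := .eq (add (x 0) zero) (x 0)

def q5 : Formula sig := .eq (add (x 0) (succ (x 1))) (succ (add (x 0) (x 1)))

def q6 : Formula sig := .eq (mul (x 0) zero) zero

def q7 : Formula sig := .eq (mul (x 0) (succ (x 1))) (add (mul (x 0) (x 1)) (x 0))

def q8 : Formula sig :=
  .iff (le (x 0) (x 1)) (.ex (Num, 2) (.eq (add (x 0) (x 2)) (x 1)))

/-- The mathematical induction axiom. -/
def induction : Formula sig :=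
  .all (Sets, 0) (.imp
    (.and (mem zero (X 0)) (.all (Num, 0) (.imp (mem (x 0) (X 0)) (mem (succ (x 0)) (X 0)))))
    (.all (Num, 0) (mem (x 0) (X 0))))

/-- Coextensive sets are equal. -/
def extensionality : Formula sig :=
  .imp (.all (Num, 0) (.iff (mem (x 0) (X 0)) (mem (x 0) (X 1)))) (.eq (X 0) (X 1))

/-- The axioms other than comprehension. -/
def base : Set (Formula sig) :=
  {q1, q2, q3, q4, q5, q6, q7, q8, induction, extensionality}

/-- `∃ F ∀ n (n ∈ F ↔ φ)`, where `F` is the `r`-th set variable and `n` the `k`-th number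
variable. -/
def comprehension (r k : ℕ) (φ : Formula sig) : Formula sig :=
  .ex (Sets, r) (.all (Num, k) (.iff (mem (x k) (X r)) φ))

/-- The comprehension schema for the formulas in `C`. -/
def schema (C : Set (Formula sig)) : Set (Formula sig) :=
  {χ | ∃ (r k : ℕ) (φ : Formula sig), φ ∈ C ∧ (Sets, r) ∉ φ.free ∧ χ = comprehension r k φ}

end PA

/-- Second-order Peano arithmetic `PA²`. -/
def PA2 : Set (Formula PA.sig) := PA.base ∪ PA.schema Set.univ

/-- `Π¹ₙ-CA₀`. -/
def PiCA (n : ℕ) : Set (Formula PA.sig) := PA.base ∪ PA.schema {φ | IsPi PA.Num n φ}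

/-! ## Hume's Principle -/

namespace HP

/-- `rel k` is the sort of `(k + 1)`-ary relations on objects; in particular `rel 0` is the sort
of sets. -/
inductive Srts
  | obj
  | rel (k : ℕ)

/-- The signature has one function symbol `#` from sets to objects, and for each `k` a membership
symbol `E` between a `(k + 1)`-ary relation (the first argument) and a `(k + 1)`-tuple of
objects. -/
abbrev sig : Signature where
  Srt := Srts
  Fn := Unit
  fnAr _ := 1
  fnArg _ _ := .rel 0
  fnRes _ := .obj
  Rl := ℕ
  rlAr k := k + 2
  rlArg k := Fin.cases (.rel k) (fun _ => .obj)

abbrev Obj : sig.Srt := Srts.obj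

abbrev Rel (k : ℕ) : sig.Srt := Srts.rel k

/-- The `i`-th object variable. -/
def x (i : ℕ) : Term sig Obj := .var (Obj, i)

/-- The `i`-th variable for `(k + 1)`-ary relations. -/
def R (k i : ℕ) : Term sig (Rel k) := .var (Rel k, i)

/-- `#A`. -/
def card (A : Term sig (Rel 0)) : Term sig Obj := .app (L := sig) () (fun _ => A)

/-- `(t₀, …, tₖ) ∈ A`. -/
def mem {k : ℕ} (A : Term sig (Rel k)) (t : Fin (k + 1) → Term sig Obj) : Formula sig :=
  .rel (L := sig) k (Fin.cases A t)

/-- `f` is (the graph of) a bijection from the set `A` to the set `B`, where `A`, `B` and `f` are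
the set variables number `0` and `1` and the binary relation variable number `0`. -/
def bijection : Formula sig :=
  let A (i : ℕ) : Formula sig := mem (R 0 0) ![x i]
  let B (i : ℕ) : Formula sig := mem (R 0 1) ![x i]
  let f (i j : ℕ) : Formula sig := mem (R 1 0) ![x i, x j]
  .and (.alls [(Obj, 0), (Obj, 1)] (.imp (f 0 1) (.and (A 0) (B 1)))) <|
  .and (.all (Obj, 0) (.imp (A 0) (.ex (Obj, 1) (f 0 1)))) <|
  .and (.alls [(Obj, 0), (Obj, 1), (Obj, 2)]
    (.imp (.and (f 0 1) (f 0 2)) (.eq (x 1) (x 2)))) <|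
  .and (.alls [(Obj, 0), (Obj, 1), (Obj, 2)]
    (.imp (.and (f 0 2) (f 1 2)) (.eq (x 0) (x 1)))) <|
  .all (Obj, 1) (.imp (B 1) (.ex (Obj, 0) (f 0 1)))

/-- Hume's Principle: `#A = #B` if and only if there is a bijection from `A` to `B`. -/
def hume : Formula sig :=
  .iff (.eq (card (R 0 0)) (card (R 0 1))) (.ex (Rel 1, 0) bijection)

/-- Coextensive `(k + 1)`-ary relations are equal. -/
def extensionality (k : ℕ) : Formula sig :=
  .imp (.alls (List.ofFn fun i : Fin (k + 1) => (Obj, (i : ℕ)))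
      (.iff (mem (R k 0) fun i => x i) (mem (R k 1) fun i => x i)))
    (.eq (R k 0) (R k 1))

/-- The axioms other than comprehension. -/
def base : Set (Formula sig) := {hume} ∪ Set.range extensionality

/-- `∃ R ∀ n₀ ⋯ ∀ nₖ ((n₀, …, nₖ) ∈ R ↔ φ)`, where `R` is the `r`-th variable for
`(k + 1)`-ary relations and `nᵢ` is the object variable number `n i`. -/
def comprehension (k r : ℕ) (n : Fin (k + 1) → ℕ) (φ : Formula sig) : Formula sig :=
  .ex (Rel k, r) (.alls (List.ofFn fun i => (Obj, n i))
    (.iff (mem (R k r) fun i => x (n i)) φ))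

/-- The comprehension schema, for relations of all arities, for the formulas in `C`. -/
def schema (C : Set (Formula sig)) : Set (Formula sig) :=
  {χ | ∃ (k r : ℕ) (n : Fin (k + 1) → ℕ) (φ : Formula sig), φ ∈ C ∧ Function.Injective n ∧
    (Rel k, r) ∉ φ.free ∧ χ = comprehension k r n φ}

end HP

/-- The theory `HP²`. -/
def HP2 : Set (Formula HP.sig) := HP.base ∪ HP.schema Set.univ

/-- `Π¹ₙ-HP₀`. -/
def PiHP (n : ℕ) : Set (Formula HP.sig) := HP.base ∪ HP.schema {φ | IsPi HP.Obj n φ}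

/-! ## Renaming variables -/

-- In a model of arithmetic, the objects are the numbers, the relations of a given arity are sets of
-- codes of tuples under a polynomial pairing function, and `#X` is `m + 1` if `X` has `m` elements
-- and `0` if `X` is infinite. Hume's Principle is proved with the function that counts the elements
-- of `X` below `n`. Sets of equal cardinality are matched by rank (`PA.exists_isBij`); conversely,
-- a bijection sends each initial segment of `X` to an equally large part of `Y`
-- (`PA.IsBij.exists_cnt_le`).
--
-- In a model of Hume's Principle, Frege's construction is used. A cardinality succeeds another if
-- it belongs to a set with one more element; the natural numbers are the objects reached from the
-- number of the empty set; and `n` has a successor because the number of natural numbers up to `n`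
-- is one (`HP.Nt.exists_suc`). Addition and multiplication are obtained by recursion, as least
-- relations closed under the recursion clauses (`HP.rec_cases`, `HP.rec_total`).
--
-- The delicate point is comprehension level by level: a `Π¹ₙ`-formula has to be translated into a
-- `Π¹ₙ`-formula, although counting, successor, order and recursion have genuinely second-order
-- definitions. The schema admits parameters, so it suffices that, inside each model, these notions
-- are arithmetical in suitable sets or relations. `Π¹₁`-comprehension provides the graphs of
-- successor, order, addition and multiplication as such parameters; this is why the level must be
-- positive. The argument of `#` is a set, so the graph of `#` is no set of numbers. It is still
-- arithmetical in parameters (`PA.ar_card_eq`): numbers code finite sets, one parameter is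
-- membership in the coded set, another the cardinality of the coded set, and a set without code is
-- infinite.
--
-- Definability with parameters, `Dfb`, is therefore studied model by model, and
-- `Dfb.transfer_arith`, `Dfb.transfer_univ` and `Dfb.transfer_pi_sigma` carry it from atomic
-- formulas to the classes of the schema. The interpretations themselves are given by explicit
-- parameter-free formulas, whose complexity does not matter.

/-- Renaming of variables by a map on indices. -/
def Term.ren {L : Signature} (f : ℕ → ℕ) : {σ : L.Srt} → Term L σ → Term L σ
  | _, .var p => .var (p.1, f p.2)
  | _, .app g ts => .app g fun i => (ts i).ren f

def Formula.ren {L : Signature} (f : ℕ → ℕ) : Formula L → Formula L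
  | .fal => .fal
  | .eq s t => .eq (s.ren f) (t.ren f)
  | .rel r ts => .rel r fun i => (ts i).ren f
  | .imp φ ψ => .imp (φ.ren f) (ψ.ren f)
  | .all p φ => .all (p.1, f p.2) (φ.ren f)
  | .ex p φ => .ex (p.1, f p.2) (φ.ren f)

section Renaming

variable {L : Signature} {M : Struc.{u} L}

theorem Struc.val_ren (f : ℕ → ℕ) (v : M.Assign) {σ : L.Srt} (t : Term L σ) :
    M.val v (t.ren f) = M.val (fun p => v (p.1, f p.2)) t := by
  induction t with
  | var p => rfl
  | app g ts ih => simp only [Term.ren, Struc.val, ih]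

theorem Struc.update_ren {f : ℕ → ℕ} (hf : Function.Injective f) (v : M.Assign) (p : L.Vrb)
    (a : M.carrier p.1) [DecidableEq L.Vrb] :
    (fun q : L.Vrb => Function.update v (p.1, f p.2) a (q.1, f q.2)) =
      Function.update (fun q : L.Vrb => v (q.1, f q.2)) p a := by
  funext q
  by_cases h : q = p
  · subst h
    exact (Function.update_self (β := fun p : L.Vrb => M.carrier p.1) (q.1, f q.2) a v).trans
      (Function.update_self (β := fun p : L.Vrb => M.carrier p.1) q a _).symm
  · rw [Function.update_of_ne h]
    have h' : (q.1, f q.2) ≠ (p.1, f p.2) := fun e =>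
      h (Prod.ext (Prod.mk.inj e).1 (hf (Prod.mk.inj e).2))
    exact Function.update_of_ne (β := fun p : L.Vrb => M.carrier p.1) h' a v

/-- Injectivity prevents a renamed quantifier from capturing another variable. -/
theorem Struc.sat_ren {f : ℕ → ℕ} (hf : Function.Injective f) (φ : Formula L) (v : M.Assign) :
    M.Sat v (φ.ren f) ↔ M.Sat (fun p => v (p.1, f p.2)) φ := by
  induction φ generalizing v with
  | fal => rfl
  | eq s t => simp only [Formula.ren, Struc.Sat, Struc.val_ren]
  | rel r ts => simp only [Formula.ren, Struc.Sat, Struc.val_ren]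
  | imp φ ψ ih₁ ih₂ => simp only [Formula.ren, Struc.Sat, ih₁, ih₂]
  | all p φ ih =>
    simp only [Formula.ren, Struc.Sat, ih]
    exact forall_congr' fun a => by rw [Struc.update_ren hf]
  | ex p φ ih =>
    simp only [Formula.ren, Struc.Sat, ih]
    exact exists_congr fun a => by rw [Struc.update_ren hf]

theorem Formula.Arithmetical.ren {ob : L.Srt} (f : ℕ → ℕ) {φ : Formula L}
    (h : φ.Arithmetical ob) : (φ.ren f).Arithmetical ob := by
  induction φ with
  | fal | eq | rel => trivial
  | imp φ ψ ih₁ ih₂ => exact ⟨ih₁ h.1, ih₂ h.2⟩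
  | all p φ ih => exact ⟨h.1, ih h.2⟩
  | ex p φ ih => exact ⟨h.1, ih h.2⟩

/-- The two classes are defined by mutual induction, so one induction on the formula treats both,
for all levels. -/
theorem isPi_isSigma_ren {ob : L.Srt} (f : ℕ → ℕ) (φ : Formula L) :
    ∀ n, (IsPi ob n φ → IsPi ob n (φ.ren f)) ∧ (IsSigma ob n φ → IsSigma ob n (φ.ren f)) := by
  induction φ with
  | fal | eq | rel =>
    intro n
    constructor <;> rintro ⟨⟩ <;> constructor <;> trivial
  | imp φ ψ ih₁ ih₂ =>
    intro n
    constructor <;> rintro ⟨⟩ <;> constructor <;> exact Formula.Arithmetical.ren f ‹_›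
  | all p φ ih =>
    intro n
    constructor
    · rintro (h | ⟨h, h'⟩ | ⟨h, h'⟩)
      · exact .arith (h.ren f)
      · exact .all_same h ((ih _).1 h')
      · exact .all_succ h ((ih _).2 h')
    · rintro ⟨h⟩
      exact .arith (Formula.Arithmetical.ren f ‹_›)
  | ex p φ ih =>
    intro n
    constructor
    · rintro ⟨h⟩
      exact .arith (Formula.Arithmetical.ren f ‹_›)
    · rintro (h | ⟨h, h'⟩ | ⟨h, h'⟩)
      · exact .arith (h.ren f)
      · exact .ex_same h ((ih _).2 h')
      · exact .ex_succ h ((ih _).1 h')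

theorem Term.vars_ren (f : ℕ → ℕ) {σ : L.Srt} (t : Term L σ) {q : L.Vrb}
    (h : q ∈ (t.ren f).vars) : q.2 ∈ Set.range f := by
  induction t with
  | var p => cases h; exact ⟨_, rfl⟩
  | app g ts ih => obtain ⟨i, hi⟩ := h; exact ih i hi

/-- Used in the contrapositive: an index outside the range of the renaming is fresh, as
comprehension requires of its set variable. -/
theorem Formula.free_ren (f : ℕ → ℕ) (φ : Formula L) {q : L.Vrb}
    (h : q ∈ (φ.ren f).free) : q.2 ∈ Set.range f := by
  induction φ with
  | fal => cases h
  | eq s t => exact h.elim (Term.vars_ren f s) (Term.vars_ren f t)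
  | rel r ts => obtain ⟨i, hi⟩ := h; exact Term.vars_ren f _ hi
  | imp φ ψ ih₁ ih₂ => exact h.elim ih₁ ih₂
  | all p φ ih => exact ih h.1
  | ex p φ ih => exact ih h.1

-- Dependence on free variables, derived connectives, closing of formulas

theorem Struc.val_congr {v w : M.Assign} {σ : L.Srt} (t : Term L σ)
    (h : ∀ q ∈ t.vars, v q = w q) : M.val v t = M.val w t := by
  induction t with
  | var p => exact h p rfl
  | app g ts ih =>
    simp only [Struc.val]
    congr 1
    funext i
    exact ih i fun q hq => h q ⟨i, hq⟩

open Classical in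
theorem Struc.sat_congr {φ : Formula L} {v w : M.Assign} (h : ∀ q ∈ φ.free, v q = w q) :
    M.Sat v φ ↔ M.Sat w φ := by
  have key : ∀ (p : L.Vrb) (φ : Formula L) (v w : M.Assign) (a : M.carrier p.1),
      (∀ q ∈ φ.free \ {p}, v q = w q) →
      ∀ q ∈ φ.free, Function.update v p a q = Function.update w p a q := by
    intro p φ v w a h q hq
    by_cases e : q = p
    · subst e; simp
    · simpa [Function.update_of_ne e] using h q ⟨hq, e⟩
  induction φ generalizing v w with
  | fal => rfl
  | eq s t =>
    simp only [Struc.Sat]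
    rw [Struc.val_congr s fun q hq => h q (Or.inl hq),
      Struc.val_congr t fun q hq => h q (Or.inr hq)]
  | rel r ts =>
    simp only [Struc.Sat]
    have : (fun i => M.val v (ts i)) = fun i => M.val w (ts i) := by
      funext i; exact Struc.val_congr _ fun q hq => h q ⟨i, hq⟩
    rw [this]
  | imp φ ψ ih₁ ih₂ =>
    exact imp_congr (ih₁ fun q hq => h q (Or.inl hq)) (ih₂ fun q hq => h q (Or.inr hq))
  | all p φ ih => exact forall_congr' fun a => ih (key p φ v w a h)
  | ex p φ ih => exact exists_congr fun a => ih (key p φ v w a h)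

theorem Struc.sat_neg {v : M.Assign} {φ : Formula L} : M.Sat v φ.neg ↔ ¬ M.Sat v φ := Iff.rfl

theorem Struc.sat_and {v : M.Assign} {φ ψ : Formula L} :
    M.Sat v (φ.and ψ) ↔ M.Sat v φ ∧ M.Sat v ψ := by
  simp only [Formula.and, Formula.neg, Struc.Sat]; tauto

theorem Struc.sat_iff {v : M.Assign} {φ ψ : Formula L} :
    M.Sat v (φ.iff ψ) ↔ (M.Sat v φ ↔ M.Sat v ψ) := by
  simp only [Formula.iff, Struc.sat_and, Struc.Sat]; tauto

/-- Speaking of assignments that agree off the list avoids iterated updates and makes repetitions in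
the list harmless. -/
theorem Struc.sat_alls {v : M.Assign} (ps : List L.Vrb) {φ : Formula L} :
    M.Sat v (.alls ps φ) ↔ ∀ w : M.Assign, (∀ q ∉ ps, w q = v q) → M.Sat w φ := by
  classical
  induction ps generalizing v with
  | nil =>
    constructor
    · intro h w hw
      rwa [show w = v from funext fun q => hw q (by simp)]
    · intro h; exact h v fun _ _ => rfl
  | cons p ps ih =>
    change (∀ a, M.Sat (Function.update v p a) (.alls ps φ)) ↔ _
    simp only [ih]
    constructor
    · intro h w hw
      refine h (w p) w fun q hq => ?_
      by_cases e : q = p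
      · subst e; simp
      · rw [Function.update_of_ne e]; exact hw q (by simp [e, hq])
    · intro h a w hw
      refine h w fun q hq => ?_
      simp only [List.mem_cons, not_or] at hq
      rw [hw q hq.2, Function.update_of_ne hq.1]

theorem Term.finite_vars {σ : L.Srt} (t : Term L σ) : t.vars.Finite := by
  induction t with
  | var p => exact Set.finite_singleton p
  | app g ts ih =>
    have : (Term.app g ts).vars = ⋃ i, (ts i).vars := by ext; simp [Term.vars]
    rw [this]
    exact Set.finite_iUnion ih

theorem Formula.finite_free (φ : Formula L) : φ.free.Finite := by
  induction φ with
  | fal => exact Set.finite_empty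
  | eq s t => exact s.finite_vars.union t.finite_vars
  | rel r ts =>
    have : (Formula.rel r ts).free = ⋃ i, (ts i).vars := by ext; simp [Formula.free]
    rw [this]
    exact Set.finite_iUnion fun i => (ts i).finite_vars
  | imp φ ψ ih₁ ih₂ => exact ih₁.union ih₂
  | all p φ ih => exact ih.subset Set.sdiff_subset
  | ex p φ ih => exact ih.subset Set.sdiff_subset

theorem Formula.free_alls (ps : List L.Vrb) (φ : Formula L) :
    (Formula.alls ps φ).free = φ.free \ {q | q ∈ ps} := by
  induction ps with
  | nil => simp [Formula.alls]
  | cons p ps ih =>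
    change (Formula.alls ps φ).free \ {p} = _
    rw [ih]; ext q; simp; tauto

/-- A formula whose truth value depends on the variables in `A` only is equivalent to one
with free variables in `A`. -/
theorem Formula.exists_free_subset (φ : Formula L) (A : Set L.Vrb) :
    ∃ ψ : Formula L, ψ.free ⊆ A ∧ ∀ M : Struc.{u} L,
      (∀ v w : M.Assign, (∀ q ∈ A, v q = w q) → M.Sat v φ → M.Sat w φ) →
        ∀ v : M.Assign, M.Sat v ψ ↔ M.Sat v φ := by
  classical
  -- The finitely many free variables outside `A` are quantified universally, which changes nothing
  -- if the truth value does not depend on them.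
  refine ⟨.alls ((φ.finite_free.subset (Set.sdiff_subset (t := A))).toFinset.toList) φ, ?_, ?_⟩
  · rw [Formula.free_alls]
    intro q hq
    by_contra hA
    exact hq.2 (by simpa using ⟨hq.1, hA⟩)
  · intro M hM v
    rw [Struc.sat_alls]
    refine ⟨fun h => h v fun _ _ => rfl, fun h w hw => hM v w (fun q hq => ?_) h⟩
    exact (hw q (by simp [hq])).symm

end Renaming

/-! ## Definability with parameters -/

section Definability

variable {L : Signature} {M : Struc.{u} L}

/-- The assignment that gives the even variables the values in `e` and the odd ones the values
in `v`. -/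
def Struc.mix (M : Struc.{u} L) (v e : M.Assign) : M.Assign :=
  fun p => if p.2 % 2 = 0 then e (p.1, p.2 / 2) else v (p.1, p.2 / 2)

theorem Struc.mix_even (v e : M.Assign) (σ : L.Srt) {n i : ℕ} (h : n = 2 * i) :
    M.mix v e (σ, n) = e (σ, i) := by
  have h₁ : n % 2 = 0 := by omega
  have h₂ : n / 2 = i := by omega
  change (if n % 2 = 0 then e (σ, n / 2) else v (σ, n / 2)) = e (σ, i)
  rw [if_pos h₁, h₂]

theorem Struc.mix_odd (v e : M.Assign) (σ : L.Srt) {n i : ℕ} (h : n = 2 * i + 1) :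
    M.mix v e (σ, n) = v (σ, i) := by
  have h₁ : ¬ n % 2 = 0 := by omega
  have h₂ : n / 2 = i := by omega
  change (if n % 2 = 0 then e (σ, n / 2) else v (σ, n / 2)) = v (σ, i)
  rw [if_neg h₁, h₂]

theorem Struc.assign_ext {v w : M.Assign} (h₀ : ∀ σ i, v (σ, 2 * i) = w (σ, 2 * i))
    (h₁ : ∀ σ i, v (σ, 2 * i + 1) = w (σ, 2 * i + 1)) : v = w := by
  funext ⟨σ, n⟩
  obtain ⟨i, rfl | rfl⟩ := Nat.even_or_odd' n
  exacts [h₀ σ i, h₁ σ i]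

/-- Renaming that makes the `i`-th family of parameters disjoint from the others. -/
def sepIndex (i n : ℕ) : ℕ := if n % 2 = 0 then n else 2 * Nat.pair i (n / 2) + 1

theorem sepIndex_even (i n : ℕ) : sepIndex i (2 * n) = 2 * n := by simp [sepIndex]

theorem sepIndex_odd (i n : ℕ) : sepIndex i (2 * n + 1) = 2 * Nat.pair i n + 1 := by
  have h : (2 * n + 1) / 2 = n := by omega
  simp [sepIndex, h]

theorem sepIndex_injective (i : ℕ) : Function.Injective (sepIndex i) := by
  intro m n h
  obtain ⟨a, rfl | rfl⟩ := Nat.even_or_odd' m <;> obtain ⟨b, rfl | rfl⟩ := Nat.even_or_odd' n <;>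
    simp only [sepIndex_even, sepIndex_odd] at h
  · exact h
  · omega
  · omega
  · have : Nat.pair i a = Nat.pair i b := by omega
    rw [(Nat.pair_eq_pair.1 this).2]

/-- Renaming that turns variable `0` into a parameter, to be bound by a quantifier. -/
def bindIndex (n : ℕ) : ℕ := if n = 0 then 1 else if n % 2 = 0 then n - 2 else n + 2

theorem bindIndex_injective : Function.Injective bindIndex := by
  intro m n h
  simp only [bindIndex] at h
  split_ifs at h <;> omega

/-- All parameters of countably many families, as one family. -/
def Struc.merge (v : ℕ → M.Assign) : M.Assign :=
  fun p => v p.2.unpair.1 (p.1, p.2.unpair.2)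

theorem Struc.mix_merge (v : ℕ → M.Assign) (e : M.Assign) (i : ℕ) :
    (fun p : L.Vrb => M.mix (Struc.merge v) e (p.1, sepIndex i p.2)) = M.mix (v i) e := by
  refine Struc.assign_ext (fun σ n => ?_) (fun σ n => ?_)
  · rw [Struc.mix_even _ _ _ rfl]
    exact Struc.mix_even _ _ _ (sepIndex_even i n)
  · rw [Struc.mix_odd _ _ _ rfl]
    refine (Struc.mix_odd _ _ _ (sepIndex_odd i n)).trans ?_
    change v (Nat.unpair (Nat.pair i n)).1 (σ, (Nat.unpair (Nat.pair i n)).2) = v i (σ, n)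
    rw [Nat.unpair_pair]

/-- `f` is given by a term with parameters. -/
class Tm (M : Struc.{u} L) {σ : L.Srt} (f : M.Assign → M.carrier σ) : Prop where
  out : ∃ (t : Term L σ) (v : M.Assign), ∀ e, f e = M.val (M.mix v e) t

/-- `P` is defined by a formula in `C` with parameters. -/
class Dfb (C : Set (Formula L)) (M : Struc.{u} L) (P : M.Assign → Prop) : Prop where
  out : ∃ φ ∈ C, ∃ v : M.Assign, ∀ e, P e ↔ M.Sat (M.mix v e) φ

def arith (ob : L.Srt) : Set (Formula L) := {φ | φ.Arithmetical ob}

def piCls (ob : L.Srt) (n : ℕ) : Set (Formula L) := {φ | IsPi ob n φ}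

def sgCls (ob : L.Srt) (n : ℕ) : Set (Formula L) := {φ | IsSigma ob n φ}

/-- A set of formulas that is closed under renaming of variables. -/
def RenClosed (C : Set (Formula L)) : Prop := ∀ φ ∈ C, ∀ f, φ.ren f ∈ C

theorem renClosed_arith (ob : L.Srt) : RenClosed (arith ob) :=
  fun _ h f => Formula.Arithmetical.ren f h

theorem renClosed_piCls (ob : L.Srt) (n : ℕ) : RenClosed (piCls ob n) :=
  fun φ h f => (isPi_isSigma_ren f φ n).1 h

theorem renClosed_univ : RenClosed (Set.univ : Set (Formula L)) := fun _ _ _ => trivial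

/-- Every element of the model may serve as a parameter, kept in the first odd variable. In this way
sets obtained by comprehension enter later definitions. -/
instance Tm.const {σ : L.Srt} (a : M.carrier σ) : Tm M (fun _ => a) := by
  classical
  refine ⟨.var (σ, 1), fun p => if h : σ = p.1 then h ▸ a else (M.nonempty p.1).some, fun e => ?_⟩
  have := Struc.mix_odd (M := M)
    (fun p => if h : σ = p.1 then h ▸ a else (M.nonempty p.1).some) e σ (n := 1) (i := 0) rfl
  rw [Struc.val, this]
  simp

instance Tm.var (σ : L.Srt) (i : ℕ) : Tm M (fun e => e (σ, i)) :=
  ⟨.var (σ, 2 * i), fun p => (M.nonempty p.1).some, fun e => (Struc.mix_even _ e σ rfl).symm⟩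

theorem Tm.fn (g : L.Fn) (f : (i : Fin (L.fnAr g)) → M.Assign → M.carrier (L.fnArg g i))
    (h : ∀ i, Tm M (f i)) : Tm M (fun e => M.fn g fun i => f i e) := by
  choose t v hv using fun i => (h i).out
  refine ⟨.app g fun i => (t i).ren (sepIndex i), Struc.merge fun n =>
    if hn : n < L.fnAr g then v ⟨n, hn⟩ else fun p => (M.nonempty p.1).some, fun e => ?_⟩
  simp only [Struc.val, Struc.val_ren, Struc.mix_merge, hv]
  simp

theorem Dfb.rel {ob : L.Srt} (r : L.Rl)
    (f : (i : Fin (L.rlAr r)) → M.Assign → M.carrier (L.rlArg r i))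
    (h : ∀ i, Tm M (f i)) : Dfb (arith ob) M (fun e => M.rl r fun i => f i e) := by
  choose t v hv using fun i => (h i).out
  refine ⟨.rel r fun i => (t i).ren (sepIndex i), trivial, Struc.merge fun n =>
    if hn : n < L.rlAr r then v ⟨n, hn⟩ else fun p => (M.nonempty p.1).some, fun e => ?_⟩
  simp only [Struc.Sat, Struc.val_ren, Struc.mix_merge, hv]
  simp

instance Dfb.eq {ob σ : L.Srt} (f g : M.Assign → M.carrier σ) [hf : Tm M f] [hg : Tm M g] :
    Dfb (arith ob) M (fun e => f e = g e) := by
  obtain ⟨s, v, hs⟩ := hf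
  obtain ⟨t, w, ht⟩ := hg
  refine ⟨.eq (s.ren (sepIndex 0)) (t.ren (sepIndex 1)), trivial,
    Struc.merge fun n => if n = 0 then v else w, fun e => ?_⟩
  simp only [Struc.Sat, Struc.val_ren, Struc.mix_merge, hs, ht]
  simp

theorem Dfb.imp' {C D : Set (Formula L)} {P Q : M.Assign → Prop} (hC : RenClosed C)
    (hD : ∀ φ ∈ C, ∀ ψ ∈ C, Formula.imp φ ψ ∈ D) (hP : Dfb C M P) (hQ : Dfb C M Q) :
    Dfb D M (fun e => P e → Q e) := by
  obtain ⟨φ, h₁, v, hφ⟩ := hP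
  obtain ⟨ψ, h₂, w, hψ⟩ := hQ
  refine ⟨.imp (φ.ren (sepIndex 0)) (ψ.ren (sepIndex 1)), hD _ (hC _ h₁ _) _ (hC _ h₂ _),
    Struc.merge fun n => if n = 0 then v else w, fun e => ?_⟩
  simp only [Struc.Sat, Struc.sat_ren (sepIndex_injective _), Struc.mix_merge, hφ, hψ]
  simp

theorem Dfb.congr {C : Set (Formula L)} {P Q : M.Assign → Prop} (hP : Dfb C M P)
    (h : ∀ e, Q e ↔ P e) : Dfb C M Q := by
  obtain ⟨φ, h₁, v, hφ⟩ := hP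
  exact ⟨φ, h₁, v, fun e => (h e).trans (hφ e)⟩

/-- The assignment without its first values. -/
abbrev Struc.Assign.tail (e : M.Assign) : M.Assign := fun p => e (p.1, p.2 + 1)

/-- `bindIndex` sends `0` to `1`, the other even indices one place down and the odd ones one place
up. Index `1` is thus free for the bound value, and the values of `e` become the tail of `e'`. For
sorts other than `τ` the value of `e'` at `0` is irrelevant. -/
theorem Struc.bind_aux (τ : L.Srt) (v e : M.Assign) (y : M.carrier τ) [DecidableEq L.Vrb] :
    ∃ e' : M.Assign, e'.tail = e ∧ e' (τ, 0) = y ∧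
      (fun q : L.Vrb => Function.update (M.mix (fun p => v (p.1, p.2 - 1)) e) (τ, 1) y
        (q.1, bindIndex q.2)) = M.mix v e' := by
  refine ⟨fun p => Function.update (M.mix (fun p => v (p.1, p.2 - 1)) e) (τ, 1) y
    (p.1, bindIndex (2 * p.2)), ?_, ?_, ?_⟩
  · funext ⟨σ, i⟩
    have h : bindIndex (2 * (i + 1)) = 2 * i := by simp [bindIndex, mul_add]
    have h' : ((σ, bindIndex (2 * (i + 1))) : L.Vrb) ≠ (τ, 1) := by simp [h]
    simp only [Struc.Assign.tail]
    rw [Function.update_of_ne h']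
    exact Struc.mix_even _ _ _ h
  · exact Function.update_self (β := fun p : L.Vrb => M.carrier p.1) (τ, 1) y _
  · refine Struc.assign_ext (fun σ n => ?_) (fun σ n => ?_)
    · rw [Struc.mix_even _ _ _ rfl]
    · have h : bindIndex (2 * n + 1) = 2 * (n + 1) + 1 := by
        simp [bindIndex, mul_add]
      have h' : ((σ, bindIndex (2 * n + 1)) : L.Vrb) ≠ (τ, 1) := by simp [h]
      rw [Struc.mix_odd _ _ _ rfl, Function.update_of_ne h', Struc.mix_odd _ _ _ h]
      rfl

/-- Binding in the style of de Bruijn: in the body, variable `0` of sort `τ` is the bound one and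
the tail is the outer assignment. Instance search can go through quantifiers in this form. -/
theorem Dfb.all' {C D : Set (Formula L)} {τ : L.Srt} {P : M.Assign → M.carrier τ → Prop}
    (hC : RenClosed C) (hD : ∀ φ ∈ C, ∀ i, Formula.all (τ, i) φ ∈ D)
    (h : Dfb C M (fun e => P e.tail (e (τ, 0)))) : Dfb D M (fun e => ∀ y, P e y) := by
  classical
  obtain ⟨φ, h₁, v, hφ⟩ := h
  refine ⟨.all (τ, 1) (φ.ren bindIndex), hD _ (hC _ h₁ _) _, fun p => v (p.1, p.2 - 1),
    fun e => forall_congr' fun y => ?_⟩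
  rw [Struc.sat_ren bindIndex_injective]
  obtain ⟨e', h₁, h₂, h₃⟩ := Struc.bind_aux τ v e y
  rw [← h₁, ← h₂, hφ, ← h₃, h₂]
  convert Iff.rfl

theorem Dfb.ex' {C D : Set (Formula L)} {τ : L.Srt} {P : M.Assign → M.carrier τ → Prop}
    (hC : RenClosed C) (hD : ∀ φ ∈ C, ∀ i, Formula.ex (τ, i) φ ∈ D)
    (h : Dfb C M (fun e => P e.tail (e (τ, 0)))) : Dfb D M (fun e => ∃ y, P e y) := by
  classical
  obtain ⟨φ, h₁, v, hφ⟩ := h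
  refine ⟨.ex (τ, 1) (φ.ren bindIndex), hD _ (hC _ h₁ _) _, fun p => v (p.1, p.2 - 1),
    fun e => exists_congr fun y => ?_⟩
  rw [Struc.sat_ren bindIndex_injective]
  obtain ⟨e', h₁, h₂, h₃⟩ := Struc.bind_aux τ v e y
  rw [← h₁, ← h₂, hφ, ← h₃, h₂]
  convert Iff.rfl

theorem Struc.mix_update (v e : M.Assign) (p : L.Vrb) (a : M.carrier p.1) [DecidableEq L.Vrb] :
    M.mix v (Function.update e p a) = Function.update (M.mix v e) (p.1, 2 * p.2) a := by
  refine Struc.assign_ext (fun σ n => ?_) (fun σ n => ?_)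
  · rw [Struc.mix_even _ _ _ rfl]
    by_cases h : (σ, n) = p
    · subst h
      rw [Function.update_self]
      exact (Function.update_self (β := fun p : L.Vrb => M.carrier p.1) (σ, 2 * n) a _).symm
    · rw [Function.update_of_ne h, Function.update_of_ne, Struc.mix_even _ _ _ rfl]
      exact fun h' => h (by simpa [Prod.ext_iff] using h')
  · rw [Struc.mix_odd _ _ _ rfl, Function.update_of_ne, Struc.mix_odd _ _ _ rfl]
    simp only [ne_eq, Prod.mk.injEq, not_and]
    omega

-- The counterpart of `Dfb.all'` that quantifies over a variable in place, as an induction on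
-- formulas needs it.
open Classical in
theorem Dfb.update_all {C D : Set (Formula L)} {P : M.Assign → Prop} (p : L.Vrb)
    (hD : ∀ φ ∈ C, ∀ i, Formula.all (p.1, i) φ ∈ D) (h : Dfb C M P) :
    Dfb D M (fun e => ∀ a, P (Function.update e p a)) := by
  obtain ⟨φ, h₁, v, hφ⟩ := h
  refine ⟨.all (p.1, 2 * p.2) φ, hD _ h₁ _, v, fun e => forall_congr' fun a => ?_⟩
  rw [hφ]
  rw [Struc.mix_update]

open Classical in
theorem Dfb.update_ex {C D : Set (Formula L)} {P : M.Assign → Prop} (p : L.Vrb)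
    (hD : ∀ φ ∈ C, ∀ i, Formula.ex (p.1, i) φ ∈ D) (h : Dfb C M P) :
    Dfb D M (fun e => ∃ a, P (Function.update e p a)) := by
  obtain ⟨φ, h₁, v, hφ⟩ := h
  refine ⟨.ex (p.1, 2 * p.2) φ, hD _ h₁ _, v, fun e => exists_congr fun a => ?_⟩
  rw [hφ]
  rw [Struc.mix_update]

end Definability

-- Closure properties of definability and growth of the hierarchy

section Closure

variable {L : Signature} {M : Struc.{u} L} {ob : L.Srt}

instance Dfb.false : Dfb (arith ob) M (fun _ => False) :=
  ⟨.fal, trivial, fun p => (M.nonempty p.1).some, fun _ => Iff.rfl⟩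

instance Dfb.imp (P Q : M.Assign → Prop) [hP : Dfb (arith ob) M P] [hQ : Dfb (arith ob) M Q] :
    Dfb (arith ob) M (fun e => P e → Q e) :=
  .imp' (renClosed_arith ob) (fun _ h _ h' => ⟨h, h'⟩) hP hQ

instance Dfb.not (P : M.Assign → Prop) [hP : Dfb (arith ob) M P] :
    Dfb (arith ob) M (fun e => ¬ P e) :=
  Dfb.imp P fun _ => False

instance Dfb.and (P Q : M.Assign → Prop) [hP : Dfb (arith ob) M P] [hQ : Dfb (arith ob) M Q] :
    Dfb (arith ob) M (fun e => P e ∧ Q e) :=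
  .congr (P := fun e => ¬ (P e → ¬ Q e)) inferInstance fun e => by tauto

instance Dfb.or (P Q : M.Assign → Prop) [hP : Dfb (arith ob) M P] [hQ : Dfb (arith ob) M Q] :
    Dfb (arith ob) M (fun e => P e ∨ Q e) :=
  .congr (P := fun e => ¬ P e → Q e) inferInstance fun e => by tauto

instance Dfb.iff (P Q : M.Assign → Prop) [hP : Dfb (arith ob) M P] [hQ : Dfb (arith ob) M Q] :
    Dfb (arith ob) M (fun e => P e ↔ Q e) :=
  .congr (P := fun e => (P e → Q e) ∧ (Q e → P e)) inferInstance fun e => by tauto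

instance Dfb.ne {σ : L.Srt} (f g : M.Assign → M.carrier σ) [Tm M f] [Tm M g] :
    Dfb (arith ob) M (fun e => f e ≠ g e) :=
  Dfb.not fun e => f e = g e

instance Dfb.all (P : M.Assign → M.carrier ob → Prop)
    [h : Dfb (arith ob) M (fun e => P e.tail (e (ob, 0)))] :
    Dfb (arith ob) M (fun e => ∀ y, P e y) :=
  .all' (renClosed_arith ob) (fun _ h _ => ⟨rfl, h⟩) h

instance Dfb.ex (P : M.Assign → M.carrier ob → Prop)
    [h : Dfb (arith ob) M (fun e => P e.tail (e (ob, 0)))] :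
    Dfb (arith ob) M (fun e => ∃ y, P e y) :=
  .ex' (renClosed_arith ob) (fun _ h _ => ⟨rfl, h⟩) h

theorem Dfb.all_pi {n : ℕ} {τ : L.Srt} (hτ : τ ≠ ob) (P : M.Assign → M.carrier τ → Prop)
    (h : Dfb (piCls ob (n + 1)) M (fun e => P e.tail (e (τ, 0)))) :
    Dfb (piCls ob (n + 1)) M (fun e => ∀ y, P e y) :=
  .all' (renClosed_piCls ob (n + 1)) (fun _ h _ => .all_same hτ h) h

/-- Weakening: the even indices move up one place to make room for a bound variable that is not
used. -/
theorem Dfb.tail {C : Set (Formula L)} (hC : RenClosed C) {P : M.Assign → Prop}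
    (h : Dfb C M P) : Dfb C M (fun e => P e.tail) := by
  obtain ⟨φ, h₁, v, hφ⟩ := h
  have hf : Function.Injective fun n : ℕ => if n % 2 = 0 then n + 2 else n := by
    intro m n h
    simp only at h
    split_ifs at h <;> omega
  refine ⟨φ.ren fun n => if n % 2 = 0 then n + 2 else n, hC _ h₁ _, v, fun e => ?_⟩
  rw [hφ, Struc.sat_ren hf]
  have : M.mix v e.tail = fun p : L.Vrb => M.mix v e
      (p.1, if p.2 % 2 = 0 then p.2 + 2 else p.2) := by
    refine Struc.assign_ext (fun σ n => ?_) (fun σ n => ?_)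
    · rw [Struc.mix_even _ _ _ rfl]
      have h' : (if 2 * n % 2 = 0 then 2 * n + 2 else 2 * n) = 2 * (n + 1) := by
        split_ifs <;> omega
      exact (Struc.mix_even (M := M) v e σ h').symm
    · rw [Struc.mix_odd _ _ _ rfl]
      have h' : (if (2 * n + 1) % 2 = 0 then 2 * n + 1 + 2 else 2 * n + 1) = 2 * n + 1 := by
        split_ifs <;> omega
      exact (Struc.mix_odd (M := M) v e σ h').symm
  rw [this]

/-- Quantifier blocks of `Π¹₁`-formulas are not empty, so a dummy quantifier is put in front; it is
harmless as no sort is empty. -/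
theorem Dfb.pi_of_arith {τ : L.Srt} (hτ : τ ≠ ob) (P : M.Assign → Prop)
    (h : Dfb (arith ob) M P) : Dfb (piCls ob 1) M P :=
  .congr (Dfb.all' (τ := τ) (P := fun e _ => P e) (renClosed_arith ob)
    (fun _ h _ => .all_succ hτ (.arith h)) (h.tail (renClosed_arith ob))) fun e => by
      have := M.nonempty τ
      simp

/-- Renaming of variables by a map that may depend on the sort. -/
def Term.reindex (g : L.Vrb → ℕ) : {σ : L.Srt} → Term L σ → Term L σ
  | _, .var p => .var (p.1, g p)
  | _, .app f ts => .app f fun i => (ts i).reindex g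

theorem Struc.val_reindex (g : L.Vrb → ℕ) (v : M.Assign) {σ : L.Srt} (t : Term L σ) :
    M.val v (t.reindex g) = M.val (fun p => v (p.1, g p)) t := by
  induction t with
  | var p => rfl
  | app f ts ih => simp only [Term.reindex, Struc.val, ih]

instance (priority := low) Tm.reindex {σ : L.Srt} (f : M.Assign → M.carrier σ) (g : L.Vrb → ℕ)
    [h : Tm M f] : Tm M (fun e => f (fun p => e (p.1, g p))) := by
  obtain ⟨t, v, h⟩ := h
  refine ⟨t.reindex fun p => if p.2 % 2 = 0 then 2 * g (p.1, p.2 / 2) else p.2, v, fun e => ?_⟩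
  rw [h, Struc.val_reindex]
  congr 1
  refine Struc.assign_ext (fun σ n => ?_) (fun σ n => ?_)
  · have h' : (if 2 * n % 2 = 0 then 2 * g (σ, 2 * n / 2) else 2 * n) = 2 * g (σ, n) := by
      simp
    rw [Struc.mix_even _ _ _ rfl]
    exact (Struc.mix_even (M := M) v e σ h').symm
  · have h' : (if (2 * n + 1) % 2 = 0 then 2 * g (σ, (2 * n + 1) / 2) else 2 * n + 1) =
        2 * n + 1 := by
      split_ifs <;> omega
    rw [Struc.mix_odd _ _ _ rfl]
    exact (Struc.mix_odd (M := M) v e σ h').symm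

/-- Without loss of generality, the variables number `1` are not free in a defining formula. -/
theorem Dfb.exists_fresh {C : Set (Formula L)} (hC : RenClosed C) {P : M.Assign → Prop}
    (h : Dfb C M P) : ∃ φ ∈ C, (∀ σ, (σ, 1) ∉ φ.free) ∧ ∃ v : M.Assign,
      ∀ e, P e ↔ M.Sat (M.mix v e) φ := by
  obtain ⟨φ, h₁, v, hφ⟩ := h
  -- The parameters move up one place, which clears index `1` in every sort for the set or relation
  -- that comprehension provides.
  have hf : Function.Injective fun n : ℕ => if n % 2 = 0 then n else n + 2 := by
    intro m n h
    simp only at h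
    split_ifs at h <;> omega
  refine ⟨φ.ren fun n => if n % 2 = 0 then n else n + 2, hC _ h₁ _, fun σ hσ => ?_,
    fun p => v (p.1, p.2 - 1), fun e => ?_⟩
  · obtain ⟨n, hn⟩ := Formula.free_ren _ _ hσ
    simp only at hn
    split_ifs at hn <;> omega
  · rw [hφ, Struc.sat_ren hf]
    have : M.mix v e = fun p : L.Vrb => M.mix (fun p => v (p.1, p.2 - 1)) e
        (p.1, if p.2 % 2 = 0 then p.2 else p.2 + 2) := by
      refine Struc.assign_ext (fun σ n => ?_) (fun σ n => ?_)
      · rw [Struc.mix_even _ _ _ rfl]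
        have h' : (if 2 * n % 2 = 0 then 2 * n else 2 * n + 2) = 2 * n := by
          split_ifs <;> omega
        exact (Struc.mix_even (M := M) (fun p => v (p.1, p.2 - 1)) e σ h').symm
      · rw [Struc.mix_odd _ _ _ rfl]
        have h' : (if (2 * n + 1) % 2 = 0 then 2 * n + 1 else 2 * n + 1 + 2) =
            2 * (n + 1) + 1 := by
          split_ifs <;> omega
        exact (Struc.mix_odd (M := M) (fun p => v (p.1, p.2 - 1)) e σ h').symm
    rw [this]

/-- The formulas of the comprehension schema: all formulas, or the `Π¹ₙ`-formulas. -/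
def cls (ob : L.Srt) : Option ℕ → Set (Formula L)
  | none => Set.univ
  | some n => piCls ob n

theorem renClosed_cls (c : Option ℕ) : RenClosed (cls ob c) := by
  cases c
  exacts [renClosed_univ, renClosed_piCls ob _]

/-- To raise the level but keep the kind of the leading quantifier, the dummy quantifier is added at
the arithmetical matrix. `P` will be logical equivalence. -/
theorem isPi_isSigma_succ (P : Formula L → Formula L → Prop)
    (hall : ∀ φ ψ p, P φ ψ → P (.all p φ) (.all p ψ)) (hex : ∀ φ ψ p, P φ ψ → P (.ex p φ) (.ex p ψ))
    (h₁ : ∀ φ, φ.Arithmetical ob → ∃ ψ, IsPi ob 1 ψ ∧ P φ ψ)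
    (h₂ : ∀ φ, φ.Arithmetical ob → ∃ ψ, IsSigma ob 1 ψ ∧ P φ ψ) (φ : Formula L) :
    ∀ n, (IsPi ob n φ → ∃ ψ, IsPi ob (n + 1) ψ ∧ P φ ψ) ∧
      (IsSigma ob n φ → ∃ ψ, IsSigma ob (n + 1) ψ ∧ P φ ψ) := by
  induction φ with
  | fal | eq | rel | imp =>
    intro n
    constructor <;> rintro ⟨h⟩
    exacts [h₁ _ h, h₂ _ h]
  | all p φ ih =>
    intro n
    constructor
    · rintro (h | ⟨h, h'⟩ | ⟨h, h'⟩)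
      · exact h₁ _ h
      · obtain ⟨ψ, hψ, hP⟩ := (ih _).1 h'
        exact ⟨_, .all_same h hψ, hall _ _ p hP⟩
      · obtain ⟨ψ, hψ, hP⟩ := (ih _).2 h'
        exact ⟨_, .all_succ h hψ, hall _ _ p hP⟩
    · rintro ⟨h⟩
      exact h₂ _ h
  | ex p φ ih =>
    intro n
    constructor
    · rintro ⟨h⟩
      exact h₁ _ h
    · rintro (h | ⟨h, h'⟩ | ⟨h, h'⟩)
      · exact h₂ _ h
      · obtain ⟨ψ, hψ, hP⟩ := (ih _).2 h'
        exact ⟨_, .ex_same h hψ, hex _ _ p hP⟩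
      · obtain ⟨ψ, hψ, hP⟩ := (ih _).1 h'
        exact ⟨_, .ex_succ h hψ, hex _ _ p hP⟩

theorem Formula.exists_dummy {τ : L.Srt} (φ : Formula L) :
    ∃ p : L.Vrb, p.1 = τ ∧ p ∉ φ.free := by
  obtain ⟨i, hi⟩ := (φ.finite_free.preimage (f := fun i : ℕ => (τ, i))
    (fun _ _ _ _ h => (Prod.mk.inj h).2)).exists_notMem
  exact ⟨(τ, i), rfl, hi⟩

open Classical in
theorem IsPi.exists_succ {τ : L.Srt} (hτ : τ ≠ ob) {n : ℕ} {φ : Formula L} (h : IsPi ob n φ) :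
    ∃ ψ, IsPi ob (n + 1) ψ ∧ ∀ (M : Struc.{u} L) (v : M.Assign), M.Sat v φ ↔ M.Sat v ψ := by
  have dummy : ∀ (M : Struc.{u} L) (v : M.Assign) (φ : Formula L) (p : L.Vrb)
      (a : M.carrier p.1), p ∉ φ.free → (M.Sat v φ ↔ M.Sat (Function.update v p a) φ) :=
    fun M v φ p a hp => Struc.sat_congr fun q hq => by
      rw [Function.update_of_ne (by rintro rfl; exact hp hq)]
  refine ((isPi_isSigma_succ (fun φ ψ => ∀ (M : Struc.{u} L) (v : M.Assign),
    M.Sat v φ ↔ M.Sat v ψ) ?_ ?_ ?_ ?_ φ) n).1 h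
  · exact fun φ ψ p h M v => forall_congr' fun a => h M _
  · exact fun φ ψ p h M v => exists_congr fun a => h M _
  · intro φ hφ
    obtain ⟨p, rfl, hp⟩ := φ.exists_dummy (τ := τ)
    refine ⟨_, .all_succ (p := p) hτ (.arith hφ), fun M v => ?_⟩
    have := M.nonempty p.1
    simp only [Struc.Sat, ← dummy M v φ p _ hp, forall_const]
  · intro φ hφ
    obtain ⟨p, rfl, hp⟩ := φ.exists_dummy (τ := τ)
    refine ⟨_, .ex_succ (p := p) hτ (.arith hφ), fun M v => ?_⟩
    have := M.nonempty p.1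
    simp only [Struc.Sat, ← dummy M v φ p _ hp, exists_const]

/-- This is where the level has to be positive: all the comprehension schemas under consideration
then include `Π¹₁`-comprehension, up to equivalence. -/
theorem Dfb.cls_of_pi {τ : L.Srt} (hτ : τ ≠ ob) {c : Option ℕ} (hc : c ≠ some 0)
    {P : M.Assign → Prop} (h : Dfb (piCls ob 1) M P) : Dfb (cls ob c) M P := by
  cases c with
  | none =>
    obtain ⟨φ, -, h'⟩ := h
    exact ⟨φ, trivial, h'⟩
  | some n =>
    induction n with
    | zero => exact absurd rfl hc
    | succ n ih =>
      cases n with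
      | zero => exact h
      | succ n =>
        obtain ⟨φ, hφ, v, hv⟩ := ih (by simp)
        obtain ⟨ψ, hψ, he⟩ := IsPi.exists_succ.{u} hτ hφ
        exact ⟨ψ, hψ, v, fun e => (hv e).trans (he M _)⟩

end Closure

/-! ## Transfer of definability -/

section Transfer

variable {K L : Signature} {M : Struc.{u} L} {N : Struc.{u} K} {obK : K.Srt} {obL : L.Srt}

-- Elements of `M` decode to elements of `N`, possibly with repetitions, but surjectively. A
-- quantifier over `N` thus becomes a quantifier over `M` without relativization to a domain, and
-- only atomic formulas need an argument.
open Classical in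
theorem Dfb.transfer_arith (D : M.Assign → N.Assign) (t : K.Vrb → L.Vrb)
    (dec : ∀ p, M.carrier (t p).1 → N.carrier p.1) (hdec : ∀ p, Function.Surjective (dec p))
    (hD : ∀ e p a, D (Function.update e (t p) a) = Function.update (D e) p (dec p a))
    (ht : ∀ p, p.1 = obK → (t p).1 = obL)
    (heq : ∀ (σ : K.Srt) (s s' : Term K σ),
      Dfb (arith obL) M (fun e => N.val (D e) s = N.val (D e) s'))
    (hrel : ∀ (r : K.Rl) (ts : (i : Fin (K.rlAr r)) → Term K (K.rlArg r i)),
      Dfb (arith obL) M (fun e => N.rl r fun i => N.val (D e) (ts i)))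
    {φ : Formula K} (h : φ.Arithmetical obK) : Dfb (arith obL) M (fun e => N.Sat (D e) φ) := by
  induction φ with
  | fal => exact Dfb.false
  | eq s t => exact heq _ s t
  | rel r ts => exact hrel r ts
  | imp φ ψ ih₁ ih₂ =>
    exact .imp' (renClosed_arith obL) (fun _ h _ h' => ⟨h, h'⟩) (ih₁ h.1) (ih₂ h.2)
  | all p φ ih =>
    refine .congr (Dfb.update_all (D := arith obL) (t p) (fun ψ hψ i => ⟨ht p h.1, hψ⟩) (ih h.2))
      fun e => ?_
    simp only [hD, Struc.Sat, (hdec p).forall]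
  | ex p φ ih =>
    refine .congr (Dfb.update_ex (D := arith obL) (t p) (fun ψ hψ i => ⟨ht p h.1, hψ⟩) (ih h.2))
      fun e => ?_
    simp only [hD, Struc.Sat, (hdec p).exists]

open Classical in
theorem Dfb.transfer_univ (D : M.Assign → N.Assign) (t : K.Vrb → L.Vrb)
    (dec : ∀ p, M.carrier (t p).1 → N.carrier p.1) (hdec : ∀ p, Function.Surjective (dec p))
    (hD : ∀ e p a, D (Function.update e (t p) a) = Function.update (D e) p (dec p a))
    (harith : ∀ φ : Formula K, φ.Arithmetical obK → Dfb (arith obL) M (fun e => N.Sat (D e) φ))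
    (φ : Formula K) : Dfb Set.univ M (fun e => N.Sat (D e) φ) := by
  have weaken : ∀ φ : Formula K, φ.Arithmetical obK →
      Dfb Set.univ M (fun e => N.Sat (D e) φ) := fun φ h => by
    obtain ⟨ψ, -, h'⟩ := harith φ h
    exact ⟨ψ, trivial, h'⟩
  induction φ with
  | fal | eq | rel => exact weaken _ trivial
  | imp φ ψ ih₁ ih₂ => exact .imp' renClosed_univ (fun _ _ _ _ => trivial) ih₁ ih₂
  | all p φ ih =>
    refine .congr (Dfb.update_all (t p) (fun _ _ _ => trivial) ih) fun e => ?_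
    simp only [hD, Struc.Sat, (hdec p).forall]
  | ex p φ ih =>
    refine .congr (Dfb.update_ex (t p) (fun _ _ _ => trivial) ih) fun e => ?_
    simp only [hD, Struc.Sat, (hdec p).exists]

-- As no guard is needed on set quantifiers, the prefix is translated quantifier by quantifier and
-- the level is kept. Compatibility with updates is required only for set and relation variables, so
-- `D` may rearrange the values of object variables; this is used for tuples.
open Classical in
theorem Dfb.transfer_pi_sigma (D : M.Assign → N.Assign) (t : K.Vrb → L.Vrb)
    (dec : ∀ p, M.carrier (t p).1 → N.carrier p.1) (hdec : ∀ p, Function.Surjective (dec p))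
    (hD : ∀ e p a, p.1 ≠ obK →
      D (Function.update e (t p) a) = Function.update (D e) p (dec p a))
    (ht : ∀ p, p.1 ≠ obK → (t p).1 ≠ obL)
    (harith : ∀ φ : Formula K, φ.Arithmetical obK → Dfb (arith obL) M (fun e => N.Sat (D e) φ))
    (φ : Formula K) : ∀ n,
      (IsPi obK n φ → Dfb (piCls obL n) M (fun e => N.Sat (D e) φ)) ∧
      (IsSigma obK n φ → Dfb (sgCls obL n) M (fun e => N.Sat (D e) φ)) := by
  have h₁ : ∀ φ : Formula K, φ.Arithmetical obK → Dfb (piCls obL 0) M (fun e => N.Sat (D e) φ) :=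
    fun φ h => by
      obtain ⟨ψ, hψ, h'⟩ := harith φ h
      exact ⟨ψ, .arith hψ, h'⟩
  have h₂ : ∀ φ : Formula K, φ.Arithmetical obK → Dfb (sgCls obL 0) M (fun e => N.Sat (D e) φ) :=
    fun φ h => by
      obtain ⟨ψ, hψ, h'⟩ := harith φ h
      exact ⟨ψ, .arith hψ, h'⟩
  induction φ with
  | fal | eq | rel | imp =>
    intro n
    constructor <;> rintro ⟨h⟩
    exacts [h₁ _ h, h₂ _ h]
  | all p φ ih =>
    intro n
    constructor
    · rintro (h | ⟨h, h'⟩ | ⟨h, h'⟩)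
      · exact h₁ _ h
      · refine .congr (Dfb.update_all (D := piCls obL _) (t p)
          (fun ψ hψ i => .all_same (ht p h) hψ) ((ih _).1 h')) fun e => ?_
        simp only [hD _ _ _ h, Struc.Sat, (hdec p).forall]
      · refine .congr (Dfb.update_all (D := piCls obL _) (t p)
          (fun ψ hψ i => .all_succ (ht p h) hψ) ((ih _).2 h')) fun e => ?_
        simp only [hD _ _ _ h, Struc.Sat, (hdec p).forall]
    · rintro ⟨h⟩
      exact h₂ _ h
  | ex p φ ih =>
    intro n
    constructor
    · rintro ⟨h⟩
      exact h₁ _ h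
    · rintro (h | ⟨h, h'⟩ | ⟨h, h'⟩)
      · exact h₂ _ h
      · refine .congr (Dfb.update_ex (D := sgCls obL _) (t p)
          (fun ψ hψ i => .ex_same (ht p h) hψ) ((ih _).2 h')) fun e => ?_
        simp only [hD _ _ _ h, Struc.Sat, (hdec p).exists]
      · refine .congr (Dfb.update_ex (D := sgCls obL _) (t p)
          (fun ψ hψ i => .ex_succ (ht p h) hψ) ((ih _).1 h')) fun e => ?_
        simp only [hD _ _ _ h, Struc.Sat, (hdec p).exists]

end Transfer

/-! ## Models of arithmetic -/

namespace PA

section Semantics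

variable {M : Struc.{u} sig}

instance : Zero (M.carrier Num) := ⟨M.fn Fns.zero fun i => i.elim0⟩

instance : Add (M.carrier Num) := ⟨fun a b => M.fn Fns.add ![a, b]⟩

instance : Mul (M.carrier Num) := ⟨fun a b => M.fn Fns.mul ![a, b]⟩

instance : LE (M.carrier Num) :=
  ⟨fun a b => M.rl Rls.le (fun | ⟨0, _⟩ => a | ⟨1, _⟩ => b)⟩

instance : Membership (M.carrier Num) (M.carrier Sets) :=
  ⟨fun X a => M.rl Rls.mem (fun | ⟨0, _⟩ => a | ⟨1, _⟩ => X)⟩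

/-- The successor function of a structure. -/
def suc (a : M.carrier Num) : M.carrier Num := M.fn Fns.succ fun _ => a

instance : One (M.carrier Num) := ⟨suc 0⟩

variable {v : M.Assign}

@[simp] theorem val_x (i : ℕ) : M.val v (x i) = v (Num, i) := rfl

@[simp] theorem val_X (i : ℕ) : M.val v (X i) = v (Sets, i) := rfl

@[simp] theorem val_zero : M.val v zero = 0 := congrArg (M.fn Fns.zero) (funext fun i => i.elim0)

@[simp] theorem val_succ (t : Term sig Num) : M.val v (succ t) = suc (M.val v t) := rfl

@[simp] theorem val_add (s t : Term sig Num) : M.val v (add s t) = M.val v s + M.val v t :=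
  congrArg (M.fn Fns.add) (funext fun i => by
    match i with
    | ⟨0, _⟩ => rfl
    | ⟨1, _⟩ => rfl)

@[simp] theorem val_mul (s t : Term sig Num) : M.val v (mul s t) = M.val v s * M.val v t :=
  congrArg (M.fn Fns.mul) (funext fun i => by
    match i with
    | ⟨0, _⟩ => rfl
    | ⟨1, _⟩ => rfl)

@[simp] theorem sat_le (s t : Term sig Num) : M.Sat v (le s t) ↔ M.val v s ≤ M.val v t :=
  iff_of_eq <| congrArg (M.rl Rls.le) (funext fun i => by
    match i with
    | ⟨0, _⟩ => rfl
    | ⟨1, _⟩ => rfl)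

@[simp] theorem sat_mem (s : Term sig Num) (t : Term sig Sets) :
    M.Sat v (mem s t) ↔ M.val v s ∈ M.val v t :=
  iff_of_eq <| congrArg (M.rl Rls.mem) (funext fun i => by
    match i with
    | ⟨0, _⟩ => rfl
    | ⟨1, _⟩ => rfl)

/-- Definability by arithmetical formulas with parameters. -/
abbrev Ar (M : Struc.{u} sig) (P : M.Assign → Prop) : Prop := Dfb (arith Num) M P

/-- Definability by `Π¹₁`-formulas with parameters. -/
abbrev Pi1 (M : Struc.{u} sig) (P : M.Assign → Prop) : Prop := Dfb (piCls Num 1) M P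

instance (P : M.Assign → Prop) [h : Ar M P] : Pi1 M P :=
  .pi_of_arith (τ := Sets) (by simp) P h

instance (P : M.Assign → M.carrier Sets → Prop)
    [h : Pi1 M (fun e => P e.tail (e (Sets, 0)))] : Pi1 M (fun e => ∀ Y, P e Y) :=
  .all_pi (by simp) P h

instance tm_suc (f : M.Assign → M.carrier Num) [h : Tm M f] : Tm M (fun e => suc (f e)) :=
  Tm.fn (M := M) Fns.succ (fun _ => f) fun _ => h

instance tm_add (f g : M.Assign → M.carrier Num) [hf : Tm M f] [hg : Tm M g] :
    Tm M (fun e => f e + g e) := by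
  have := Tm.fn (M := M) Fns.add ![f, g] (fun i => by
    match i with
    | ⟨0, _⟩ => exact hf
    | ⟨1, _⟩ => exact hg)
  convert this using 2 with e
  refine congrArg (M.fn Fns.add) (funext fun i => ?_)
  match i with
  | ⟨0, _⟩ => rfl
  | ⟨1, _⟩ => rfl

instance tm_mul (f g : M.Assign → M.carrier Num) [hf : Tm M f] [hg : Tm M g] :
    Tm M (fun e => f e * g e) := by
  have := Tm.fn (M := M) Fns.mul ![f, g] (fun i => by
    match i with
    | ⟨0, _⟩ => exact hf
    | ⟨1, _⟩ => exact hg)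
  convert this using 2 with e
  refine congrArg (M.fn Fns.mul) (funext fun i => ?_)
  match i with
  | ⟨0, _⟩ => rfl
  | ⟨1, _⟩ => rfl

instance ar_le (f g : M.Assign → M.carrier Num) [hf : Tm M f] [hg : Tm M g] :
    Ar M (fun e => f e ≤ g e) := by
  refine (Dfb.rel (M := M) (ob := Num) Rls.le (fun | ⟨0, _⟩ => f | ⟨1, _⟩ => g) (fun i => by
    match i with
    | ⟨0, _⟩ => exact hf
    | ⟨1, _⟩ => exact hg)).congr fun e => iff_of_eq <| congrArg (M.rl Rls.le) (funext fun i => ?_)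
  match i with
  | ⟨0, _⟩ => rfl
  | ⟨1, _⟩ => rfl

instance ar_mem (f : M.Assign → M.carrier Num) (g : M.Assign → M.carrier Sets)
    [hf : Tm M f] [hg : Tm M g] : Ar M (fun e => f e ∈ g e) := by
  refine (Dfb.rel (M := M) (ob := Num) Rls.mem (fun | ⟨0, _⟩ => f | ⟨1, _⟩ => g) (fun i => by
    match i with
    | ⟨0, _⟩ => exact hf
    | ⟨1, _⟩ => exact hg)).congr fun e => iff_of_eq <| congrArg (M.rl Rls.mem) (funext fun i => ?_)
  match i with
  | ⟨0, _⟩ => rfl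
  | ⟨1, _⟩ => rfl

end Semantics

/-- The semantic form of comprehension: number variable `0` runs over the members, and all other
variables keep their values in `e₀`. -/
theorem exists_set_of_schema {M : Struc.{u} sig} {c : Option ℕ} (hM : M.Models (schema (cls Num c)))
    {P : M.Assign → Prop} (hP : Dfb (cls Num c) M P) (e₀ : M.Assign) :
    ∃ F : M.carrier Sets, ∀ e : M.Assign, (∀ p, p ≠ (Num, 0) → e p = e₀ p) →
      (e (Num, 0) ∈ F ↔ P e) := by
  classical
  obtain ⟨φ, hφ, hfr, v, hv⟩ := hP.exists_fresh (renClosed_cls c)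
  obtain ⟨F, hF⟩ := hM _ ⟨1, 0, φ, hφ, hfr _, rfl⟩ (M.mix v e₀)
  refine ⟨F, fun e he => ?_⟩
  have h := hF (e (Num, 0))
  rw [Struc.sat_iff, sat_mem, val_x, val_X] at h
  rw [hv]
  simp only [Function.update_self, Function.update_of_ne (a := ((Sets, 1) : sig.Vrb))
    (a' := (Num, 0)) (by simp)] at h
  rw [h]
  refine Struc.sat_congr fun q hq => ?_
  have h₁ : q ≠ (Sets, 1) := fun h => hfr _ (h ▸ hq)
  have he' : e = Function.update e₀ (Num, 0) (e (Num, 0)) := by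
    funext p
    by_cases hp : p = (Num, 0)
    · subst hp; simp
    · rw [Function.update_of_ne hp, he p hp]
  rw [he', Struc.mix_update]
  by_cases h₂ : q = (Num, 0)
  · subst h₂; simp
  · rw [Function.update_of_ne h₂, Function.update_of_ne h₁]
    exact (Function.update_of_ne h₂ _ _).symm

/-- Models of the axioms other than comprehension that satisfy `Π¹₁`-comprehension. -/
class IsModel (M : Struc.{u} sig) : Prop where
  suc_ne_zero : ∀ a : M.carrier Num, suc a ≠ 0
  suc_inj : ∀ a b : M.carrier Num, suc a = suc b → a = b
  add_zero : ∀ a : M.carrier Num, a + 0 = a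
  add_suc : ∀ a b : M.carrier Num, a + suc b = suc (a + b)
  mul_zero : ∀ a : M.carrier Num, a * 0 = 0
  mul_suc : ∀ a b : M.carrier Num, a * suc b = a * b + a
  le_iff : ∀ a b : M.carrier Num, a ≤ b ↔ ∃ c, a + c = b
  ind : ∀ F : M.carrier Sets, 0 ∈ F → (∀ a : M.carrier Num, a ∈ F → suc a ∈ F) →
    ∀ a : M.carrier Num, a ∈ F
  ext : ∀ F G : M.carrier Sets, (∀ a : M.carrier Num, a ∈ F ↔ a ∈ G) → F = G
  compr : ∀ P : M.carrier Num → Prop, Pi1 M (fun e => P (e (Num, 0))) →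
    ∃ F : M.carrier Sets, ∀ a, a ∈ F ↔ P a

theorem isModel_of_models {M : Struc.{u} sig} {c : Option ℕ} (hc : c ≠ some 0)
    (hM : M.Models (base ∪ schema (cls Num c))) : IsModel M := by
  classical
  have hb : ∀ φ ∈ base, ∀ v, M.Sat v φ := fun φ hφ => hM φ (Or.inl hφ)
  have hs : M.Models (schema (cls Num c)) := fun φ hφ => hM φ (Or.inr hφ)
  let w : M.Assign := fun p => (M.nonempty p.1).some
  let w₂ (a b : M.carrier Num) : M.Assign :=
    Function.update (Function.update w (Num, 0) a) (Num, 1) b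
  have e0 : ∀ a b, w₂ a b (Num, 0) = a := fun a b => by
    simp only [w₂]; rw [Function.update_of_ne (by simp)]; simp
  have e1 : ∀ a b, w₂ a b (Num, 1) = b := fun a b => by simp [w₂]
  constructor
  · intro a
    simpa [q1, Struc.sat_neg, Struc.Sat, e0] using hb q1 (by simp [base]) (w₂ a a)
  · intro a b
    simpa [q2, Struc.Sat, e0, e1] using hb q2 (by simp [base]) (w₂ a b)
  · intro a
    simpa [q4, Struc.Sat, e0, e1] using hb q4 (by simp [base]) (w₂ a a)
  · intro a b
    simpa [q5, Struc.Sat, e0, e1] using hb q5 (by simp [base]) (w₂ a b)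
  · intro a
    simpa [q6, Struc.Sat, e0, e1] using hb q6 (by simp [base]) (w₂ a a)
  · intro a b
    simpa [q7, Struc.Sat, e0, e1] using hb q7 (by simp [base]) (w₂ a b)
  · intro a b
    simpa [q8, Struc.Sat, Struc.sat_iff, e0, e1, Function.update] using
      hb q8 (by simp [base]) (w₂ a b)
  · intro F h₀ h₁
    have := hb induction (by simp [base]) w F
    simp [Struc.Sat, Struc.sat_and, Function.update] at this
    exact this h₀ h₁
  · intro F G h
    have := hb extensionality (by simp [base])
      (Function.update (Function.update w (Sets, 0) F) (Sets, 1) G)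
    simp [extensionality, Struc.Sat, Struc.sat_iff, Function.update] at this
    exact this h
  · intro P hP
    obtain ⟨F, hF⟩ := exists_set_of_schema hs
      (Dfb.cls_of_pi (τ := Sets) (by simp) hc hP) w
    refine ⟨F, fun a => ?_⟩
    have := hF (Function.update w (Num, 0) a) fun p hp => Function.update_of_ne hp _ _
    simpa using this

-- The ordered semiring of numbers and its pairing function

section Arithmetic

variable {M : Struc.{u} sig} [IsModel M]

theorem add_one' (a : M.carrier Num) : a + 1 = suc a := by
  change a + suc 0 = _
  rw [IsModel.add_suc, IsModel.add_zero]

/-- Comprehension turns `P` into a set, to which the induction axiom applies. That `P` is definable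
is left to instance search. -/
theorem induct (P : M.carrier Num → Prop) [hP : Pi1 M (fun e => P (e (Num, 0)))] (h₀ : P 0)
    (h₁ : ∀ a, P a → P (a + 1)) (a : M.carrier Num) : P a := by
  obtain ⟨F, hF⟩ := IsModel.compr P hP
  rw [← hF]
  refine IsModel.ind F ((hF 0).2 h₀) (fun a ha => ?_) a
  rw [← add_one', hF]
  exact h₁ a ((hF a).1 ha)

instance : AddCommMonoid (M.carrier Num) :=
  have zero_add' : ∀ a : M.carrier Num, 0 + a = a := induct (fun a => 0 + a = a)
    (IsModel.add_zero 0) fun a h => by rw [add_one', IsModel.add_suc, h]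
  have add_assoc' : ∀ a b c : M.carrier Num, a + b + c = a + (b + c) := fun a b =>
    induct (fun c => a + b + c = a + (b + c)) (by simp only [IsModel.add_zero])
      fun c h => by simp only [add_one', IsModel.add_suc, h]
  have suc_add : ∀ a b : M.carrier Num, suc a + b = suc (a + b) := fun a =>
    induct (fun b => suc a + b = suc (a + b)) (by simp only [IsModel.add_zero])
      fun b h => by simp only [add_one', IsModel.add_suc, h]
  { add_assoc := add_assoc'
    zero_add := zero_add'
    add_zero := IsModel.add_zero
    add_comm := fun a => induct (fun b => a + b = b + a)
      (by rw [IsModel.add_zero, zero_add']) fun b h => by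
        simp only [add_one', IsModel.add_suc, suc_add, h]
    nsmul := nsmulRec }

instance : CommSemiring (M.carrier Num) :=
  have zero_mul' : ∀ a : M.carrier Num, 0 * a = 0 := induct (fun a => 0 * a = 0)
    (IsModel.mul_zero 0) fun a h => by rw [add_one', IsModel.mul_suc, h, IsModel.add_zero]
  have suc_mul : ∀ a b : M.carrier Num, suc a * b = a * b + b := fun a =>
    induct (fun b => suc a * b = a * b + b) (by simp only [IsModel.mul_zero, add_zero])
      fun b h => by
        simp only [add_one', IsModel.mul_suc, h, IsModel.add_suc]
        rw [add_right_comm]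
  have mul_comm' : ∀ a b : M.carrier Num, a * b = b * a := fun a =>
    induct (fun b => a * b = b * a) (by rw [IsModel.mul_zero, zero_mul']) fun b h => by
      rw [add_one', IsModel.mul_suc, suc_mul, h]
  have mul_add' : ∀ a b c : M.carrier Num, a * (b + c) = a * b + a * c := fun a b =>
    induct (fun c => a * (b + c) = a * b + a * c)
      (by simp only [IsModel.mul_zero, add_zero]) fun c h => by
        simp only [add_one', IsModel.mul_suc, IsModel.add_suc, h, add_assoc]
  have mul_one' : ∀ a : M.carrier Num, a * 1 = a := fun a => by
    change a * suc 0 = a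
    rw [IsModel.mul_suc, IsModel.mul_zero, zero_add]
  { left_distrib := mul_add'
    right_distrib := fun a b c => by
      rw [mul_comm', mul_add', mul_comm' c a, mul_comm' c b]
    zero_mul := zero_mul'
    mul_zero := IsModel.mul_zero
    mul_assoc := fun a b => induct (fun c => a * b * c = a * (b * c))
      (by simp only [IsModel.mul_zero]) fun c h => by
        simp only [add_one', IsModel.mul_suc, mul_add', h]
    one_mul := fun a => by rw [mul_comm', mul_one']
    mul_one := mul_one'
    mul_comm := mul_comm'
    natCast := Nat.unaryCast
    nsmul := nsmulRec }

theorem add_one_ne_zero (a : M.carrier Num) : a + 1 ≠ 0 := by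
  rw [add_one']; exact IsModel.suc_ne_zero a

/-- Induction gives this axiom of Robinson's arithmetic, which is therefore not among the fields of
`IsModel`. -/
theorem eq_zero_or_add_one (a : M.carrier Num) : a = 0 ∨ ∃ b, a = b + 1 :=
  induct (fun a => a = 0 ∨ ∃ b, a = b + 1) (Or.inl rfl) (fun a _ => Or.inr ⟨a, rfl⟩) a

theorem add_right_cancel' {a b c : M.carrier Num} : a + c = b + c → a = b :=
  induct (fun c => a + c = b + c → a = b) (by simp) (fun c ih h => ih <| by
    rw [← add_assoc, ← add_assoc, add_one', add_one'] at h
    exact IsModel.suc_inj _ _ h) c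

instance : IsCancelAdd (M.carrier Num) :=
  { add_left_cancel := fun a b c h => add_right_cancel' (c := a) (by
      simpa only [add_comm _ a] using h)
    add_right_cancel := fun _ _ _ h => add_right_cancel' h }

theorem eq_zero_of_add {a b : M.carrier Num} (h : a + b = 0) : b = 0 := by
  obtain rfl | ⟨c, rfl⟩ := eq_zero_or_add_one b
  · rfl
  · rw [← add_assoc] at h
    exact absurd h (add_one_ne_zero _)

noncomputable instance : LinearOrder (M.carrier Num) where
  le_refl a := (IsModel.le_iff a a).2 ⟨0, add_zero a⟩
  le_trans a b c h h' := by
    obtain ⟨d, rfl⟩ := (IsModel.le_iff a b).1 h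
    obtain ⟨d', rfl⟩ := (IsModel.le_iff _ c).1 h'
    exact (IsModel.le_iff _ _).2 ⟨d + d', (add_assoc _ _ _).symm⟩
  le_antisymm a b h h' := by
    obtain ⟨d, rfl⟩ := (IsModel.le_iff a b).1 h
    obtain ⟨d', h₁⟩ := (IsModel.le_iff _ a).1 h'
    rw [add_assoc] at h₁
    have := add_left_cancel (h₁.trans (add_zero a).symm)
    rw [add_comm] at this
    rw [eq_zero_of_add this, add_zero]
  le_total a b := by
    refine induct (fun b => a ≤ b ∨ b ≤ a) (Or.inr ((IsModel.le_iff _ _).2 ⟨a, zero_add a⟩))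
      (fun b h => ?_) b
    rcases h with h | h
    · obtain ⟨d, rfl⟩ := (IsModel.le_iff a b).1 h
      exact Or.inl ((IsModel.le_iff _ _).2 ⟨d + 1, (add_assoc _ _ _).symm⟩)
    · obtain ⟨d, rfl⟩ := (IsModel.le_iff b a).1 h
      obtain rfl | ⟨c, rfl⟩ := eq_zero_or_add_one d
      · exact Or.inl ((IsModel.le_iff _ _).2 ⟨1, by rw [add_zero]⟩)
      · exact Or.inr ((IsModel.le_iff _ _).2 ⟨c, by rw [add_assoc, add_comm 1]⟩)
  toDecidableLE := Classical.decRel _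

instance : CanonicallyOrderedAdd (M.carrier Num) where
  exists_add_of_le {a b} h := by
    obtain ⟨c, rfl⟩ := (IsModel.le_iff a b).1 h
    exact ⟨c, rfl⟩
  le_self_add a b := (IsModel.le_iff _ _).2 ⟨b, rfl⟩
  le_add_self a b := (IsModel.le_iff _ _).2 ⟨b, add_comm _ _⟩

instance : IsOrderedRing (M.carrier Num) := CanonicallyOrderedAdd.toIsOrderedRing

instance : IsOrderedCancelAddMonoid (M.carrier Num) where
  le_of_add_le_add_left a b c h := by
    obtain ⟨d, hd⟩ := (IsModel.le_iff _ _).1 h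
    rw [add_assoc] at hd
    exact (IsModel.le_iff _ _).2 ⟨d, add_left_cancel hd⟩

theorem lt_add_one' (a : M.carrier Num) : a < a + 1 := by
  refine lt_of_le_of_ne le_self_add fun h => ?_
  have : a + 0 = a + 1 := by rw [add_zero]; exact h
  exact add_one_ne_zero (0 : M.carrier Num) (by rw [zero_add]; exact (add_left_cancel this).symm)

theorem lt_iff_add_one_le {a b : M.carrier Num} : a < b ↔ a + 1 ≤ b := by
  refine ⟨fun h => ?_, fun h => (lt_add_one' a).trans_le h⟩
  obtain ⟨c, rfl⟩ := (IsModel.le_iff a b).1 h.le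
  obtain rfl | ⟨d, rfl⟩ := eq_zero_or_add_one c
  · rw [add_zero] at h; exact absurd h (lt_irrefl _)
  · exact (IsModel.le_iff _ _).2 ⟨d, by rw [add_assoc, add_comm 1]⟩

theorem lt_add_one_iff {a b : M.carrier Num} : a < b + 1 ↔ a ≤ b := by
  rw [lt_iff_add_one_le, add_le_add_iff_right]

instance ar_lt (f g : M.Assign → M.carrier Num) [Tm M f] [Tm M g] :
    Ar M (fun e => f e < g e) :=
  Dfb.congr (P := fun e => ¬ g e ≤ f e) inferInstance fun _ => not_le.symm

/-- A pairing function. -/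
def pair (a b : M.carrier Num) : M.carrier Num := (a + b) * (a + b) + a

instance tm_pair (f g : M.Assign → M.carrier Num) [Tm M f] [Tm M g] :
    Tm M (fun e => pair (f e) (g e)) :=
  inferInstanceAs (Tm M fun e => (f e + g e) * (f e + g e) + f e)

/-- Pairs with sum `s` have codes between `s²` and `s² + s`, which is less than `(s + 1)²`; so
different sums occupy disjoint intervals. -/
theorem pair_lt {a b c d : M.carrier Num} (h : a + b < c + d) : pair a b < pair c d := by
  have h₁ : a + b + 1 ≤ c + d := lt_iff_add_one_le.1 h
  calc pair a b ≤ (a + b) * (a + b) + (a + b) := add_le_add_right le_self_add _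
    _ < (a + b) * (a + b) + (a + b) + (a + b + 1) :=
      (lt_add_one' _).trans_le (by gcongr; exact le_add_self)
    _ = (a + b + 1) * (a + b + 1) := by ring
    _ ≤ (c + d) * (c + d) := mul_le_mul' h₁ h₁
    _ ≤ pair c d := le_self_add

theorem pair_inj {a b c d : M.carrier Num} : pair a b = pair c d ↔ a = c ∧ b = d := by
  refine ⟨fun h => ?_, fun h => by rw [h.1, h.2]⟩
  rcases lt_trichotomy (a + b) (c + d) with h' | h' | h'
  · exact absurd h (pair_lt h').ne
  · rw [pair, pair, h'] at h
    have h₁ := add_left_cancel h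
    rw [h₁] at h'
    exact ⟨h₁, add_left_cancel h'⟩
  · exact absurd h (pair_lt h').ne'

end Arithmetic

end PA

namespace PA

/-! ## Counting -/

section Counting

variable {M : Struc.{u} sig}

variable [IsModel M]

/-- `F` contains the pairs `(n, number of elements of X below n)`. -/
def CountClosed (X F : M.carrier Sets) : Prop :=
  pair 0 0 ∈ F ∧ ∀ n m : M.carrier Num, pair n m ∈ F →
    (n ∈ X → pair (n + 1) (m + 1) ∈ F) ∧ (¬ n ∈ X → pair (n + 1) m ∈ F)

/-- `F` is the graph of the function that counts the elements of `X`. -/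
def IsCount (X F : M.carrier Sets) : Prop :=
  CountClosed X F ∧ ∀ n m k : M.carrier Num, pair n m ∈ F → pair n k ∈ F → m = k

instance ar_countClosed (f g : M.Assign → M.carrier Sets) [Tm M f] [Tm M g] :
    Ar M (fun e => CountClosed (f e) (g e)) := by
  unfold CountClosed; infer_instance

instance ar_isCount (f g : M.Assign → M.carrier Sets) [Tm M f] [Tm M g] :
    Ar M (fun e => IsCount (f e) (g e)) := by
  unfold IsCount; infer_instance

theorem exists_isCount (X : M.carrier Sets) : ∃ F, IsCount X F := by
  -- The intersection of all closed sets is `Π¹₁`, hence a set.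
  obtain ⟨F, hF⟩ := IsModel.compr (M := M) (fun z => ∀ Y, CountClosed X Y → z ∈ Y) inferInstance
  have hc : CountClosed X F := by
    refine ⟨(hF _).2 fun Y hY => hY.1, fun n m h => ⟨fun hn => ?_, fun hn => ?_⟩⟩
    · exact (hF _).2 fun Y hY => (hY.2 n m ((hF _).1 h Y hY)).1 hn
    · exact (hF _).2 fun Y hY => (hY.2 n m ((hF _).1 h Y hY)).2 hn
  -- Inversion: `G` consists of what one closure clause yields from `F`. It is closed, so by
  -- minimality every member of `F` arises from a clause.
  obtain ⟨G, hG⟩ := IsModel.compr (M := M) (fun z => z = pair 0 0 ∨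
    ∃ n m, pair n m ∈ F ∧ ((n ∈ X ∧ z = pair (n + 1) (m + 1)) ∨ (¬ n ∈ X ∧ z = pair (n + 1) m)))
    inferInstance
  have hGF : ∀ z, z ∈ G → z ∈ F := by
    intro z hz
    obtain rfl | ⟨n, m, h, ⟨hn, rfl⟩ | ⟨hn, rfl⟩⟩ := (hG z).1 hz
    exacts [hc.1, (hc.2 n m h).1 hn, (hc.2 n m h).2 hn]
  have hFG : ∀ z, z ∈ F → z ∈ G := fun z hz => (hF z).1 hz G
    ⟨(hG _).2 (Or.inl rfl), fun n m h => ⟨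
      fun hn => (hG _).2 (Or.inr ⟨n, m, hGF _ h, Or.inl ⟨hn, rfl⟩⟩),
      fun hn => (hG _).2 (Or.inr ⟨n, m, hGF _ h, Or.inr ⟨hn, rfl⟩⟩)⟩⟩
  have h0 : ∀ m, pair 0 m ∈ F → m = 0 := by
    intro m h
    rcases (hG _).1 (hFG _ h) with h | ⟨n, k, -, ⟨-, h⟩ | ⟨-, h⟩⟩
    · exact (pair_inj.1 h).2
    · exact absurd (pair_inj.1 h).1.symm (add_one_ne_zero n)
    · exact absurd (pair_inj.1 h).1.symm (add_one_ne_zero n)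
  have h1 : ∀ n m, pair (n + 1) m ∈ F →
      ∃ k, pair n k ∈ F ∧ ((n ∈ X ∧ m = k + 1) ∨ (¬ n ∈ X ∧ m = k)) := by
    intro n m h
    rcases (hG _).1 (hFG _ h) with h | ⟨n', k, hk, ⟨hn, h⟩ | ⟨hn, h⟩⟩
    · exact absurd (pair_inj.1 h).1 (add_one_ne_zero n)
    · obtain rfl := add_right_cancel (pair_inj.1 h).1
      exact ⟨k, hk, Or.inl ⟨hn, (pair_inj.1 h).2⟩⟩
    · obtain rfl := add_right_cancel (pair_inj.1 h).1
      exact ⟨k, hk, Or.inr ⟨hn, (pair_inj.1 h).2⟩⟩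
  refine ⟨F, hc, induct (fun n => ∀ m k, pair n m ∈ F → pair n k ∈ F → m = k) ?_ ?_⟩
  · intro m k h h'
    rw [h0 m h, h0 k h']
  · intro n ih m k h h'
    obtain ⟨m', hm, h₁⟩ := h1 n m h
    obtain ⟨k', hk, h₂⟩ := h1 n k h'
    obtain rfl := ih m' k' hm hk
    rcases h₁ with ⟨h₁, rfl⟩ | ⟨h₁, rfl⟩ <;> rcases h₂ with ⟨h₂, rfl⟩ | ⟨h₂, rfl⟩
    · rfl
    · exact absurd h₁ h₂
    · exact absurd h₂ h₁
    · rfl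

theorem exists_count (X : M.carrier Sets) : ∃ (c : M.carrier Num → M.carrier Num)
    (F : M.carrier Sets), IsCount X F ∧ ∀ n m, pair n m ∈ F ↔ c n = m := by
  obtain ⟨F, hF⟩ := exists_isCount X
  have : ∀ n, ∃ m, pair n m ∈ F := induct (fun n => ∃ m, pair n m ∈ F) ⟨0, hF.1.1⟩ fun n ⟨m, h⟩ => by
    by_cases hn : n ∈ X
    · exact ⟨_, (hF.1.2 n m h).1 hn⟩
    · exact ⟨_, (hF.1.2 n m h).2 hn⟩
  choose c hc using this
  exact ⟨c, F, hF, fun n m => ⟨fun h => hF.2 n _ _ (hc n) h, fun h => h ▸ hc n⟩⟩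

/-- The number of elements of `X` below `n`. -/
noncomputable def cnt (X : M.carrier Sets) : M.carrier Num → M.carrier Num :=
  (exists_count X).choose

theorem exists_graph_cnt (X : M.carrier Sets) :
    ∃ F, IsCount X F ∧ ∀ n m, pair n m ∈ F ↔ cnt X n = m :=
  (exists_count X).choose_spec

theorem cnt_zero (X : M.carrier Sets) : cnt X 0 = 0 := by
  obtain ⟨F, hF, h⟩ := exists_graph_cnt X
  exact (h _ _).1 hF.1.1

theorem cnt_add_one_of_mem {X : M.carrier Sets} {n : M.carrier Num} (hn : n ∈ X) :
    cnt X (n + 1) = cnt X n + 1 := by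
  obtain ⟨F, hF, h⟩ := exists_graph_cnt X
  exact (h _ _).1 ((hF.1.2 n _ ((h _ _).2 rfl)).1 hn)

theorem cnt_add_one_of_notMem {X : M.carrier Sets} {n : M.carrier Num} (hn : ¬ n ∈ X) :
    cnt X (n + 1) = cnt X n := by
  obtain ⟨F, hF, h⟩ := exists_graph_cnt X
  exact (h _ _).1 ((hF.1.2 n _ ((h _ _).2 rfl)).2 hn)

/-- A counting graph may contain numbers that code no pair, so uniqueness concerns pairs only. By
induction, two graphs share a value at every argument. -/
theorem IsCount.mem_iff {X F : M.carrier Sets} (hF : IsCount X F) (n m : M.carrier Num) :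
    pair n m ∈ F ↔ cnt X n = m := by
  obtain ⟨G, hG, hc⟩ := exists_graph_cnt X
  have key : ∀ n, ∃ m, pair n m ∈ F ∧ pair n m ∈ G :=
    induct (fun n => ∃ m, pair n m ∈ F ∧ pair n m ∈ G) ⟨0, hF.1.1, hG.1.1⟩ fun n ⟨m, h, h'⟩ => by
      by_cases hn : n ∈ X
      · exact ⟨_, (hF.1.2 n m h).1 hn, (hG.1.2 n m h').1 hn⟩
      · exact ⟨_, (hF.1.2 n m h).2 hn, (hG.1.2 n m h').2 hn⟩
  obtain ⟨k, h₁, h₂⟩ := key n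
  rw [(hc n k).1 h₂]
  exact ⟨fun h => hF.2 n _ _ h₁ h, fun h => h ▸ h₁⟩

/-- The set `X` is fixed, so its counting graph can be a parameter. A set that varies with the
assignment is not covered; inductions over varying sets have to mention `IsCount` instead. -/
instance ar_cnt_eq (X : M.carrier Sets) (f g : M.Assign → M.carrier Num) [Tm M f] [Tm M g] :
    Ar M (fun e => cnt X (f e) = g e) := by
  obtain ⟨F, -, h⟩ := exists_graph_cnt X
  simp only [← h]
  infer_instance

instance ar_lt_cnt (X : M.carrier Sets) (f g : M.Assign → M.carrier Num) [Tm M f] [Tm M g] :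
    Ar M (fun e => g e < cnt X (f e)) :=
  Dfb.congr (P := fun e => ∃ m, cnt X (f e) = m ∧ g e < m) inferInstance (by simp)

instance ar_le_cnt (X : M.carrier Sets) (f g : M.Assign → M.carrier Num) [Tm M f] [Tm M g] :
    Ar M (fun e => g e ≤ cnt X (f e)) :=
  Dfb.congr (P := fun e => ∃ m, cnt X (f e) = m ∧ g e ≤ m) inferInstance (by simp)

instance ar_cnt_eq_cnt (X Y : M.carrier Sets) (f g : M.Assign → M.carrier Num) [Tm M f]
    [Tm M g] : Ar M (fun e => cnt X (f e) = cnt Y (g e)) :=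
  Dfb.congr (P := fun e => ∃ m, cnt X (f e) = m ∧ cnt Y (g e) = m) inferInstance (by simp [eq_comm])

theorem cnt_le_add_one (X : M.carrier Sets) (n : M.carrier Num) : cnt X n ≤ cnt X (n + 1) := by
  by_cases hn : n ∈ X
  · rw [cnt_add_one_of_mem hn]; exact le_self_add
  · rw [cnt_add_one_of_notMem hn]

theorem cnt_mono (X : M.carrier Sets) {n k : M.carrier Num} (h : n ≤ k) : cnt X n ≤ cnt X k := by
  obtain ⟨d, rfl⟩ := exists_add_of_le h
  refine induct (fun d => cnt X n ≤ cnt X (n + d)) (by rw [add_zero]) (fun d ih => ?_) d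
  rw [← add_assoc]
  exact ih.trans (cnt_le_add_one X _)

theorem cnt_lt_cnt {X : M.carrier Sets} {n k : M.carrier Num} (hn : n ∈ X) (h : n < k) :
    cnt X n < cnt X k := by
  rw [lt_iff_add_one_le, ← cnt_add_one_of_mem hn]
  exact cnt_mono X (lt_iff_add_one_le.1 h)

theorem cnt_injOn {X : M.carrier Sets} {n k : M.carrier Num} (hn : n ∈ X) (hk : k ∈ X)
    (h : cnt X n = cnt X k) : n = k := by
  rcases lt_trichotomy n k with h' | h' | h'
  exacts [absurd h (cnt_lt_cnt hn h').ne, h', absurd h (cnt_lt_cnt hk h').ne']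

/-- A discrete intermediate value argument: counts start at `0` and grow by at most one, and they
grow exactly at elements of `X`. -/
theorem exists_cnt_eq {X : M.carrier Sets} {m n : M.carrier Num} :
    m < cnt X n → ∃ x, x ∈ X ∧ cnt X x = m := by
  refine induct (fun n => m < cnt X n → ∃ x, x ∈ X ∧ cnt X x = m) (fun h => ?_)
    (fun n ih h => ?_) n
  · rw [cnt_zero] at h; exact absurd h not_lt_zero
  · by_cases hn : n ∈ X
    · rw [cnt_add_one_of_mem hn, lt_add_one_iff] at h
      rcases h.lt_or_eq with h | h
      exacts [ih h, ⟨n, hn, h.symm⟩]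
    · rw [cnt_add_one_of_notMem hn] at h
      exact ih h

theorem cnt_le_cnt_of_subset {X Y : M.carrier Sets} (h : ∀ a, a ∈ X → a ∈ Y)
    (n : M.carrier Num) : cnt X n ≤ cnt Y n := by
  -- The intermediate `m` brings the inequality into a form that the definability instances
  -- recognize.
  refine (induct (fun n => ∃ m, cnt X n = m ∧ m ≤ cnt Y n) ?_ ?_ n).elim fun m hm => hm.1 ▸ hm.2
  · exact ⟨0, cnt_zero X, by rw [cnt_zero]⟩
  · rintro n ⟨m, rfl, hm⟩
    refine ⟨_, rfl, ?_⟩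
    by_cases hn : n ∈ X
    · rw [cnt_add_one_of_mem hn, cnt_add_one_of_mem (h n hn)]
      gcongr
    · rw [cnt_add_one_of_notMem hn]
      exact hm.trans (cnt_le_add_one Y n)

theorem cnt_insert {Z W : M.carrier Sets} {y : M.carrier Num} (hy : ¬ y ∈ Z)
    (hW : ∀ a, a ∈ W ↔ a ∈ Z ∨ a = y) (n : M.carrier Num) :
    (n ≤ y → cnt W n = cnt Z n) ∧ (y < n → cnt W n = cnt Z n + 1) := by
  obtain ⟨F, -, hF⟩ := exists_graph_cnt Z
  have : ∃ m, pair n m ∈ F ∧ (n ≤ y → cnt W n = m) ∧ (y < n → cnt W n = m + 1) := by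
    refine induct (fun n => ∃ m, pair n m ∈ F ∧ (n ≤ y → cnt W n = m) ∧ (y < n → cnt W n = m + 1))
      ⟨0, ?_, ?_, ?_⟩ ?_ n
    · rw [hF, cnt_zero]
    · rw [cnt_zero]; simp
    · simp
    · rintro n ⟨m, h, h₁, h₂⟩
      refine ⟨_, (hF _ _).2 rfl, fun hn => ?_, fun hn => ?_⟩
      · have hn' := lt_iff_add_one_le.2 hn
        by_cases hz : n ∈ Z
        · rw [cnt_add_one_of_mem hz, cnt_add_one_of_mem ((hW n).2 (Or.inl hz)), h₁ hn'.le,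
            (hF _ _).1 h]
        · rw [cnt_add_one_of_notMem hz, cnt_add_one_of_notMem, h₁ hn'.le, (hF _ _).1 h]
          exact fun h => ((hW n).1 h).elim hz hn'.ne
      · rcases (lt_add_one_iff.1 hn).eq_or_lt with rfl | hn
        · rw [cnt_add_one_of_notMem hy, cnt_add_one_of_mem ((hW _).2 (Or.inr rfl)), h₁ le_rfl,
            (hF _ _).1 h]
        · by_cases hz : n ∈ Z
          · rw [cnt_add_one_of_mem hz, cnt_add_one_of_mem ((hW n).2 (Or.inl hz)), h₂ hn,
              (hF _ _).1 h]
          · rw [cnt_add_one_of_notMem hz, cnt_add_one_of_notMem, h₂ hn, (hF _ _).1 h]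
            exact fun h => ((hW n).1 h).elim hz hn.ne'
  obtain ⟨m, h, h'⟩ := this
  rwa [(hF n m).1 h]

/-- `R` codes a bijection from `X` to `Y`. -/
structure IsBij (R X Y : M.carrier Sets) : Prop where
  mem : ∀ a b : M.carrier Num, pair a b ∈ R → a ∈ X ∧ b ∈ Y
  total : ∀ a : M.carrier Num, a ∈ X → ∃ b, pair a b ∈ R
  functional : ∀ a b c : M.carrier Num, pair a b ∈ R → pair a c ∈ R → b = c
  injective : ∀ a b c : M.carrier Num, pair a c ∈ R → pair b c ∈ R → a = b
  surjective : ∀ b : M.carrier Num, b ∈ Y → ∃ a, pair a b ∈ R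

/-- A pigeonhole argument: the image of the part of `X` below `n` gains a new element whenever `n`
passes an element of `X`, and this image lies in `Y`. -/
theorem IsBij.exists_cnt_le {R X Y : M.carrier Sets} (h : IsBij R X Y) (n : M.carrier Num) :
    ∃ k, cnt X n ≤ cnt Y k := by
  -- The image `Z` depends on `n`. Quantifying universally over the image and its counting graph
  -- makes the induction predicate `Π¹₁`.
  have key : ∀ n, ∀ Z G : M.carrier Sets,
      (∀ y, y ∈ Z ↔ ∃ x, x < n ∧ pair x y ∈ R) → IsCount Z G →
        ∃ k c m, cnt X n = c ∧ pair k m ∈ G ∧ c ≤ m := by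
    refine induct (fun n => ∀ Z G : M.carrier Sets,
      (∀ y, y ∈ Z ↔ ∃ x, x < n ∧ pair x y ∈ R) → IsCount Z G →
        ∃ k c m, cnt X n = c ∧ pair k m ∈ G ∧ c ≤ m) ?_ ?_
    · intro Z G _ hG
      exact ⟨0, 0, 0, cnt_zero X, hG.1.1, le_rfl⟩
    · intro n ih W G hW hG
      obtain ⟨Z, hZ⟩ := IsModel.compr (M := M) (fun y => ∃ x, x < n ∧ pair x y ∈ R) inferInstance
      obtain ⟨F, hF⟩ := exists_isCount Z
      obtain ⟨k, c, m, hc, hk, hm⟩ := ih Z F hZ hF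
      rw [hF.mem_iff] at hk
      by_cases hn : n ∈ X
      · obtain ⟨y, hy⟩ := h.total n hn
        have hyZ : ¬ y ∈ Z := fun hyZ => by
          obtain ⟨x, hx, hxy⟩ := (hZ y).1 hyZ
          exact hx.ne (h.injective _ _ _ hxy hy)
        have hWZ : ∀ a, a ∈ W ↔ a ∈ Z ∨ a = y := by
          intro a
          rw [hW, hZ]
          constructor
          · rintro ⟨x, hx, hxa⟩
            rcases (lt_add_one_iff.1 hx).eq_or_lt with rfl | hx
            · exact Or.inr (h.functional _ _ _ hxa hy)
            · exact Or.inl ⟨x, hx, hxa⟩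
          · rintro (⟨x, hx, hxa⟩ | rfl)
            · exact ⟨x, hx.trans (lt_add_one' n), hxa⟩
            · exact ⟨n, lt_add_one' n, hy⟩
        -- Beyond `y`, so that the new element is counted, and not below the old bound.
        refine ⟨max k (y + 1), _, _, rfl, (hG.mem_iff _ _).2 rfl, ?_⟩
        rw [cnt_add_one_of_mem hn,
          (cnt_insert hyZ hWZ _).2 ((lt_add_one' y).trans_le (le_max_right _ _)), hc]
        gcongr
        exact hm.trans (hk ▸ cnt_mono Z (le_max_left _ _))
      · refine ⟨k, _, _, rfl, (hG.mem_iff _ _).2 rfl, ?_⟩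
        rw [cnt_add_one_of_notMem hn, hc]
        refine hm.trans (hk ▸ cnt_le_cnt_of_subset (fun a ha => ?_) k)
        obtain ⟨x, hx, hxa⟩ := (hZ a).1 ha
        exact (hW a).2 ⟨x, hx.trans (lt_add_one' n), hxa⟩
  obtain ⟨Z, hZ⟩ := IsModel.compr (M := M) (fun y => ∃ x, x < n ∧ pair x y ∈ R) inferInstance
  obtain ⟨F, hF⟩ := exists_isCount Z
  obtain ⟨k, c, m, hc, hk, hm⟩ := key n Z F hZ hF
  rw [hF.mem_iff] at hk
  refine ⟨k, ?_⟩
  rw [hc]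
  refine hm.trans (hk ▸ cnt_le_cnt_of_subset (fun a ha => ?_) k)
  obtain ⟨x, -, hxa⟩ := (hZ a).1 ha
  exact (h.mem _ _ hxa).2

theorem IsBij.symm {R X Y : M.carrier Sets} (h : IsBij R X Y) : ∃ S, IsBij S Y X := by
  obtain ⟨S, hS⟩ := IsModel.compr (M := M) (fun z => ∃ a b, z = pair b a ∧ pair a b ∈ R)
    inferInstance
  have hS' : ∀ a b, pair a b ∈ S ↔ pair b a ∈ R := by
    intro a b
    rw [hS]
    constructor
    · rintro ⟨c, d, h, h'⟩
      obtain ⟨rfl, rfl⟩ := pair_inj.1 h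
      exact h'
    · exact fun h => ⟨b, a, rfl, h⟩
  refine ⟨S, ?_, ?_, ?_, ?_, ?_⟩ <;> simp only [hS']
  · exact fun a b h' => (h.mem b a h').symm
  · exact h.surjective
  · exact fun a b c => h.injective b c a
  · exact fun a b c => h.functional c a b
  · exact h.total

/-- Elements of equal rank are matched. The hypothesis says that the same ranks occur in both sets.
-/
theorem exists_isBij {X Y : M.carrier Sets}
    (h : ∀ m, (∃ n, m < cnt X n) ↔ ∃ n, m < cnt Y n) : ∃ R, IsBij R X Y := by
  obtain ⟨R, hR⟩ := IsModel.compr (M := M)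
    (fun z => ∃ a b, z = pair a b ∧ a ∈ X ∧ b ∈ Y ∧ cnt X a = cnt Y b) inferInstance
  have hR' : ∀ a b, pair a b ∈ R ↔ a ∈ X ∧ b ∈ Y ∧ cnt X a = cnt Y b := by
    intro a b
    rw [hR]
    constructor
    · rintro ⟨c, d, h, h'⟩
      obtain ⟨rfl, rfl⟩ := pair_inj.1 h
      exact h'
    · exact fun h => ⟨a, b, rfl, h⟩
  refine ⟨R, ?_, ?_, ?_, ?_, ?_⟩ <;> simp only [hR']
  · exact fun a b h => ⟨h.1, h.2.1⟩
  · intro a ha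
    obtain ⟨n, hn⟩ := (h (cnt X a)).1 ⟨a + 1, cnt_lt_cnt ha (lt_add_one' a)⟩
    obtain ⟨b, hb, h'⟩ := exists_cnt_eq hn
    exact ⟨b, ha, hb, h'.symm⟩
  · exact fun a b c h h' => cnt_injOn h.2.1 h'.2.1 (h.2.2.symm.trans h'.2.2)
  · exact fun a b c h h' => cnt_injOn h.1 h'.1 (h.2.2.trans h'.2.2.symm)
  · intro b hb
    obtain ⟨n, hn⟩ := (h (cnt Y b)).2 ⟨b + 1, cnt_lt_cnt hb (lt_add_one' b)⟩
    obtain ⟨a, ha, h'⟩ := exists_cnt_eq hn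
    exact ⟨a, ha, hb, h'⟩

/-- `c` codes the cardinality of the set with counting function `F`: it is `m + 1` if the set has
`m` elements, and `0` if the set is infinite. -/
def IsCardOf (F : M.carrier Sets) (c : M.carrier Num) : Prop :=
  (∃ m, c = m + 1 ∧ (∃ n, pair n m ∈ F) ∧ ∀ n k, pair n k ∈ F → k ≤ m) ∨
    (c = 0 ∧ ∀ m, ∃ n k, pair n k ∈ F ∧ m < k)

instance ar_isCardOf (f : M.Assign → M.carrier Sets) (g : M.Assign → M.carrier Num) [Tm M f]
    [Tm M g] : Ar M (fun e => IsCardOf (f e) (g e)) := by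
  unfold IsCardOf; infer_instance

theorem IsCount.isCardOf_iff {X F : M.carrier Sets} (hF : IsCount X F) (c : M.carrier Num) :
    IsCardOf F c ↔ (∃ m, c = m + 1 ∧ (∃ n, cnt X n = m) ∧ ∀ n, cnt X n ≤ m) ∨
      (c = 0 ∧ ∀ m, ∃ n, m < cnt X n) := by
  simp [IsCardOf, hF.mem_iff]

/-- Either the counting function attains a maximum, or, by induction, it exceeds every number. -/
theorem exists_isCardOf (X : M.carrier Sets) : ∃ c, ∃ F, IsCount X F ∧ IsCardOf F c := by
  obtain ⟨F, hF⟩ := exists_isCount X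
  by_cases h : ∃ n, ∀ k, cnt X k ≤ cnt X n
  · obtain ⟨n, hn⟩ := h
    exact ⟨cnt X n + 1, F, hF, (hF.isCardOf_iff _).2 (Or.inl ⟨_, rfl, ⟨n, rfl⟩, hn⟩)⟩
  · push Not at h
    refine ⟨0, F, hF, (hF.isCardOf_iff _).2 (Or.inr ⟨rfl, ?_⟩)⟩
    refine induct (fun m => ∃ n, m < cnt X n) ?_ fun m ⟨n, hn⟩ => ?_
    · obtain ⟨k, hk⟩ := h 0
      exact ⟨k, by rwa [cnt_zero] at hk⟩
    · obtain ⟨k, hk⟩ := h n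
      exact ⟨k, (lt_iff_add_one_le.1 hn).trans_lt hk⟩

/-- The interpretation of the operator `#`. -/
noncomputable def card (X : M.carrier Sets) : M.carrier Num := (exists_isCardOf X).choose

theorem card_spec (X : M.carrier Sets) :
    (∃ m, card X = m + 1 ∧ (∃ n, cnt X n = m) ∧ ∀ n, cnt X n ≤ m) ∨
      (card X = 0 ∧ ∀ m, ∃ n, m < cnt X n) := by
  obtain ⟨F, hF, h⟩ := (exists_isCardOf X).choose_spec
  exact (hF.isCardOf_iff _).1 h

/-- The numbers below some count form the initial segment of length `|X|`, or all numbers if `X` is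
infinite. Comparing these segments treats finite and infinite sets alike. -/
theorem card_eq_card_iff {X Y : M.carrier Sets} :
    card X = card Y ↔ ∀ m, (∃ n, m < cnt X n) ↔ ∃ n, m < cnt Y n := by
  have bdd : ∀ {X : M.carrier Sets} {m : M.carrier Num}, (∃ n, cnt X n = m) → (∀ n, cnt X n ≤ m) →
      ∀ k, (∃ n, k < cnt X n) ↔ k < m := by
    rintro X m ⟨n, rfl⟩ h k
    exact ⟨fun ⟨n', hn'⟩ => hn'.trans_le (h n'), fun h => ⟨n, h⟩⟩
  rcases card_spec X with ⟨m, h, hm, hm'⟩ | ⟨h, hX⟩ <;>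
    rcases card_spec Y with ⟨k, h', hk, hk'⟩ | ⟨h', hY⟩ <;> rw [h, h']
  · simp only [bdd hm hm', bdd hk hk', add_left_inj]
    refine ⟨fun h => by simp [h], fun h => eq_of_forall_lt_iff h⟩
  · simp only [hY, iff_true, bdd hm hm']
    exact ⟨fun h => absurd h (add_one_ne_zero m), fun h => absurd (h m) (lt_irrefl m)⟩
  · simp only [hX, true_iff, bdd hk hk']
    exact ⟨fun h => absurd h.symm (add_one_ne_zero k), fun h => absurd (h k) (lt_irrefl k)⟩
  · simp only [hX, hY, implies_true]

theorem IsCount.isCardOf_iff_card {X F : M.carrier Sets} (hF : IsCount X F) (c : M.carrier Num) :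
    IsCardOf F c ↔ card X = c := by
  have uniq : ∀ c d, IsCardOf F c → IsCardOf F d → c = d := by
    intro c d h h'
    rw [hF.isCardOf_iff] at h h'
    rcases h with ⟨m, rfl, ⟨n, rfl⟩, hm⟩ | ⟨rfl, h⟩ <;>
      rcases h' with ⟨m', rfl, ⟨n', rfl⟩, hm'⟩ | ⟨rfl, h'⟩
    · rw [le_antisymm (hm' n) (hm n')]
    · obtain ⟨k, hk⟩ := h' (cnt X n)
      exact absurd (hm k) hk.not_ge
    · obtain ⟨k, hk⟩ := h (cnt X n')
      exact absurd (hm' k) hk.not_ge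
    · rfl
  have h := (hF.isCardOf_iff _).2 (card_spec X)
  exact ⟨uniq _ _ h, fun e => e ▸ h⟩

theorem hume_card {X Y : M.carrier Sets} : card X = card Y ↔ ∃ R, IsBij R X Y := by
  refine ⟨fun h => exists_isBij (card_eq_card_iff.1 h), ?_⟩
  rintro ⟨R, hR⟩
  obtain ⟨S, hS⟩ := hR.symm
  refine card_eq_card_iff.2 fun m => ⟨fun ⟨n, hn⟩ => ?_, fun ⟨n, hn⟩ => ?_⟩
  · obtain ⟨k, hk⟩ := hR.exists_cnt_le n
    exact ⟨k, hn.trans_le hk⟩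
  · obtain ⟨k, hk⟩ := hS.exists_cnt_le n
    exact ⟨k, hn.trans_le hk⟩

end Counting

/-! ## Codes of finite sets -/

section FiniteSets

variable {M : Struc.{u} sig} [IsModel M]

/-- A membership relation for codes of finite sets, where `pair a l + 1` codes the set coded by `l`
with the element `a` added. -/
theorem exists_code_membership : ∃ E : M.carrier Sets, (∀ i, ¬ pair 0 i ∈ E) ∧
    ∀ a l i : M.carrier Num, pair (pair a l + 1) i ∈ E ↔ i = a ∨ pair l i ∈ E := by
  -- Codes are lists, with `0` as the empty list; membership is the least relation closed under the
  -- two clauses.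
  obtain ⟨E, hE⟩ := IsModel.compr (M := M) (fun z => ∀ Y : M.carrier Sets,
    ((∀ a l, pair (pair a l + 1) a ∈ Y) ∧
      ∀ a l i, pair l i ∈ Y → pair (pair a l + 1) i ∈ Y) → z ∈ Y) inferInstance
  have h₁ : ∀ a l, pair (pair a l + 1) a ∈ E := fun a l => (hE _).2 fun Y hY => hY.1 a l
  have h₂ : ∀ a l i, pair l i ∈ E → pair (pair a l + 1) i ∈ E := fun a l i h =>
    (hE _).2 fun Y hY => hY.2 a l i ((hE _).1 h Y hY)
  -- Inversion by minimality, as for counting graphs.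
  obtain ⟨G, hG⟩ := IsModel.compr (M := M) (fun z => (∃ a l, z = pair (pair a l + 1) a) ∨
    ∃ a l i, pair l i ∈ E ∧ z = pair (pair a l + 1) i) inferInstance
  have hGE : ∀ z, z ∈ G → z ∈ E := by
    intro z hz
    obtain ⟨a, l, rfl⟩ | ⟨a, l, i, h, rfl⟩ := (hG z).1 hz
    exacts [h₁ a l, h₂ a l i h]
  have hEG : ∀ z, z ∈ E → z ∈ G := fun z hz => (hE z).1 hz G
    ⟨fun a l => (hG _).2 (Or.inl ⟨a, l, rfl⟩),
      fun a l i h => (hG _).2 (Or.inr ⟨a, l, i, hGE _ h, rfl⟩)⟩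
  refine ⟨E, fun i hi => ?_, fun a l i => ⟨fun hi => ?_, ?_⟩⟩
  · rcases (hG _).1 (hEG _ hi) with ⟨a, l, h⟩ | ⟨a, l, i, -, h⟩ <;>
      exact add_one_ne_zero _ (pair_inj.1 h).1.symm
  · rcases (hG _).1 (hEG _ hi) with ⟨b, k, h⟩ | ⟨b, k, j, hj, h⟩ <;>
      obtain ⟨rfl, rfl⟩ := pair_inj.1 (add_right_cancel (pair_inj.1 h).1) <;>
      obtain rfl := (pair_inj.1 h).2
    exacts [Or.inl rfl, Or.inr hj]
  · rintro (rfl | h)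
    exacts [h₁ i l, h₂ a l i h]

/-- The graph of `#` is arithmetical in parameters. -/
theorem ar_card_eq (f : M.Assign → M.carrier Sets) (g : M.Assign → M.carrier Num) [Tm M f]
    [Tm M g] : Ar M (fun e => card (f e) = g e) := by
  obtain ⟨E, h₀, h₁⟩ := exists_code_membership (M := M)
  -- Cardinality as a function of codes. The coded set is unique and the choice of its counting
  -- graph does not matter, so a universal, hence `Π¹₁`, definition is available.
  obtain ⟨C, hC⟩ := IsModel.compr (M := M) (fun z => ∀ Z F : M.carrier Sets, ∀ l c, z = pair l c →
    (∀ i, i ∈ Z ↔ pair l i ∈ E) → IsCount Z F → IsCardOf F c) inferInstance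
  -- With `E` and `C` as parameters only number quantifiers remain; a set without code is infinite
  -- and has the value `0`.
  refine Dfb.congr (P := fun e => (∃ l, (∀ i, i ∈ f e ↔ pair l i ∈ E) ∧ pair l (g e) ∈ C) ∨
    (g e = 0 ∧ ¬ ∃ l, ∀ i, i ∈ f e ↔ pair l i ∈ E)) inferInstance fun e => ?_
  have hC' : ∀ l, (∀ i, i ∈ f e ↔ pair l i ∈ E) → ∀ c, pair l c ∈ C ↔ card (f e) = c := by
    intro l hl c
    rw [hC]
    constructor
    · intro h
      obtain ⟨F, hF⟩ := exists_isCount (f e)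
      exact (hF.isCardOf_iff_card c).1 (h _ F l c rfl hl hF)
    · intro h Z F l' c' h' hZ hF
      obtain ⟨rfl, rfl⟩ := pair_inj.1 h'
      obtain rfl : Z = f e := IsModel.ext _ _ fun i => (hZ i).trans (hl i).symm
      exact (hF.isCardOf_iff_card _).2 h
  by_cases hl : ∃ l, ∀ i, i ∈ f e ↔ pair l i ∈ E
  · constructor
    · intro h
      obtain ⟨l, hl⟩ := hl
      exact Or.inl ⟨l, hl, (hC' l hl _).2 h⟩
    · rintro (⟨l, hl, h⟩ | h)
      · exact (hC' l hl _).1 h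
      · exact absurd hl h.2
  · have : card (f e) = 0 := by
      rcases card_spec (f e) with ⟨m, -, ⟨n, rfl⟩, hn⟩ | ⟨h, -⟩
      -- Every initial part of a set has a code. If the count is maximal at `n`, the part below `n`
      -- is the whole set.
      · have key : ∀ n, ∃ l, ∀ i, pair l i ∈ E ↔ i ∈ f e ∧ i < n := by
          generalize f e = X
          refine induct (fun n => ∃ l, ∀ i, pair l i ∈ E ↔ i ∈ X ∧ i < n) ⟨0, fun i => ?_⟩ ?_
          · simp [h₀]
          · rintro n ⟨l, hl⟩
            by_cases hn : n ∈ X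
            · refine ⟨pair n l + 1, fun i => ?_⟩
              rw [h₁, hl, lt_add_one_iff, le_iff_eq_or_lt]
              constructor
              · rintro (rfl | h)
                exacts [⟨hn, Or.inl rfl⟩, ⟨h.1, Or.inr h.2⟩]
              · rintro ⟨h, h' | h'⟩
                exacts [Or.inl h', Or.inr ⟨h, h'⟩]
            · refine ⟨l, fun i => ?_⟩
              rw [hl, lt_add_one_iff, le_iff_eq_or_lt]
              constructor
              · exact fun h => ⟨h.1, Or.inr h.2⟩
              · rintro ⟨h, rfl | h'⟩
                exacts [absurd h hn, ⟨h, h'⟩]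
        obtain ⟨l, hl'⟩ := key n
        refine absurd ⟨l, fun i => ?_⟩ hl
        rw [hl']
        refine ⟨fun hi => ⟨hi, lt_of_not_ge fun hni => ?_⟩, fun h => h.1⟩
        -- An element at or beyond `n` would raise the count above its maximum.
        exact ((cnt_mono _ hni).trans_lt (cnt_lt_cnt hi (lt_add_one' i))).not_ge (hn _)
      · exact h
    rw [this]
    constructor
    · exact fun h => Or.inr ⟨h.symm, hl⟩
    · rintro (⟨l, hl', -⟩ | h)
      exacts [absurd ⟨l, hl'⟩ hl, h.1.symm]

end FiniteSets

end PA

/-! ## Semantics of Hume's Principle -/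

namespace HP

variable {M : Struc.{u} sig}

/-- The membership relation of a structure. -/
def app {k : ℕ} (R : M.carrier (Rel k)) (a : Fin (k + 1) → M.carrier Obj) : Prop :=
  M.rl k (Fin.cases R a)

/-- The interpretation of `#` in a structure. -/
def num (X : M.carrier (Rel 0)) : M.carrier Obj := M.fn () fun _ => X

variable {v : M.Assign}

@[simp] theorem val_x (i : ℕ) : M.val v (x i) = v (Obj, i) := rfl

@[simp] theorem val_R (k i : ℕ) : M.val v (R k i) = v (Rel k, i) := rfl

@[simp] theorem val_card (t : Term sig (Rel 0)) : M.val v (card t) = num (M.val v t) := rfl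

theorem rl_iff_app {k : ℕ} (a : (i : Fin (k + 2)) → M.carrier (sig.rlArg k i)) :
    M.rl k a ↔ app (M := M) (a 0) (fun i => a i.succ) :=
  iff_of_eq <| congrArg (M.rl k) <| funext fun i => by
    induction i using Fin.cases <;> rfl

theorem sat_mem' {k : ℕ} (A : Term sig (Rel k)) (t : Fin (k + 1) → Term sig Obj) :
    M.Sat v (mem A t) ↔ app (M.val v A) fun i => M.val v (t i) :=
  rl_iff_app _

/-- Membership in a set. -/
abbrev app1 (X : M.carrier (Rel 0)) (a : M.carrier Obj) : Prop := app X ![a]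

/-- Membership in a binary relation. -/
abbrev app2 (X : M.carrier (Rel 1)) (a b : M.carrier Obj) : Prop := app X ![a, b]

/-- Membership in a ternary relation. -/
abbrev app3 (X : M.carrier (Rel 2)) (a b c : M.carrier Obj) : Prop := app X ![a, b, c]

@[simp] theorem sat_mem1 (A : Term sig (Rel 0)) (s : Term sig Obj) :
    M.Sat v (mem A ![s]) ↔ app1 (M.val v A) (M.val v s) := by
  rw [sat_mem', app1]
  refine iff_of_eq <| congrArg _ <| funext fun i => ?_
  fin_cases i; rfl

@[simp] theorem sat_mem2 (A : Term sig (Rel 1)) (s t : Term sig Obj) :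
    M.Sat v (mem A ![s, t]) ↔ app2 (M.val v A) (M.val v s) (M.val v t) := by
  rw [sat_mem', app2]
  refine iff_of_eq <| congrArg _ <| funext fun i => ?_
  fin_cases i <;> rfl

@[simp] theorem sat_mem3 (A : Term sig (Rel 2)) (s t r : Term sig Obj) :
    M.Sat v (mem A ![s, t, r]) ↔ app3 (M.val v A) (M.val v s) (M.val v t) (M.val v r) := by
  rw [sat_mem', app3]
  refine iff_of_eq <| congrArg _ <| funext fun i => ?_
  fin_cases i <;> rfl

/-- `f` is the graph of a bijection from `A` to `B`. -/
structure IsBij (f : M.carrier (Rel 1)) (A B : M.carrier (Rel 0)) : Prop where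
  mem : ∀ a b, app2 f a b → app1 A a ∧ app1 B b
  total : ∀ a, app1 A a → ∃ b, app2 f a b
  functional : ∀ a b c, app2 f a b → app2 f a c → b = c
  injective : ∀ a b c, app2 f a c → app2 f b c → a = b
  surjective : ∀ b, app1 B b → ∃ a, app2 f a b

theorem sat_hume : M.Sat v hume ↔
    (num (v (Rel 0, 0)) = num (v (Rel 0, 1)) ↔ ∃ f, IsBij f (v (Rel 0, 0)) (v (Rel 0, 1))) := by
  rw [hume, Struc.sat_iff]
  refine iff_congr Iff.rfl (exists_congr fun f => ?_)
  simp only [bijection, Formula.alls, List.foldr, Struc.sat_and, Struc.Sat, sat_mem1, sat_mem2,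
    val_R, val_x]
  simp only [Function.update, Prod.mk.injEq, reduceCtorEq, Srts.rel.injEq]
  simp only [OfNat.ofNat_ne_one, OfNat.one_ne_ofNat, and_false, false_and, and_self, dite_true,
    dite_false]
  refine ⟨fun ⟨h₁, h₂, h₃, h₄, h₅⟩ => ⟨h₁, h₂, fun a b c h h' => h₃ a b c ⟨h, h'⟩,
    fun a b c h h' => h₄ a b c ⟨h, h'⟩, h₅⟩, fun ⟨h₁, h₂, h₃, h₄, h₅⟩ =>
    ⟨h₁, h₂, fun a b c h => h₃ a b c h.1 h.2, fun a b c h => h₄ a b c h.1 h.2, h₅⟩⟩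

open Classical in
theorem sat_alls_obj {k : ℕ} {n : Fin (k + 1) → ℕ} {φ : Formula sig} :
    M.Sat v (.alls (List.ofFn fun i => (Obj, n i)) φ) ↔
      ∀ w : M.Assign, (∀ q, (∀ i, q ≠ (Obj, n i)) → w q = v q) → M.Sat w φ := by
  rw [Struc.sat_alls]
  simp only [List.mem_ofFn, not_exists]
  exact forall_congr' fun w => imp_congr (forall_congr' fun q => imp_congr
    (forall_congr' fun i => ne_comm) Iff.rfl) Iff.rfl

theorem sat_extensionality {k : ℕ} : (∀ v : M.Assign, M.Sat v (extensionality k)) ↔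
    ∀ A B : M.carrier (Rel k), (∀ a, app A a ↔ app B a) → A = B := by
  classical
  constructor
  · intro h A B hAB
    let w : M.Assign := fun p => (M.nonempty p.1).some
    have hs := h (Function.update (Function.update w (Rel k, 0) A) (Rel k, 1) B)
    simp only [extensionality, Struc.Sat, sat_alls_obj, Struc.sat_iff, sat_mem', val_R] at hs
    simp only [Function.update_self] at hs
    rw [Function.update_of_ne (by simp), Function.update_self] at hs
    refine hs fun w' hw' => ?_
    rw [hw' _ (by simp), hw' (Rel k, 1) (by simp), Function.update_of_ne (by simp),
      Function.update_self, Function.update_self]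
    exact hAB _
  · intro h v
    simp only [extensionality, Struc.Sat, sat_alls_obj, Struc.sat_iff, sat_mem', val_R]
    intro hs
    refine h _ _ fun a => ?_
    have := hs (fun p => match p with
      | (.obj, i) => if h : i < k + 1 then a ⟨i, h⟩ else v (Obj, i)
      | (.rel j, i) => v (Rel j, i)) (by
        rintro ⟨_ | j, i⟩ hq
        · have : ¬ i < k + 1 := fun hi => hq ⟨i, hi⟩ rfl
          simp only [this, dite_false]
        · rfl)
    simpa only [val_x, Fin.is_lt, dite_true, Fin.eta] using this

open Classical in
theorem sat_comprehension {k r : ℕ} {n : Fin (k + 1) → ℕ} {φ : Formula sig} :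
    M.Sat v (comprehension k r n φ) ↔ ∃ A : M.carrier (Rel k), ∀ w : M.Assign,
      (∀ q, (∀ i, q ≠ (Obj, n i)) → w q = Function.update v (Rel k, r) A q) →
        (app A (fun i => w (Obj, n i)) ↔ M.Sat w φ) := by
  rw [comprehension]
  refine exists_congr fun A => ?_
  rw [sat_alls_obj]
  refine forall_congr' fun w => forall_congr' fun hw => ?_
  rw [Struc.sat_iff, sat_mem', val_R, hw (Rel k, r) (by simp), Function.update_self]
  rfl

/-- As `#` leads from sets to objects and nothing leads back, terms do not nest: relation terms are
variables, object terms are variables or `#` of a variable. The sort is kept general so that cases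
can be distinguished on the term. -/
theorem term_cases {σ : sig.Srt} (t : Term sig σ) :
    (∃ i, t = .var (σ, i)) ∨ ∃ (h : σ = Obj) (A : Term sig (Rel 0)), h ▸ t = card A := by
  cases t with
  | var p => exact Or.inl ⟨p.2, rfl⟩
  | app f ts =>
    refine Or.inr ⟨rfl, ts 0, ?_⟩
    exact congrArg (Term.app (L := sig) ()) (funext fun i => by fin_cases i; rfl)

theorem term_rel {k : ℕ} (t : Term sig (Rel k)) : ∃ i, t = R k i := by
  rcases term_cases t with h | ⟨h, -⟩
  · exact h
  · cases h

theorem term_obj (t : Term sig Obj) : (∃ i, t = x i) ∨ ∃ i, t = card (R 0 i) := by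
  rcases term_cases t with h | ⟨-, A, rfl⟩
  · exact Or.inl h
  · obtain ⟨i, rfl⟩ := term_rel A
    exact Or.inr ⟨i, rfl⟩

end HP

/-! ## Schemes -/

/-- A formula with free variables in `A` that is equivalent to `φ` wherever `φ` depends on the
variables in `A` only. -/
noncomputable def Formula.closeTo {L : Signature} (φ : Formula L) (A : Set L.Vrb) : Formula L :=
  (Formula.exists_free_subset.{u} φ A).choose

theorem Formula.free_closeTo {L : Signature} (φ : Formula L) (A : Set L.Vrb) :
    (Formula.closeTo.{u} φ A).free ⊆ A :=
  (Formula.exists_free_subset.{u} φ A).choose_spec.1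

/-- The conditions on free variables in a scheme are syntactic. This lemma replaces their
verification by the remark that the meaning of the formula depends on the permitted variables only.
-/
theorem Formula.sat_closeTo {L : Signature} {φ : Formula L} {A : Set L.Vrb} {M : Struc.{u} L}
    {P : M.Assign → Prop} (hφ : ∀ v, M.Sat v φ ↔ P v)
    (hP : ∀ v w : M.Assign, (∀ q ∈ A, v q = w q) → P v → P w) (v : M.Assign) :
    M.Sat v (Formula.closeTo.{u} φ A) ↔ P v := by
  rw [← hφ]
  exact (Formula.exists_free_subset.{u} φ A).choose_spec.2 M
    (fun v w h => by rw [hφ, hφ]; exact hP v w h) v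

/-- The scheme given by formulas, ignoring free variables that are not allowed. -/
noncomputable def Scheme.ofFormulas {K L : Signature} (srt : K.Srt → L.Srt)
    (dom : K.Srt → Formula L) (rl : K.Rl → Formula L) (fn : K.Fn → Formula L) : Scheme K L where
  srt := srt
  dom σ := Formula.closeTo.{u} (dom σ) {(srt σ, 0)}
  rl r := Formula.closeTo.{u} (rl r) {q | ∃ i : Fin (K.rlAr r), q = (srt (K.rlArg r i), (i : ℕ))}
  fn f := Formula.closeTo.{u} (fn f) {q | (∃ i : Fin (K.fnAr f), q = (srt (K.fnArg f i), (i : ℕ))) ∨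
      q = (srt (K.fnRes f), K.fnAr f)}
  dom_free _ := Formula.free_closeTo _ _
  rl_free _ := Formula.free_closeTo _ _
  fn_free _ := Formula.free_closeTo _ _

/-! ## Hume's Principle in arithmetic -/

namespace PA

-- Relations as sets of codes of tuples

section Tuples

variable {M : Struc.{u} sig} [IsModel M]

/-- The code of a tuple. -/
def tup : (k : ℕ) → (Fin (k + 1) → M.carrier Num) → M.carrier Num
  | 0, a => a 0
  | k + 1, a => pair (a 0) (tup k fun i => a i.succ)

theorem tup_inj : ∀ {k : ℕ} {a b : Fin (k + 1) → M.carrier Num}, tup k a = tup k b → a = b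
  | 0, a, b, h => funext fun i => by rw [Fin.fin_one_eq_zero i]; exact h
  | k + 1, a, b, h => by
    have h' := pair_inj.1 h
    have ih := tup_inj h'.2
    funext i
    induction i using Fin.cases with
    | zero => exact h'.1
    | succ i => exact congrFun ih i

omit [IsModel M] in
theorem exists_tup_succ {k : ℕ} {z : M.carrier Num} :
    (∃ a, z = tup (k + 1) a) ↔ ∃ x y : M.carrier Num, z = pair x y ∧ ∃ a, y = tup k a := by
  constructor
  · rintro ⟨a, rfl⟩
    exact ⟨_, _, rfl, _, rfl⟩
  · rintro ⟨x, y, rfl, a, rfl⟩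
    exact ⟨Fin.cons x a, rfl⟩

omit [IsModel M] in
theorem tm_tup : ∀ {k : ℕ} (f : Fin (k + 1) → M.Assign → M.carrier Num) (_ : ∀ i, Tm M (f i)),
    Tm M (fun e => tup k fun i => f i e)
  | 0, _, h => h 0
  | k + 1, f, h => by
    have := h 0
    have := tm_tup (fun i : Fin (k + 1) => f i.succ) fun i => h i.succ
    exact inferInstanceAs (Tm M fun e => pair (f 0 e) (tup k fun i => f i.succ e))

omit [IsModel M] in
theorem ar_exists_tup (k : ℕ) : ∀ (f : M.Assign → M.carrier Num) [Tm M f],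
    Ar M (fun e => ∃ a, f e = tup k a) := by
  induction k with
  | zero =>
    intro f _
    refine Dfb.congr (P := fun e => f e = f e) inferInstance fun e => ?_
    exact ⟨fun _ => rfl, fun _ => ⟨fun _ => f e, rfl⟩⟩
  | succ k ih =>
    intro f _
    simp only [exists_tup_succ]
    have := ih (fun e => e (Num, 0)) 
    infer_instance

/-- A set that consists of codes of `(k + 1)`-tuples. -/
def IsRel (k : ℕ) (X : M.carrier Sets) : Prop :=
  ∀ z : M.carrier Num, z ∈ X → ∃ a, z = tup k a

theorem exists_restr (k : ℕ) (X : M.carrier Sets) :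
    ∃ Y : {Y : M.carrier Sets // IsRel k Y}, ∀ a, tup k a ∈ Y.1 ↔ tup k a ∈ X := by
  have := ar_exists_tup k (M := M) (fun e => e (Num, 0))
  obtain ⟨Y, hY⟩ := IsModel.compr (M := M) (fun z => (∃ a, z = tup k a) ∧ z ∈ X) inferInstance
  refine ⟨⟨Y, fun z hz => ((hY z).1 hz).1⟩, fun a => ?_⟩
  rw [hY]
  exact ⟨fun h => h.2, fun h => ⟨⟨a, rfl⟩, h⟩⟩

/-- The codes of tuples in a set. -/
noncomputable def restr (k : ℕ) (X : M.carrier Sets) : {Y : M.carrier Sets // IsRel k Y} :=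
  (exists_restr k X).choose

theorem tup_mem_restr {k : ℕ} {X : M.carrier Sets} {a : Fin (k + 1) → M.carrier Num} :
    tup k a ∈ (restr k X).1 ↔ tup k a ∈ X :=
  (exists_restr k X).choose_spec a

/-- Sets that represent relations contain nothing but codes of tuples for this reason: equality has
to be interpreted as equality. -/
theorem rel_ext {k : ℕ} {X Y : {Y : M.carrier Sets // IsRel k Y}}
    (h : ∀ a, tup k a ∈ X.1 ↔ tup k a ∈ Y.1) : X = Y := by
  refine Subtype.ext (IsModel.ext _ _ fun z => ⟨fun hz => ?_, fun hz => ?_⟩)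
  · obtain ⟨a, rfl⟩ := X.2 z hz
    exact (h a).1 hz
  · obtain ⟨a, rfl⟩ := Y.2 z hz
    exact (h a).2 hz

theorem restr_of_isRel {k : ℕ} (X : {Y : M.carrier Sets // IsRel k Y}) : restr k X.1 = X :=
  rel_ext fun _ => tup_mem_restr

theorem restr_zero (X : M.carrier Sets) : (restr 0 X).1 = X :=
  IsModel.ext _ _ fun z => tup_mem_restr (k := 0) (a := fun _ => z)

variable (M) in
/-- The structure of objects and relations that is defined in a model of arithmetic. -/
noncomputable def humeStruc : Struc.{u} HP.sig where
  carrier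
    | .obj => M.carrier Num
    | .rel k => {X : M.carrier Sets // IsRel k X}
  nonempty
    | .obj => ⟨(0 : M.carrier Num)⟩
    | .rel k => ⟨restr k (M.nonempty Sets).some⟩
  fn _ a := card (a 0).1
  rl k a := tup k (fun i => a i.succ) ∈ (a 0).1

theorem isBij_humeStruc {f : (humeStruc M).carrier (HP.Rel 1)}
    {A B : (humeStruc M).carrier (HP.Rel 0)} :
    HP.IsBij f A B ↔ IsBij (M := M) f.1 A.1 B.1 :=
  ⟨fun h => ⟨h.1, h.2, h.3, h.4, h.5⟩, fun h => ⟨h.1, h.2, h.3, h.4, h.5⟩⟩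

theorem models_base_humeStruc : (humeStruc M).Models HP.base := by
  rintro φ (rfl | ⟨k, rfl⟩) v
  · rw [HP.sat_hume]
    refine (show _ ↔ _ from hume_card (M := M) (X := (v (HP.Rel 0, 0)).1)
      (Y := (v (HP.Rel 0, 1)).1)).trans ?_
    simp only [isBij_humeStruc]
    constructor
    · rintro ⟨R, h⟩
      -- `R` may contain numbers that code no pair; restriction removes them and keeps the
      -- bijection.
      have e : ∀ a b : M.carrier Num, pair a b ∈ (restr 1 R).1 ↔ pair a b ∈ R := fun a b =>
        tup_mem_restr (a := ![a, b])
      refine ⟨restr 1 R, ?_, ?_, ?_, ?_, ?_⟩ <;> simp only [e]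
      exacts [h.1, h.2, h.3, h.4, h.5]
    · exact fun ⟨f, h⟩ => ⟨f.1, h⟩
  · exact HP.sat_extensionality.2 (fun A B h => rel_ext h) v

/-! ### Definability in the model -/

/-- The variable that represents a given variable. -/
def humeVar : HP.sig.Vrb → sig.Vrb
  -- The shift reserves number variable `0` for the code of a tuple in comprehension. In the next
  -- case, pairing the indices fits the variables of all relation sorts into the one sort of sets.
  | (.obj, j) => (Num, j + 1)
  | (.rel k, i) => (Sets, Nat.pair k i)

/-- The object or relation that is represented by a number or set. -/
noncomputable def humeDec : (p : HP.sig.Vrb) → M.carrier (humeVar p).1 → (humeStruc M).carrier p.1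
  | (.obj, _) => fun a => a
  | (.rel k, _) => restr k

/-- The assignment that is represented by an assignment. -/
noncomputable def humeAssign (e : M.Assign) : (humeStruc M).Assign :=
  fun p => humeDec p (e (humeVar p))

theorem humeVar_injective : Function.Injective humeVar := by
  rintro ⟨_ | k, i⟩ ⟨_ | l, j⟩ h <;> simp [humeVar] at h ⊢
  · exact h
  · exact h

theorem humeDec_surjective (p : HP.sig.Vrb) : Function.Surjective (humeDec (M := M) p) := by
  obtain ⟨_ | k, i⟩ := p
  · exact fun a => ⟨a, rfl⟩
  · exact fun X => ⟨X.1, restr_of_isRel X⟩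

open Classical in
theorem humeAssign_update (e : M.Assign) (p : HP.sig.Vrb) (a : M.carrier (humeVar p).1) :
    humeAssign (Function.update e (humeVar p) a) =
      Function.update (humeAssign e) p (humeDec p a) := by
  funext q
  by_cases h : q = p
  · subst h
    simp [humeAssign]
  · rw [Function.update_of_ne h, humeAssign, Function.update_of_ne (humeVar_injective.ne h)]
    rfl

theorem exists_humeAssign_eq (v : (humeStruc M).Assign) : ∃ e : M.Assign, humeAssign e = v := by
  refine ⟨fun p => match p with
    | (.num, j) => v (HP.Obj, j - 1)
    | (.set, i) => (v (HP.Rel i.unpair.1, i.unpair.2)).1, ?_⟩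
  funext ⟨σ, i⟩
  rcases σ with _ | k
  · rfl
  · change restr k (v (HP.Rel (Nat.unpair (Nat.pair k i)).1, (Nat.unpair (Nat.pair k i)).2)).1 = _
    rw [Nat.unpair_pair]
    exact restr_of_isRel _

/-- The map `h` makes the lemma applicable under quantifiers, where the original assignment is a
tail of the current one. -/
theorem ar_val_obj (h : M.Assign → M.Assign) (hh : ∀ p : sig.Vrb, Tm M fun e => h e p)
    (s : Term HP.sig HP.Obj) (f : M.Assign → M.carrier Num) [Tm M f] :
    Ar M (fun e => (humeStruc M).val (humeAssign (h e)) s = f e) := by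
  rcases HP.term_obj s with ⟨i, rfl⟩ | ⟨i, rfl⟩
  · have := hh (Num, i + 1)
    exact inferInstanceAs (Ar M fun e => h e (Num, i + 1) = f e)
  · have := hh (Sets, Nat.pair 0 i)
    refine (ar_card_eq (fun e => h e (Sets, Nat.pair 0 i)) f).congr fun e => ?_
    change card (restr 0 (h e (Sets, Nat.pair 0 i))).1 = _ ↔ _
    rw [restr_zero]

theorem ar_tup_val : ∀ {k : ℕ} (h : M.Assign → M.Assign) (_ : ∀ p : sig.Vrb, Tm M fun e => h e p)
    (s : Fin (k + 1) → Term HP.sig HP.Obj) (f : M.Assign → M.carrier Num) [Tm M f],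
    Ar M (fun e => tup k (fun i => (humeStruc M).val (humeAssign (h e)) (s i)) = f e)
  | 0, h, hh, s, f, _ => ar_val_obj h hh (s 0) f
  | k + 1, h, hh, s, f, _ => by
    have h₀ := ar_val_obj (fun e : M.Assign => h e.tail.tail) (fun p =>
      have := hh p
      Tm.reindex (fun e => h e p) fun p => p.2 + 1 + 1) (s 0) (fun e => e (Num, 1))
    have h₁ := ar_tup_val (fun e : M.Assign => h e.tail.tail) (fun p =>
      have := hh p
      Tm.reindex (fun e => h e p) fun p => p.2 + 1 + 1) (fun i => s i.succ) (fun e => e (Num, 0))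
    refine Dfb.congr (P := fun e => ∃ x y : M.carrier Num,
      (humeStruc M).val (humeAssign (h e)) (s 0) = x ∧
      tup k (fun i => (humeStruc M).val (humeAssign (h e)) (s i.succ)) = y ∧ pair x y = f e)
      inferInstance fun e => ?_
    constructor
    · exact fun h => ⟨_, _, rfl, rfl, h⟩
    · rintro ⟨x, y, rfl, rfl, h⟩
      exact h

/-- Values of `#` enter atomic formulas through the graph, by `ar_card_eq`, with a number quantifier
for the value. -/
theorem ar_sat_humeStruc {φ : Formula HP.sig} (h : φ.Arithmetical HP.Obj) :
    Ar M (fun e => (humeStruc M).Sat (humeAssign e) φ) := by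
  refine Dfb.transfer_arith humeAssign humeVar humeDec humeDec_surjective humeAssign_update
    ?_ ?_ ?_ h
  · rintro ⟨σ, i⟩ rfl
    rfl
  · intro σ s t
    rcases σ with _ | k
    · have h₁ := ar_val_obj (M := M) (fun e => e.tail) inferInstance s (fun e => e (Num, 0))
      have h₂ := ar_val_obj (M := M) (fun e => e.tail) inferInstance t (fun e => e (Num, 0))
      exact Dfb.congr (P := fun e => ∃ y : M.carrier Num,
        (humeStruc M).val (humeAssign e) s = y ∧ (humeStruc M).val (humeAssign e) t = y)
        inferInstance fun e => ⟨fun h => ⟨_, h, rfl⟩, fun ⟨y, h, h'⟩ => h.trans h'.symm⟩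
    · obtain ⟨i, rfl⟩ := HP.term_rel s
      obtain ⟨j, rfl⟩ := HP.term_rel t
      have := ar_exists_tup k (M := M) (fun e => e (Num, 0))
      refine Dfb.congr (P := fun e => ∀ z, (∃ a, z = tup k a) →
        (z ∈ e (Sets, Nat.pair k i) ↔ z ∈ e (Sets, Nat.pair k j))) inferInstance fun e => ?_
      change restr k (e (Sets, Nat.pair k i)) = restr k (e (Sets, Nat.pair k j)) ↔ _
      constructor
      · rintro h z ⟨a, rfl⟩
        rw [← tup_mem_restr, h, tup_mem_restr]
      · intro h
        refine rel_ext fun a => ?_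
        rw [tup_mem_restr, tup_mem_restr]
        exact h _ ⟨a, rfl⟩
  · intro k ts
    obtain ⟨i, hi⟩ := HP.term_rel (ts 0)
    let s : Fin (k + 1) → Term HP.sig HP.Obj := fun i => ts i.succ
    have h₁ := ar_tup_val (M := M) (fun e => e.tail) inferInstance s (fun e => e (Num, 0))
    refine Dfb.congr (P := fun e => ∃ z : M.carrier Num,
      tup k (fun i => (humeStruc M).val (humeAssign e) (s i)) = z ∧
        z ∈ e (Sets, Nat.pair k i)) inferInstance fun e => ?_
    change tup k (fun i => (humeStruc M).val (humeAssign e) (s i)) ∈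
      ((humeStruc M).val (humeAssign e) (ts 0)).1 ↔ _
    rw [hi]
    exact tup_mem_restr.trans ⟨fun h => ⟨_, rfl, h⟩, fun ⟨z, h, h'⟩ => h ▸ h'⟩

omit [IsModel M] in
/-- Quantification over several number variables. -/
theorem dfb_alls_num {C : Set (Formula sig)} (hC : ∀ φ ∈ C, ∀ i, Formula.all (Num, i) φ ∈ C)
    (ns : List ℕ) {P : M.Assign → Prop} (h : Dfb C M P) :
    Dfb C M (fun e => ∀ e' : M.Assign, (∀ p, (∀ n ∈ ns, p ≠ (Num, n)) → e' p = e p) → P e') := by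
  classical
  obtain ⟨φ, hφ, v, hv⟩ := h
  refine ⟨.alls (ns.map fun n => (Num, 2 * n)) φ, ?_, v, fun e => ?_⟩
  · induction ns with
    | nil => exact hφ
    | cons n ns ih => exact hC _ ih _
  · rw [Struc.sat_alls]
    constructor
    · intro h w hw
      have hmix : w = M.mix v (fun p => w (p.1, 2 * p.2)) := by
        refine Struc.assign_ext (fun σ n => ?_) (fun σ n => ?_)
        · rw [Struc.mix_even _ _ _ rfl]
        · rw [Struc.mix_odd _ _ _ rfl, hw, Struc.mix_odd _ _ _ rfl]
          simp
          omega
      rw [hmix, ← hv]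
      refine h _ fun p hp => ?_
      rw [hw]
      · exact Struc.mix_even v e p.1 rfl
      · simp only [List.mem_map, not_exists, not_and]
        intro n hn hp'
        refine hp n hn (Prod.ext (Prod.ext_iff.1 hp').1.symm ?_)
        have := (Prod.ext_iff.1 hp').2
        simp at this
        exact this.symm
    · intro h e' he'
      rw [hv]
      refine h _ fun q hq => ?_
      obtain ⟨σ, m⟩ := q
      obtain ⟨i, rfl | rfl⟩ := Nat.even_or_odd' m
      · rw [Struc.mix_even _ _ _ rfl, Struc.mix_even _ _ _ rfl]
        refine he' _ fun n hn hp => hq ?_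
        simp only [Prod.mk.injEq] at hp
        obtain ⟨rfl, rfl⟩ := hp
        exact List.mem_map.2 ⟨_, hn, rfl⟩
      · rw [Struc.mix_odd _ _ _ rfl, Struc.mix_odd _ _ _ rfl]

open Classical in
/-- The components of the tuple coded by `z`. -/
noncomputable def proj (k : ℕ) (z : M.carrier Num) : Fin (k + 1) → M.carrier Num :=
  if h : ∃ a, z = tup k a then h.choose else fun _ => 0

theorem proj_tup {k : ℕ} (a : Fin (k + 1) → M.carrier Num) : proj k (tup k a) = a := by
  have h : ∃ b, tup k a = tup k b := ⟨a, rfl⟩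
  rw [proj, dif_pos h]
  exact (tup_inj h.choose_spec).symm

/-- An arithmetical description of the graph of `proj`; the second disjunct accounts for the default
value at numbers that code no tuple. -/
theorem eq_proj_iff {k : ℕ} (a : Fin (k + 1) → M.carrier Num) (z : M.carrier Num) :
    a = proj k z ↔ z = tup k a ∨ (¬ (∃ b, z = tup k b) ∧ tup k a = tup k fun _ => 0) := by
  by_cases h : ∃ b, z = tup k b
  · obtain ⟨b, rfl⟩ := h
    rw [proj_tup]
    constructor
    · rintro rfl; exact Or.inl rfl
    · rintro (h | h)
      exacts [(tup_inj h).symm, absurd ⟨b, rfl⟩ h.1]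
  · rw [proj, dif_neg h]
    constructor
    · rintro rfl; exact Or.inr ⟨h, rfl⟩
    · rintro (rfl | h')
      exacts [absurd ⟨a, rfl⟩ h, tup_inj h'.2]

open Classical in
/-- The assignment that gives the variables number `n i + 1` the components of the value of the
variable number `0`. -/
noncomputable def spread {k : ℕ} (n : Fin (k + 1) → ℕ) (e : M.Assign) : M.Assign
  | (.num, j) => if h : ∃ i, j = n i + 1 then proj k (e (Num, 0)) h.choose else e (Num, j)
  | (.set, j) => e (Sets, j)

omit [IsModel M] in
theorem spread_num {k : ℕ} {n : Fin (k + 1) → ℕ} (hn : Function.Injective n) (e : M.Assign)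
    (i : Fin (k + 1)) : spread n e (Num, n i + 1) = proj k (e (Num, 0)) i := by
  have h : ∃ i', n i + 1 = n i' + 1 := ⟨i, rfl⟩
  have : h.choose = i := (hn (Nat.succ_injective h.choose_spec)).symm
  simp only [spread, h, dite_true, this]

omit [IsModel M] in
theorem spread_of_ne {k : ℕ} {n : Fin (k + 1) → ℕ} (e : M.Assign) {p : sig.Vrb}
    (hp : ∀ i, p ≠ (Num, n i + 1)) : spread n e p = e p := by
  obtain ⟨_ | _, j⟩ := p
  · have h : ¬ ∃ i, j = n i + 1 := fun ⟨i, hi⟩ => hp i (by rw [hi])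
    simp only [spread, h, dite_false]
  · rfl

/-- Projections are not given by terms, so the components are introduced by universal number
quantifiers guarded by `eq_proj_iff`. The closure assumptions hold for the arithmetical formulas and
for all formulas, but not for the `Π¹ₙ`-formulas. -/
theorem dfb_spread {C : Set (Formula sig)} (hr : RenClosed C)
    (hi : ∀ φ ∈ C, ∀ ψ ∈ C, Formula.imp φ ψ ∈ C) (ha : arith Num ⊆ C)
    (hC : ∀ φ ∈ C, ∀ i, Formula.all (Num, i) φ ∈ C)
    {k : ℕ} {n : Fin (k + 1) → ℕ} (hn : Function.Injective n)
    {P : M.Assign → Prop} (h : Dfb C M P) : Dfb C M (fun e => P (spread n e)) := by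
  have h₀ := ar_exists_tup k (M := M) (fun e => e (Num, 0))
  have h₁ := tm_tup (M := M) (fun (i : Fin (k + 1)) e => e (Num, n i + 1)) fun i => Tm.var Num _
  have h₂ : Ar M (fun e => e (Num, 0) = tup k (fun i => e (Num, n i + 1)) ∨
      (¬ (∃ b, e (Num, 0) = tup k b) ∧ tup k (fun i => e (Num, n i + 1)) = tup k fun _ => 0)) :=
    inferInstance
  have h₃ : Dfb C M (fun e => e (Num, 0) = tup k (fun i => e (Num, n i + 1)) ∨
      (¬ (∃ b, e (Num, 0) = tup k b) ∧ tup k (fun i => e (Num, n i + 1)) = tup k fun _ => 0)) := by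
    obtain ⟨φ, hφ, h'⟩ := h₂
    exact ⟨φ, ha hφ, h'⟩
  refine (dfb_alls_num hC (List.ofFn fun i => n i + 1) (.imp' hr hi h₃ h)).congr fun e => ?_
  simp only [← eq_proj_iff, List.mem_ofFn, forall_exists_index, forall_apply_eq_imp_iff]
  constructor
  · intro hP e' he' hproj
    have : e' = spread n e := by
      funext p
      by_cases hp : ∀ i, p ≠ (Num, n i + 1)
      · rw [spread_of_ne e hp, he' p hp]
      · push Not at hp
        obtain ⟨i, rfl⟩ := hp
        rw [spread_num hn, ← he' (Num, 0) (by simp)]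
        exact congrFun hproj i
    exact this ▸ hP
  · intro h
    refine h _ (fun p hp => spread_of_ne e hp) ?_
    funext i
    rw [spread_num hn, spread_of_ne e (by simp)]

omit [IsModel M] in
open Classical in
theorem spread_update {k : ℕ} {n : Fin (k + 1) → ℕ} (e : M.Assign) {p : sig.Vrb} (hp : p.1 ≠ Num)
    (a : M.carrier p.1) : spread n (Function.update e p a) = Function.update (spread n e) p a := by
  obtain ⟨_ | _, j⟩ := p
  · exact absurd rfl hp
  · funext ⟨σ, i⟩
    rcases σ with _ | _
    · simp [spread]
    · change Function.update e (Sets, j) a (Sets, i) = _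
      by_cases hij : ((Sets, i) : sig.Vrb) = (Sets, j)
      · rw [hij]; simp
      · rw [Function.update_of_ne hij, Function.update_of_ne hij]
        rfl

/-- For `Π¹ₙ`-formulas the tuple is decoded in the arithmetical matrix. This is legitimate because
`spread` commutes with the updates made by set quantifiers. -/
theorem dfb_sat_spread {c : Option ℕ} {φ : Formula HP.sig} (hφ : φ ∈ cls HP.Obj c) {k : ℕ}
    {n : Fin (k + 1) → ℕ} (hn : Function.Injective n) :
    Dfb (cls Num c) M (fun e => (humeStruc M).Sat (humeAssign (spread n e)) φ) := by
  cases c with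
  | none =>
    exact dfb_spread renClosed_univ (fun _ _ _ _ => trivial) (fun _ _ => trivial)
      (fun _ _ _ => trivial) hn (Dfb.transfer_univ humeAssign humeVar humeDec humeDec_surjective
        humeAssign_update (fun φ h => ar_sat_humeStruc h) φ)
  | some m =>
    refine ((Dfb.transfer_pi_sigma (fun e => humeAssign (spread n e)) humeVar humeDec
      humeDec_surjective ?_ ?_ ?_ φ) m).1 hφ
    · rintro e p a hp
      have : (humeVar p).1 ≠ Num := by
        obtain ⟨_ | _, j⟩ := p
        · exact absurd rfl hp
        · simp [humeVar]
      simp only [spread_update e this, humeAssign_update]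
    · rintro ⟨_ | _, j⟩ hp
      · exact absurd rfl hp
      · simp [humeVar]
    · exact fun φ h => dfb_spread (renClosed_arith Num) (fun _ h _ h' => ⟨h, h'⟩) subset_rfl
        (fun _ h _ => ⟨rfl, h⟩) hn (ar_sat_humeStruc h)

/-- Comprehension for tuples reduces to comprehension for numbers: number variable `0` runs over
codes, and `spread` distributes the components to the variables that stand for the arguments. -/
theorem models_humeStruc {c : Option ℕ} (hM : M.Models (schema (cls Num c))) :
    (humeStruc M).Models (HP.base ∪ HP.schema (cls HP.Obj c)) := by
  classical
  rintro φ (h | ⟨k, r, n, φ, hφ, hn, hr, rfl⟩) v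
  · exact models_base_humeStruc φ h v
  obtain ⟨e₀, rfl⟩ := exists_humeAssign_eq v
  obtain ⟨F, hF⟩ := exists_set_of_schema hM (dfb_sat_spread hφ hn) e₀
  rw [HP.sat_comprehension]
  refine ⟨restr k F, fun w hw => ?_⟩
  obtain ⟨a, ha⟩ : ∃ a : Fin (k + 1) → M.carrier Num, a = fun i => w (HP.Obj, n i) := ⟨_, rfl⟩
  rw [← ha]
  refine (show _ ↔ _ from tup_mem_restr (M := M) (a := a)).trans ?_
  have := hF (Function.update e₀ (Num, 0) (tup k a))
    fun p hp => Function.update_of_ne hp _ _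
  rw [Function.update_self] at this
  rw [this]
  refine Struc.sat_congr fun q hq => ?_
  have hqr : q ≠ (HP.Rel k, r) := fun h => hr (h ▸ hq)
  by_cases hqn : ∃ i, q = (HP.Obj, n i)
  · obtain ⟨i, rfl⟩ := hqn
    change spread n _ (Num, n i + 1) = _
    rw [spread_num hn, Function.update_self, proj_tup, ha]
  · push Not at hqn
    refine Eq.trans ?_ ((hw q hqn).trans (Function.update_of_ne hqr _ _)).symm
    rw [humeAssign, humeAssign, spread_of_ne, Function.update_of_ne]
    · obtain ⟨_ | _, j⟩ := q <;> simp [humeVar]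
    · intro i
      obtain ⟨_ | _, j⟩ := q
      · have := hqn i
        simpa [humeVar] using this
      · simp [humeVar]

end Tuples

end PA

namespace PA

/-! ### The interpretation -/

def pairTerm (s t : Term sig Num) : Term sig Num := add (mul (add s t) (add s t)) s

def tupTerm : (k : ℕ) → (Fin (k + 1) → Term sig Num) → Term sig Num
  | 0, t => t 0
  | k + 1, t => pairTerm (t 0) (tupTerm k fun i => t i.succ)

/-- The variable number `j` codes a `(k + 1)`-tuple. -/
def isTupFormula : ℕ → ℕ → Formula sig
  | 0, _ => .imp .fal .fal
  | k + 1, j => .ex (Num, j + 1) <| .ex (Num, j + 2) <|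
      .and (.eq (x j) (pairTerm (x (j + 1)) (x (j + 2)))) (isTupFormula k (j + 2))

/-- The set variable number `0` codes a `(k + 1)`-ary relation. -/
def isRelFormula (k : ℕ) : Formula sig :=
  .all (Num, 0) (.imp (mem (x 0) (X 0)) (isTupFormula k 0))

/-- The set variable number `1` codes the counting function of the one number `0`. -/
def isCountFormula : Formula sig :=
  .and (.and (mem (pairTerm zero zero) (X 1)) <|
    .all (Num, 2) <| .all (Num, 3) <| .imp (mem (pairTerm (x 2) (x 3)) (X 1)) <|
      .and (.imp (mem (x 2) (X 0)) (mem (pairTerm (succ (x 2)) (succ (x 3))) (X 1)))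
        (.imp (.neg (mem (x 2) (X 0))) (mem (pairTerm (succ (x 2)) (x 3)) (X 1)))) <|
  .all (Num, 2) <| .all (Num, 3) <| .all (Num, 4) <|
    .imp (mem (pairTerm (x 2) (x 3)) (X 1)) <| .imp (mem (pairTerm (x 2) (x 4)) (X 1)) <|
      .eq (x 3) (x 4)

/-- The number variable `1` is the cardinality of a set with counting function `1`. -/
def isCardOfFormula : Formula sig :=
  .imp (.neg <| .ex (Num, 2) <| .and (.eq (x 1) (succ (x 2))) <|
      .and (.ex (Num, 3) <| mem (pairTerm (x 3) (x 2)) (X 1)) <|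
        .all (Num, 3) <| .all (Num, 4) <| .imp (mem (pairTerm (x 3) (x 4)) (X 1)) <|
          le (x 4) (x 2)) <|
    .and (.eq (x 1) zero) <| .all (Num, 2) <| .ex (Num, 3) <| .ex (Num, 4) <|
      .and (mem (pairTerm (x 3) (x 4)) (X 1)) (.neg (le (x 4) (x 2)))

section

variable {M : Struc.{u} sig} [IsModel M] {v : M.Assign}

omit [IsModel M] in
@[simp] theorem val_pairTerm (s t : Term sig Num) :
    M.val v (pairTerm s t) = pair (M.val v s) (M.val v t) := by
  simp [pairTerm, pair]

omit [IsModel M] in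
theorem val_tupTerm : ∀ {k : ℕ} (t : Fin (k + 1) → Term sig Num),
    M.val v (tupTerm k t) = tup k fun i => M.val v (t i)
  | 0, _ => rfl
  | k + 1, t => by rw [tupTerm, val_pairTerm, val_tupTerm]; rfl

omit [IsModel M] in
theorem sat_isTupFormula : ∀ {k j : ℕ} {v : M.Assign},
    M.Sat v (isTupFormula k j) ↔ ∃ a, v (Num, j) = tup k a
  | 0, j, v => ⟨fun _ => ⟨fun _ => v (Num, j), rfl⟩, fun _ h => h⟩
  | k + 1, j, v => by
    rw [exists_tup_succ]
    simp only [isTupFormula, Struc.Sat, Struc.sat_and, sat_isTupFormula, val_pairTerm, val_x]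
    simp [Function.update]

omit [IsModel M] in
theorem sat_isRelFormula {k : ℕ} : M.Sat v (isRelFormula k) ↔ IsRel k (v (Sets, 0)) := by
  simp only [isRelFormula, Struc.Sat, sat_isTupFormula, sat_mem, val_x, val_X]
  simp [Function.update, IsRel]

theorem sat_isCountFormula : M.Sat v isCountFormula ↔ IsCount (v (Sets, 0)) (v (Sets, 1)) := by
  simp only [isCountFormula, Struc.Sat, Struc.sat_and, Struc.sat_neg, sat_mem, val_x, val_X,
    val_pairTerm, val_succ, val_zero, IsCount, CountClosed, add_one']
  simp [Function.update]

theorem sat_isCardOfFormula :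
    M.Sat v isCardOfFormula ↔ IsCardOf (v (Sets, 1)) (v (Num, 1)) := by
  simp only [isCardOfFormula, Struc.Sat, Struc.sat_and, Struc.sat_neg, sat_mem, sat_le, val_x,
    val_X, val_pairTerm, val_succ, val_zero, IsCardOf, add_one', ← not_le]
  simp [Function.update, or_iff_not_imp_left]

/-- The scheme must do without the parameters of `ar_card_eq`, but it may use a set quantifier. Any
counting graph gives the same cardinality. -/
theorem sat_cardFormula : M.Sat v (.ex (Sets, 1) (.and isCountFormula isCardOfFormula)) ↔
    card (v (Sets, 0)) = v (Num, 1) := by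
  simp only [Struc.Sat, Struc.sat_and, sat_isCountFormula, sat_isCardOfFormula]
  simp only [Function.update_self, ne_eq, Prod.mk.injEq, reduceCtorEq, false_and, and_false,
    not_false_eq_true, Function.update_of_ne, zero_ne_one]
  constructor
  · rintro ⟨F, hF, h⟩
    exact (hF.isCardOf_iff_card _).1 h
  · intro h
    obtain ⟨F, hF⟩ := exists_isCount (v (Sets, 0))
    exact ⟨F, hF, (hF.isCardOf_iff_card _).2 h⟩

end

/-- The interpretation of the theory of Hume's Principle in arithmetic. -/
noncomputable def humeScheme : Scheme HP.sig sig :=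
  Scheme.ofFormulas.{u} (fun | .obj => Num | .rel _ => Sets)
    (fun | .obj => .imp .fal .fal | .rel k => isRelFormula k)
    (fun k => mem (tupTerm k fun i => x (i + 1)) (X 0))
    (fun _ => .ex (Sets, 1) (.and isCountFormula isCardOfFormula))

theorem defines_humeStruc (M : Struc.{u} sig) [IsModel M] :
    humeScheme.{u}.Defines M (humeStruc M) := by
  refine ⟨fun | .obj => fun a => a | .rel k => Subtype.val, ?_, ?_, ?_, ?_⟩
  · rintro (_ | k)
    exacts [fun _ _ h => h, Subtype.val_injective]
  · rintro (_ | k) v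
    · refine iff_of_true ⟨_, rfl⟩ ((Formula.sat_closeTo (P := fun _ => True)
        (fun _ => iff_of_true id trivial) (fun _ _ _ h => h) v).2 trivial)
    · refine Iff.trans ?_ (Formula.sat_closeTo (fun v => sat_isRelFormula (k := k) (v := v))
        (fun v w h hv => ?_) v).symm
      · exact ⟨fun ⟨Y, hY⟩ => hY ▸ Y.2, fun h => ⟨⟨_, h⟩, rfl⟩⟩
      · rwa [← h _ rfl]
  · intro k a v hv
    refine Iff.trans ?_ (Formula.sat_closeTo
      (P := fun v => tup k (fun i : Fin (k + 1) => v (Num, i + 1)) ∈ v (Sets, 0)) (fun v => ?_)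
        (fun v w h hv => ?_) v).symm
    · have h₀ : v (Sets, 0) = (a 0).1 := hv 0
      have h₁ : ∀ i : Fin (k + 1), v (Num, i + 1) = a i.succ := fun i => hv i.succ
      change tup k _ ∈ (a 0).1 ↔ _
      rw [h₀]
      simp only [h₁]
    · rw [sat_mem, val_tupTerm]
      rfl
    · have h₀ : v (Sets, 0) = w (Sets, 0) := h _ ⟨0, rfl⟩
      have h₁ : ∀ i : Fin (k + 1), v (Num, i + 1) = w (Num, i + 1) := fun i => h _ ⟨i.succ, rfl⟩
      rw [← h₀]
      simpa only [h₁] using hv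
  · intro f a b v hv hb
    refine Iff.trans ?_ (Formula.sat_closeTo (fun v => sat_cardFormula (v := v))
      (fun v w h hv => ?_) v).symm
    · have h₀ : v (Sets, 0) = (a 0).1 := hv 0
      have h₁ : v (Num, 1) = b := hb
      rw [h₀, h₁]
      rfl
    · have h₀ : v (Sets, 0) = w (Sets, 0) := h _ (Or.inl ⟨0, rfl⟩)
      have h₁ : v (Num, 1) = w (Num, 1) := h _ (Or.inr rfl)
      rwa [← h₀, ← h₁]

theorem interpretable_hume {c : Option ℕ} (hc : c ≠ some 0) :
    Interpretable.{u} (HP.base ∪ HP.schema (cls HP.Obj c)) (base ∪ schema (cls Num c)) := by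
  refine ⟨humeScheme.{u}, fun M hM => ?_⟩
  have := isModel_of_models hc hM
  exact ⟨humeStruc M, models_humeStruc fun φ hφ => hM φ (Or.inr hφ), defines_humeStruc M⟩

end PA

/-! ## Frege arithmetic -/

namespace HP

section Semantics

variable {M : Struc.{u} sig}

/-- Definability by arithmetical formulas with parameters. -/
abbrev Ar (M : Struc.{u} sig) (P : M.Assign → Prop) : Prop := Dfb (arith Obj) M P

/-- Definability by `Π¹₁`-formulas with parameters. -/
abbrev Pi1 (M : Struc.{u} sig) (P : M.Assign → Prop) : Prop := Dfb (piCls Obj 1) M P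

instance (P : M.Assign → Prop) [h : Ar M P] : Pi1 M P :=
  .pi_of_arith (τ := Rel 0) (by simp) P h

instance {k : ℕ} (P : M.Assign → M.carrier (Rel k) → Prop)
    [h : Pi1 M (fun e => P e.tail (e (Rel k, 0)))] : Pi1 M (fun e => ∀ Y, P e Y) :=
  .all_pi (by simp) P h

instance tm_num (f : M.Assign → M.carrier (Rel 0)) [h : Tm M f] : Tm M (fun e => num (f e)) :=
  Tm.fn (M := M) () (fun _ => f) fun _ => h

theorem ar_app {k : ℕ} (f : M.Assign → M.carrier (Rel k))
    (g : Fin (k + 1) → M.Assign → M.carrier Obj) [hf : Tm M f] (hg : ∀ i, Tm M (g i)) :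
    Ar M (fun e => app (f e) fun i => g i e) := by
  refine (Dfb.rel (M := M) (ob := Obj) k (fun i => Fin.cases f g i) (fun i => by
    induction i using Fin.cases
    exacts [hf, hg _])).congr fun e => ?_
  rw [rl_iff_app]
  rfl

instance ar_app1 (f : M.Assign → M.carrier (Rel 0)) (a : M.Assign → M.carrier Obj)
    [Tm M f] [ha : Tm M a] : Ar M (fun e => app1 (f e) (a e)) :=
  (ar_app f ![a] (by simpa [Fin.forall_fin_one] using ha)).congr fun e => iff_of_eq <|
    congrArg _ <| funext fun i => by fin_cases i; rfl

instance ar_app2 (f : M.Assign → M.carrier (Rel 1)) (a b : M.Assign → M.carrier Obj)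
    [Tm M f] [ha : Tm M a] [hb : Tm M b] : Ar M (fun e => app2 (f e) (a e) (b e)) :=
  (ar_app f ![a, b] (by intro i; fin_cases i; exacts [ha, hb])).congr fun e => iff_of_eq <|
    congrArg _ <| funext fun i => by fin_cases i <;> rfl

instance ar_app3 (f : M.Assign → M.carrier (Rel 2)) (a b c : M.Assign → M.carrier Obj)
    [Tm M f] [ha : Tm M a] [hb : Tm M b] [hc : Tm M c] :
    Ar M (fun e => app3 (f e) (a e) (b e) (c e)) :=
  (ar_app f ![a, b, c] (by intro i; fin_cases i; exacts [ha, hb, hc])).congr fun e => iff_of_eq <|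
    congrArg _ <| funext fun i => by fin_cases i <;> rfl

end Semantics

theorem exists_rel_of_schema {M : Struc.{u} sig} {c : Option ℕ}
    (hM : M.Models (schema (cls Obj c))) {P : M.Assign → Prop} (hP : Dfb (cls Obj c) M P)
    {k : ℕ} {n : Fin (k + 1) → ℕ} (hn : Function.Injective n) (e₀ : M.Assign) :
    ∃ A : M.carrier (Rel k), ∀ e : M.Assign, (∀ p, (∀ i, p ≠ (Obj, n i)) → e p = e₀ p) →
      (app A (fun i => e (Obj, n i)) ↔ P e) := by
  classical
  obtain ⟨φ, hφ, hfr, v, hv⟩ := hP.exists_fresh (renClosed_cls c)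
  obtain ⟨A, hA⟩ := sat_comprehension.1 <| hM _ ⟨k, 1, fun i => 2 * n i, φ, hφ,
    fun i j h => hn (Nat.eq_of_mul_eq_mul_left two_pos h), hfr _, rfl⟩ (M.mix v e₀)
  refine ⟨A, fun e he => ?_⟩
  have h := hA (Function.update (M.mix v e) (Rel k, 1) A) (by
    intro q hq
    by_cases hq' : q = (Rel k, 1)
    · subst hq'; simp
    · rw [Function.update_of_ne hq', Function.update_of_ne hq']
      obtain ⟨σ, m⟩ := q
      obtain ⟨i, rfl | rfl⟩ := Nat.even_or_odd' m
      · rw [Struc.mix_even _ _ _ rfl, Struc.mix_even _ _ _ rfl]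
        refine he _ fun j hj => hq j ?_
        simp only [Prod.mk.injEq] at hj ⊢
        exact ⟨hj.1, by rw [hj.2]⟩
      · rw [Struc.mix_odd _ _ _ rfl, Struc.mix_odd _ _ _ rfl])
  rw [hv]
  have h₁ : (fun i => Function.update (M.mix v e) (Rel k, 1) A (Obj, 2 * n i)) =
      fun i => e (Obj, n i) := by
    funext i
    rw [Function.update_of_ne (by simp), Struc.mix_even _ _ _ rfl]
  rw [h₁] at h
  rw [h]
  refine Struc.sat_congr fun q hq => Function.update_of_ne ?_ _ _
  rintro rfl
  exact hfr _ hq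

/-- Models of the axioms other than comprehension that satisfy `Π¹₁`-comprehension. -/
class IsModel (M : Struc.{u} sig) : Prop where
  hume : ∀ A B : M.carrier (Rel 0), num A = num B ↔ ∃ f, IsBij f A B
  ext : ∀ {k : ℕ} (A B : M.carrier (Rel k)), (∀ a, app A a ↔ app B a) → A = B
  compr : ∀ {k : ℕ} (P : (Fin (k + 1) → M.carrier Obj) → Prop),
    Pi1 M (fun e => P fun i => e (Obj, i)) → ∃ A : M.carrier (Rel k), ∀ a, app A a ↔ P a

theorem isModel_of_models {M : Struc.{u} sig} {c : Option ℕ} (hc : c ≠ some 0)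
    (hM : M.Models (base ∪ schema (cls Obj c))) : IsModel M := by
  classical
  let w : M.Assign := fun p => (M.nonempty p.1).some
  constructor
  · intro A B
    have := hM HP.hume (Or.inl (Or.inl rfl))
      (Function.update (Function.update w (Rel 0, 0) A) (Rel 0, 1) B)
    rw [sat_hume] at this
    rw [Function.update_self, Function.update_of_ne (by simp), Function.update_self] at this
    exact this
  · intro k
    exact sat_extensionality.1 (hM _ (Or.inl (Or.inr ⟨k, rfl⟩)))
  · intro k P hP
    obtain ⟨A, hA⟩ := exists_rel_of_schema (fun φ hφ => hM φ (Or.inr hφ))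
      (Dfb.cls_of_pi (τ := Rel 0) (by simp) hc hP) (n := fun i : Fin (k + 1) => (i : ℕ))
      Fin.val_injective w
    refine ⟨A, fun a => ?_⟩
    have := hA (fun p => match p with
      | (.obj, i) => if h : i < k + 1 then a ⟨i, h⟩ else w (Obj, i)
      | (.rel j, i) => w (Rel j, i)) (by
        rintro ⟨_ | j, i⟩ hq
        · have : ¬ i < k + 1 := fun hi => hq ⟨i, hi⟩ rfl
          simp only [this, dite_false]
        · rfl)
    simpa only [Fin.is_lt, dite_true, Fin.eta] using this

-- Successor, order and natural numbers from Hume's Principle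

section Frege

variable {M : Struc.{u} sig} [IsModel M]

theorem compr1 (P : M.carrier Obj → Prop) [h : Pi1 M (fun e => P (e (Obj, 0)))] :
    ∃ A : M.carrier (Rel 0), ∀ a, app1 A a ↔ P a := by
  obtain ⟨A, hA⟩ := IsModel.compr (M := M) (k := 0) (fun a => P (a 0)) h
  exact ⟨A, fun a => hA _⟩

theorem compr2 (P : M.carrier Obj → M.carrier Obj → Prop)
    [h : Pi1 M (fun e => P (e (Obj, 0)) (e (Obj, 1)))] :
    ∃ A : M.carrier (Rel 1), ∀ a b, app2 A a b ↔ P a b := by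
  obtain ⟨A, hA⟩ := IsModel.compr (M := M) (k := 1) (fun a => P (a 0) (a 1)) h
  exact ⟨A, fun a b => hA _⟩

theorem compr3 (P : M.carrier Obj → M.carrier Obj → M.carrier Obj → Prop)
    [h : Pi1 M (fun e => P (e (Obj, 0)) (e (Obj, 1)) (e (Obj, 2)))] :
    ∃ A : M.carrier (Rel 2), ∀ a b c, app3 A a b c ↔ P a b c := by
  obtain ⟨A, hA⟩ := IsModel.compr (M := M) (k := 2) (fun a => P (a 0) (a 1) (a 2)) h
  exact ⟨A, fun a b c => hA _⟩

theorem set_ext {A B : M.carrier (Rel 0)} (h : ∀ a, app1 A a ↔ app1 B a) : A = B := by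
  refine IsModel.ext A B fun a => ?_
  have ha : a = ![a 0] := by funext i; fin_cases i; rfl
  rw [ha]
  exact h _

/-- `B` is obtained from `A` by removing the element `u`. -/
def IsErase (A : M.carrier (Rel 0)) (u : M.carrier Obj) (B : M.carrier (Rel 0)) : Prop :=
  app1 A u ∧ ∀ a, app1 B a ↔ app1 A a ∧ a ≠ u

omit [IsModel M] in
instance ar_isErase (f : M.Assign → M.carrier (Rel 0)) (g : M.Assign → M.carrier Obj)
    (h : M.Assign → M.carrier (Rel 0)) [Tm M f] [Tm M g] [Tm M h] :
    Ar M (fun e => IsErase (f e) (g e) (h e)) := by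
  unfold IsErase; infer_instance

/-- The bijection is rerouted: if `u` is not sent to `w`, the preimage of `w` is sent to the image
of `u`. -/
theorem IsBij.erase {f : M.carrier (Rel 1)} {A A' B B' : M.carrier (Rel 0)} {u w : M.carrier Obj}
    (hf : IsBij f A B) (hA : IsErase A u A') (hB : IsErase B w B') : ∃ g, IsBij g A' B' := by
  obtain ⟨g, hg⟩ := compr2 (M := M) fun a b =>
    a ≠ u ∧ b ≠ w ∧ (app2 f a b ∨ (app2 f a w ∧ app2 f u b))
  obtain ⟨hu, hA⟩ := hA
  obtain ⟨hw, hB⟩ := hB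
  obtain ⟨fu, hfu⟩ := hf.total u hu
  obtain ⟨fw, hfw⟩ := hf.surjective w hw
  obtain ⟨h₁, h₂, h₃, h₄, h₅⟩ := hf
  refine ⟨g, ?_, ?_, ?_, ?_, ?_⟩
  · intro a b h
    rw [hA, hB]
    obtain ⟨ha, hb, h | h⟩ := (hg a b).1 h
    · exact ⟨⟨(h₁ _ _ h).1, ha⟩, (h₁ _ _ h).2, hb⟩
    · exact ⟨⟨(h₁ _ _ h.1).1, ha⟩, (h₁ _ _ h.2).2, hb⟩
  · intro a ha
    obtain ⟨ha, hau⟩ := (hA a).1 ha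
    obtain ⟨b, hb⟩ := h₂ a ha
    by_cases hbw : b = w
    · subst hbw
      refine ⟨fu, (hg _ _).2 ⟨hau, ?_, Or.inr ⟨hb, hfu⟩⟩⟩
      rintro rfl
      exact hau (h₄ _ _ _ hb hfu)
    · exact ⟨b, (hg _ _).2 ⟨hau, hbw, Or.inl hb⟩⟩
  · intro a b c h h'
    obtain ⟨ha, hb, h⟩ := (hg a b).1 h
    obtain ⟨-, hc, h'⟩ := (hg a c).1 h'
    rcases h with h | h <;> rcases h' with h' | h'
    · exact h₃ _ _ _ h h'
    · exact absurd (h₃ _ _ _ h h'.1) hb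
    · exact absurd (h₃ _ _ _ h' h.1) hc
    · exact h₃ _ _ _ h.2 h'.2
  · intro a b c h h'
    obtain ⟨ha, hc, h⟩ := (hg a c).1 h
    obtain ⟨hb, -, h'⟩ := (hg b c).1 h'
    rcases h with h | h <;> rcases h' with h' | h'
    · exact h₄ _ _ _ h h'
    · exact absurd (h₄ _ _ _ h h'.2) ha
    · exact absurd (h₄ _ _ _ h' h.2) hb
    · exact h₄ _ _ _ h.1 h'.1
  · intro b hb
    obtain ⟨hb, hbw⟩ := (hB b).1 hb
    obtain ⟨a, ha⟩ := h₅ b hb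
    by_cases hau : a = u
    · subst hau
      refine ⟨fw, (hg _ _).2 ⟨?_, hbw, Or.inr ⟨hfw, ha⟩⟩⟩
      rintro rfl
      exact hbw (h₃ _ _ _ ha hfw)
    · exact ⟨a, (hg _ _).2 ⟨hau, hbw, Or.inl ha⟩⟩

theorem IsBij.insert {f : M.carrier (Rel 1)} {A A' B B' : M.carrier (Rel 0)}
    {u w : M.carrier Obj} (hf : IsBij f A' B') (hA : IsErase A u A') (hB : IsErase B w B') :
    ∃ g, IsBij g A B := by
  obtain ⟨g, hg⟩ := compr2 (M := M) fun a b => app2 f a b ∨ (a = u ∧ b = w)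
  obtain ⟨hu, hA⟩ := hA
  obtain ⟨hw, hB⟩ := hB
  obtain ⟨h₁, h₂, h₃, h₄, h₅⟩ := hf
  have hfu : ∀ b, ¬ app2 f u b := fun b h => ((hA u).1 (h₁ _ _ h).1).2 rfl
  have hfw : ∀ a, ¬ app2 f a w := fun a h => ((hB w).1 (h₁ _ _ h).2).2 rfl
  refine ⟨g, ?_, ?_, ?_, ?_, ?_⟩
  · intro a b h
    rcases (hg a b).1 h with h | ⟨rfl, rfl⟩
    · exact ⟨((hA _).1 (h₁ _ _ h).1).1, ((hB _).1 (h₁ _ _ h).2).1⟩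
    · exact ⟨hu, hw⟩
  · intro a ha
    by_cases hau : a = u
    · exact ⟨w, (hg _ _).2 (Or.inr ⟨hau, rfl⟩)⟩
    · obtain ⟨b, hb⟩ := h₂ a ((hA a).2 ⟨ha, hau⟩)
      exact ⟨b, (hg _ _).2 (Or.inl hb)⟩
  · intro a b c h h'
    rcases (hg a b).1 h with h | ⟨rfl, rfl⟩ <;> rcases (hg _ c).1 h' with h' | ⟨e, e'⟩
    exacts [h₃ _ _ _ h h', absurd (e ▸ h) (hfu _), absurd h' (hfu _), e'.symm]
  · intro a b c h h'
    rcases (hg a c).1 h with h | ⟨rfl, rfl⟩ <;> rcases (hg b _).1 h' with h' | ⟨e, e'⟩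
    exacts [h₄ _ _ _ h h', absurd (e' ▸ h) (hfw _), absurd h' (hfw _), e.symm]
  · intro b hb
    by_cases hbw : b = w
    · exact ⟨u, (hg _ _).2 (Or.inr ⟨rfl, hbw⟩)⟩
    · obtain ⟨a, ha⟩ := h₅ b ((hB b).2 ⟨hb, hbw⟩)
      exact ⟨a, (hg _ _).2 (Or.inl ha)⟩

/-- One direction makes the successor relation functional, the other makes it injective. -/
theorem num_eq_iff_of_isErase {A A' B B' : M.carrier (Rel 0)} {u w : M.carrier Obj}
    (hA : IsErase A u A') (hB : IsErase B w B') : num A = num B ↔ num A' = num B' := by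
  rw [IsModel.hume, IsModel.hume]
  exact ⟨fun ⟨f, hf⟩ => hf.erase hA hB, fun ⟨f, hf⟩ => hf.insert hA hB⟩

/-- `z` is the immediate successor of `y` as a cardinality. -/
def Suc (y z : M.carrier Obj) : Prop := ∃ A B u, IsErase A u B ∧ num A = z ∧ num B = y

/-- The definition of `Suc` has existential set quantifiers, so comprehension is applied to its
negation and a complement is taken. -/
theorem exists_suc : ∃ S : M.carrier (Rel 1), ∀ y z, app2 S y z ↔ Suc y z := by
  obtain ⟨T, hT⟩ := compr2 (M := M) fun y z => ∀ A B : M.carrier (Rel 0), ∀ u,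
    IsErase A u B → num A = z → num B ≠ y
  obtain ⟨S, hS⟩ := compr2 (M := M) fun y z => ¬ app2 T y z
  refine ⟨S, fun y z => ?_⟩
  rw [hS, hT]
  push Not
  rfl

/-- With the graph as a parameter, `Suc` counts as arithmetical in further definitions. The same
device is used for order, addition and multiplication. -/
instance ar_suc (f g : M.Assign → M.carrier Obj) [Tm M f] [Tm M g] :
    Ar M (fun e => Suc (f e) (g e)) := by
  obtain ⟨S, hS⟩ := exists_suc (M := M)
  simp only [← hS]
  infer_instance

theorem Suc.eq_iff {y z y' z' : M.carrier Obj} (h : Suc y z) (h' : Suc y' z') :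
    y = y' ↔ z = z' := by
  obtain ⟨A, B, u, hA, rfl, rfl⟩ := h
  obtain ⟨A', B', u', hA', rfl, rfl⟩ := h'
  exact (num_eq_iff_of_isErase hA hA').symm

theorem Suc.right_unique {y z z' : M.carrier Obj} (h : Suc y z) (h' : Suc y z') : z = z' :=
  (h.eq_iff h').1 rfl

theorem Suc.left_unique {y y' z : M.carrier Obj} (h : Suc y z) (h' : Suc y' z) : y = y' :=
  (h.eq_iff h').2 rfl

theorem exists_empty : ∃ A : M.carrier (Rel 0), ∀ a, ¬ app1 A a := by
  obtain ⟨A, hA⟩ := compr1 (M := M) fun _ => False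
  exact ⟨A, fun a => (hA a).1⟩

variable (M) in
/-- The cardinality of the empty set. -/
noncomputable def zero : M.carrier Obj := num (exists_empty (M := M)).choose

theorem eq_zero_iff {z : M.carrier Obj} :
    z = zero M ↔ ∃ A : M.carrier (Rel 0), (∀ a, ¬ app1 A a) ∧ num A = z := by
  have h := (exists_empty (M := M)).choose_spec
  constructor
  · rintro rfl
    exact ⟨_, h, rfl⟩
  · rintro ⟨A, hA, rfl⟩
    exact congrArg num (set_ext fun a => iff_of_false (hA a) (h a))

theorem Suc.ne_zero {y z : M.carrier Obj} (h : Suc y z) : z ≠ zero M := by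
  intro hz
  obtain ⟨A, B, u, hA, rfl, rfl⟩ := h
  obtain ⟨C, hC, h⟩ := eq_zero_iff.1 hz
  obtain ⟨f, hf⟩ := (IsModel.hume _ _).1 h
  obtain ⟨a, ha⟩ := hf.surjective u hA.1
  exact hC a (hf.mem _ _ ha).1

/-- The weak ancestral of the successor relation. -/
def Le (m n : M.carrier Obj) : Prop := ∀ F : M.carrier (Rel 0), app1 F m →
  (∀ y z, app1 F y → Suc y z → app1 F z) → app1 F n

instance ar_le (f g : M.Assign → M.carrier Obj) [Tm M f] [Tm M g] :
    Ar M (fun e => Le (f e) (g e)) := by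
  obtain ⟨S, hS⟩ := compr2 (M := M) fun m n => ∀ F : M.carrier (Rel 0), app1 F m →
    (∀ y z, app1 F y → Suc y z → app1 F z) → app1 F n
  unfold Le
  simp only [← hS]
  infer_instance

omit [IsModel M] in
theorem Le.refl (m : M.carrier Obj) : Le m m := fun _ h _ => h

omit [IsModel M] in
theorem Le.suc {m n k : M.carrier Obj} (h : Le m n) (h' : Suc n k) : Le m k :=
  fun F h₀ h₁ => h₁ _ _ (h F h₀ h₁) h'

omit [IsModel M] in
theorem Le.trans {m n k : M.carrier Obj} (h : Le m n) (h' : Le n k) : Le m k :=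
  fun F h₀ h₁ => h' F (h F h₀ h₁) h₁

theorem Le.cases {m n : M.carrier Obj} (h : Le m n) : m = n ∨ ∃ k, Le m k ∧ Suc k n := by
  obtain ⟨F, hF⟩ := compr1 (M := M) fun n => m = n ∨ ∃ k, Le m k ∧ Suc k n
  refine (hF n).1 (h F ((hF m).2 (Or.inl rfl)) fun y z hy hyz => (hF z).2 (Or.inr ⟨y, ?_, hyz⟩))
  rcases (hF y).1 hy with rfl | ⟨k, hk, hk'⟩
  exacts [Le.refl _, hk.suc hk']

/-- The natural numbers. -/
def Nt (n : M.carrier Obj) : Prop := Le (zero M) n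

instance ar_nt (f : M.Assign → M.carrier Obj) [Tm M f] : Ar M (fun e => Nt (f e)) := by
  unfold Nt; infer_instance

theorem nt_zero : Nt (zero M) := Le.refl _

theorem Nt.suc {m n : M.carrier Obj} (h : Nt m) (h' : Suc m n) : Nt n := Le.suc h h'

theorem Nt.induct (P : M.carrier Obj → Prop) [hP : Pi1 M (fun e => P (e (Obj, 0)))]
    (h₀ : P (zero M)) (h₁ : ∀ m n, Nt m → P m → Suc m n → P n) {n : M.carrier Obj} (hn : Nt n) :
    P n := by
  obtain ⟨F, hF⟩ := compr1 P
  -- Intersecting with the natural numbers lets the induction step assume that `m` is one.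
  obtain ⟨G, hG⟩ := compr1 (M := M) fun n => Nt n ∧ app1 F n
  refine (hF n).1 ((hG n).1 (hn G ((hG _).2 ⟨nt_zero, (hF _).2 h₀⟩) fun y z hy hyz => ?_)).2
  obtain ⟨h, h'⟩ := (hG y).1 hy
  exact (hG z).2 ⟨h.suc hyz, (hF z).2 (h₁ y z h ((hF y).1 h') hyz)⟩

/-- The successor relation has no cycles among the natural numbers. Hence a successor is a new
element when it joins the numbers up to its predecessor. -/
theorem Nt.not_suc_le {n : M.carrier Obj} (hn : Nt n) : ∀ k, Suc n k → ¬ Le k n := by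
  refine hn.induct (fun n => ∀ k, Suc n k → ¬ Le k n) ?_ ?_
  · intro k hk h
    rcases h.cases with rfl | ⟨j, -, hj⟩
    exacts [hk.ne_zero rfl, hj.ne_zero rfl]
  · intro m n _ ih hmn k hk h
    rcases h.cases with rfl | ⟨j, hj, hj'⟩
    · obtain rfl := hmn.left_unique hk
      exact ih _ hk (Le.refl _)
    · obtain rfl := hj'.left_unique hmn
      exact ih n hmn (((Le.refl n).suc hk).trans hj)

/-- Frege's theorem that every natural number `n` has a successor: the number of natural numbers
up to `n`. -/
theorem Nt.exists_suc {n : M.carrier Obj} (hn : Nt n) : ∃ k, Suc n k := by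
  -- The set of numbers up to `n` is quantified universally to obtain a `Π¹₁` induction predicate.
  have key : ∀ A : M.carrier (Rel 0), (∀ m, app1 A m ↔ Le m n) → Suc n (num A) := by
    refine hn.induct (fun n => ∀ A : M.carrier (Rel 0), (∀ m, app1 A m ↔ Le m n) →
      Suc n (num A)) ?_ ?_
    · intro A hA
      obtain ⟨B, hB⟩ := exists_empty (M := M)
      refine ⟨A, B, zero M, ⟨(hA _).2 (Le.refl _), fun a => ?_⟩, rfl,
        (eq_zero_iff.2 ⟨B, hB, rfl⟩).symm ▸ rfl⟩
      refine iff_of_false (hB a) ?_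
      rintro ⟨h, h'⟩
      rcases ((hA a).1 h).cases with rfl | ⟨k, -, hk⟩
      exacts [h' rfl, hk.ne_zero rfl]
    · intro m n hm ih hmn A hA
      obtain ⟨B, hB⟩ := compr1 (M := M) fun k => Le k m
      -- Without `n`, the numbers up to `n` are those up to `m`. By the induction hypothesis their
      -- number succeeds `m`, so it is `n`.
      refine ⟨A, B, n, ⟨(hA n).2 (Le.refl n), fun a => ?_⟩, rfl, (ih B hB).right_unique hmn⟩
      rw [hB, hA]
      constructor
      · refine fun h => ⟨h.suc hmn, ?_⟩
        rintro rfl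
        exact hm.not_suc_le _ hmn h
      · rintro ⟨h, h'⟩
        rcases h.cases with rfl | ⟨k, hk, hk'⟩
        · exact absurd rfl h'
        · rwa [hmn.left_unique hk']
  obtain ⟨A, hA⟩ := compr1 (M := M) fun m => Le m n
  exact ⟨_, key A hA⟩

/-! ### Recursion -/

/-- `R` contains the graph of the function that is defined from `B` and `G` by recursion. -/
def RecClosed (B : M.carrier Obj → M.carrier Obj → Prop)
    (G : M.carrier Obj → M.carrier Obj → M.carrier Obj → Prop) (R : M.carrier (Rel 2)) : Prop :=
  (∀ x z, B x z → app3 R x (zero M) z) ∧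
    ∀ x y z y' z', app3 R x y z → Suc y y' → G x z z' → app3 R x y' z'

/-- The graph of the function that is defined from `B` and `G` by recursion. -/
def Rec (B : M.carrier Obj → M.carrier Obj → Prop)
    (G : M.carrier Obj → M.carrier Obj → M.carrier Obj → Prop) (x y z : M.carrier Obj) : Prop :=
  ∀ R : M.carrier (Rel 2), RecClosed B G R → app3 R x y z

section Recursion

variable {B : M.carrier Obj → M.carrier Obj → Prop}
  {G : M.carrier Obj → M.carrier Obj → M.carrier Obj → Prop}

/-- When `B` and `G` are relations of the model, `Rec` is `Π¹₁` with these as parameters. -/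
theorem exists_rec (hB : ∃ b : M.carrier (Rel 1), ∀ x z, app2 b x z ↔ B x z)
    (hG : ∃ g : M.carrier (Rel 2), ∀ x z z', app3 g x z z' ↔ G x z z') :
    ∃ H : M.carrier (Rel 2), ∀ x y z, app3 H x y z ↔ Rec B G x y z := by
  obtain ⟨b, hb⟩ := hB
  obtain ⟨g, hg⟩ := hG
  simp only [Rec, RecClosed, ← hb, ← hg]
  exact compr3 (M := M) fun x y z => ∀ R : M.carrier (Rel 2),
    ((∀ x z, app2 b x z → app3 R x (zero M) z) ∧
      ∀ x y z y' z', app3 R x y z → Suc y y' → app3 g x z z' → app3 R x y' z') → app3 R x y z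

theorem rec_cases (hB : ∃ b : M.carrier (Rel 1), ∀ x z, app2 b x z ↔ B x z)
    (hG : ∃ g : M.carrier (Rel 2), ∀ x z z', app3 g x z z' ↔ G x z z') {x y z : M.carrier Obj} :
    Rec B G x y z ↔ (y = zero M ∧ B x z) ∨ ∃ y₀ z₀, Rec B G x y₀ z₀ ∧ Suc y₀ y ∧ G x z₀ z := by
  obtain ⟨H, hH⟩ := exists_rec hB hG
  have mpr : ∀ x y z : M.carrier Obj, ((y = zero M ∧ B x z) ∨
      ∃ y₀ z₀, Rec B G x y₀ z₀ ∧ Suc y₀ y ∧ G x z₀ z) → Rec B G x y z := by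
    rintro x y z (⟨rfl, h⟩ | ⟨y₀, z₀, h, h', h''⟩) R hR
    exacts [hR.1 x z h, hR.2 x y₀ z₀ y z (h R hR) h' h'']
  refine ⟨fun h => ?_, mpr x y z⟩
  obtain ⟨b, hb⟩ := hB
  obtain ⟨g, hg⟩ := hG
  -- Inversion by minimality: the right-hand side defines a closed relation.
  obtain ⟨K, hK⟩ := compr3 (M := M) fun x y z => (y = zero M ∧ app2 b x z) ∨
    ∃ y₀ z₀, app3 H x y₀ z₀ ∧ Suc y₀ y ∧ app3 g x z₀ z
  simp only [hb, hg, hH] at hK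
  refine (hK x y z).1 (h K ⟨fun x z h => (hK _ _ _).2 (Or.inl ⟨rfl, h⟩), ?_⟩)
  intro x y z y' z' h h' h''
  exact (hK _ _ _).2 (Or.inr ⟨y, z, mpr x y z ((hK _ _ _).1 h), h', h''⟩)

theorem rec_zero (hB : ∃ b : M.carrier (Rel 1), ∀ x z, app2 b x z ↔ B x z)
    (hG : ∃ g : M.carrier (Rel 2), ∀ x z z', app3 g x z z' ↔ G x z z') {x z : M.carrier Obj} :
    Rec B G x (zero M) z ↔ B x z := by
  rw [rec_cases hB hG]
  refine ⟨?_, fun h => Or.inl ⟨rfl, h⟩⟩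
  rintro (h | ⟨_, _, _, h, _⟩)
  exacts [h.2, absurd rfl h.ne_zero]

theorem rec_suc (hB : ∃ b : M.carrier (Rel 1), ∀ x z, app2 b x z ↔ B x z)
    (hG : ∃ g : M.carrier (Rel 2), ∀ x z z', app3 g x z z' ↔ G x z z') {x y y' z : M.carrier Obj}
    (hy : Suc y y') : Rec B G x y' z ↔ ∃ z₀, Rec B G x y z₀ ∧ G x z₀ z := by
  rw [rec_cases hB hG]
  constructor
  · rintro (⟨rfl, -⟩ | ⟨y₀, z₀, h, h', h''⟩)
    · exact absurd rfl hy.ne_zero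
    · obtain rfl := h'.left_unique hy
      exact ⟨z₀, h, h''⟩
  · exact fun ⟨z₀, h, h'⟩ => Or.inr ⟨y, z₀, h, hy, h'⟩

/-- Existence and uniqueness of the value are proved by one induction on `y`, together with its
being a natural number, as `G` is assumed to be a function only there. -/
theorem rec_total (hB : ∃ b : M.carrier (Rel 1), ∀ x z, app2 b x z ↔ B x z)
    (hG : ∃ g : M.carrier (Rel 2), ∀ x z z', app3 g x z z' ↔ G x z z') {x y : M.carrier Obj}
    (hB' : ∃ z, Nt z ∧ ∀ w, B x w ↔ w = z)
    (hG' : ∀ z, Nt z → ∃ z', Nt z' ∧ ∀ w, G x z w ↔ w = z') (hy : Nt y) :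
    ∃ z, Nt z ∧ ∀ w, Rec B G x y w ↔ w = z := by
  obtain ⟨H, hH⟩ := exists_rec hB hG
  have : ∃ z, Nt z ∧ ∀ w, app3 H x y w ↔ w = z := by
    refine hy.induct (fun y => ∃ z, Nt z ∧ ∀ w, app3 H x y w ↔ w = z) ?_ ?_
    · simpa only [hH, rec_zero hB hG] using hB'
    · rintro m n hm ⟨z, hz, h⟩ hmn
      obtain ⟨z', hz', h'⟩ := hG' z hz
      refine ⟨z', hz', fun w => ?_⟩
      simp only [hH] at h
      rw [hH, rec_suc hB hG hmn]
      simp only [h, exists_eq_left, h']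
  simpa only [hH] using this

end Recursion

/-- The graph of addition. -/
def Add (x y z : M.carrier Obj) : Prop := Rec (fun x z => z = x) (fun _ z z' => Suc z z') x y z

theorem exists_add_base : ∃ b : M.carrier (Rel 1), ∀ x z, app2 b x z ↔ z = x :=
  compr2 (M := M) fun x z => z = x

theorem exists_add_step : ∃ g : M.carrier (Rel 2), ∀ x z z', app3 g x z z' ↔ Suc z z' :=
  compr3 (M := M) fun _ z z' => Suc z z'

instance ar_add (f g h : M.Assign → M.carrier Obj) [Tm M f] [Tm M g] [Tm M h] :
    Ar M (fun e => Add (f e) (g e) (h e)) := by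
  obtain ⟨H, hH⟩ := exists_rec (M := M) exists_add_base exists_add_step
  unfold Add
  simp only [← hH]
  infer_instance

theorem add_zero {x z : M.carrier Obj} : Add x (zero M) z ↔ z = x :=
  rec_zero exists_add_base exists_add_step

theorem add_suc {x y y' z : M.carrier Obj} (hy : Suc y y') :
    Add x y' z ↔ ∃ z₀, Add x y z₀ ∧ Suc z₀ z :=
  rec_suc exists_add_base exists_add_step hy

theorem add_total {x y : M.carrier Obj} (hx : Nt x) (hy : Nt y) :
    ∃ z, Nt z ∧ ∀ w, Add x y w ↔ w = z := by
  refine rec_total exists_add_base exists_add_step ⟨x, hx, fun w => Iff.rfl⟩ (fun z hz => ?_) hy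
  obtain ⟨z', hz'⟩ := hz.exists_suc
  exact ⟨z', hz.suc hz', fun w => ⟨fun h => h.right_unique hz', fun h => h ▸ hz'⟩⟩

/-- The graph of multiplication. -/
def Mul (x y z : M.carrier Obj) : Prop :=
  Rec (fun _ z => z = zero M) (fun x z z' => Add z x z') x y z

theorem exists_mul_base : ∃ b : M.carrier (Rel 1), ∀ x z, app2 b x z ↔ z = zero M :=
  compr2 (M := M) fun _ z => z = zero M

theorem exists_mul_step : ∃ g : M.carrier (Rel 2), ∀ x z z', app3 g x z z' ↔ Add z x z' :=
  compr3 (M := M) fun x z z' => Add z x z'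

instance ar_mul (f g h : M.Assign → M.carrier Obj) [Tm M f] [Tm M g] [Tm M h] :
    Ar M (fun e => Mul (f e) (g e) (h e)) := by
  obtain ⟨H, hH⟩ := exists_rec (M := M) exists_mul_base exists_mul_step
  unfold Mul
  simp only [← hH]
  infer_instance

theorem mul_zero {x z : M.carrier Obj} : Mul x (zero M) z ↔ z = zero M :=
  rec_zero exists_mul_base exists_mul_step

theorem mul_suc {x y y' z : M.carrier Obj} (hy : Suc y y') :
    Mul x y' z ↔ ∃ z₀, Mul x y z₀ ∧ Add z₀ x z :=
  rec_suc exists_mul_base exists_mul_step hy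

theorem mul_total {x y : M.carrier Obj} (hx : Nt x) (hy : Nt y) :
    ∃ z, Nt z ∧ ∀ w, Mul x y w ↔ w = z :=
  rec_total exists_mul_base exists_mul_step ⟨zero M, nt_zero, fun _ => Iff.rfl⟩
    (fun _ hz => add_total hz hx) hy

end Frege

end HP

/-! ## Arithmetic in models of Hume's Principle -/

namespace HP

section ArithStruc

variable {M : Struc.{u} sig} [IsModel M]

variable (M) in
/-- The natural numbers as a type. -/
abbrev NtType : Type u := {n : M.carrier Obj // Nt n}

/-- The successor, as a function. -/
noncomputable def sucFn (x : NtType M) : NtType M :=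
  ⟨x.2.exists_suc.choose, x.2.suc x.2.exists_suc.choose_spec⟩

noncomputable def addFn (x y : NtType M) : NtType M :=
  ⟨(add_total x.2 y.2).choose, (add_total x.2 y.2).choose_spec.1⟩

noncomputable def mulFn (x y : NtType M) : NtType M :=
  ⟨(mul_total x.2 y.2).choose, (mul_total x.2 y.2).choose_spec.1⟩

theorem suc_iff (x : NtType M) (z : M.carrier Obj) : Suc x.1 z ↔ z = (sucFn x).1 :=
  ⟨fun h => h.right_unique x.2.exists_suc.choose_spec, fun h => h ▸ x.2.exists_suc.choose_spec⟩

theorem add_iff (x y : NtType M) (z : M.carrier Obj) : Add x.1 y.1 z ↔ z = (addFn x y).1 :=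
  (add_total x.2 y.2).choose_spec.2 z

theorem mul_iff (x y : NtType M) (z : M.carrier Obj) : Mul x.1 y.1 z ↔ z = (mulFn x y).1 :=
  (mul_total x.2 y.2).choose_spec.2 z

theorem exists_inter (X : M.carrier (Rel 0)) :
    ∃ Y : {Y : M.carrier (Rel 0) // ∀ a, app1 Y a → Nt a},
      ∀ a, app1 Y.1 a ↔ app1 X a ∧ Nt a := by
  obtain ⟨Y, hY⟩ := compr1 (M := M) fun a => app1 X a ∧ Nt a
  exact ⟨⟨Y, fun a h => ((hY a).1 h).2⟩, hY⟩

/-- The set of natural numbers in a set. -/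
noncomputable def inter (X : M.carrier (Rel 0)) :
    {Y : M.carrier (Rel 0) // ∀ a, app1 Y a → Nt a} := (exists_inter X).choose

theorem app1_inter {X : M.carrier (Rel 0)} {a : M.carrier Obj} :
    app1 (inter X).1 a ↔ app1 X a ∧ Nt a := (exists_inter X).choose_spec a

variable (M) in
/-- The structure of natural numbers that is defined in a model of Hume's Principle. -/
noncomputable def arithStruc : Struc.{u} PA.sig where
  carrier
    | .num => NtType M
    | .set => {Y : M.carrier (Rel 0) // ∀ a, app1 Y a → Nt a}
  nonempty
    | .num => ⟨⟨zero M, nt_zero⟩⟩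
    | .set => ⟨inter (M.nonempty (Rel 0)).some⟩
  fn
    | .zero => fun _ => ⟨zero M, nt_zero⟩
    | .succ => fun a => sucFn (a 0)
    | .add => fun a => addFn (a 0) (a 1)
    | .mul => fun a => mulFn (a 0) (a 1)
  rl
    | .le => fun a => ∃ c : NtType M, addFn (a 0) c = a 1
    | .mem => fun a => app1 (a 1).1 (a 0).1

theorem le_arithStruc (a b : (arithStruc M).carrier PA.Num) :
    a ≤ b ↔ ∃ c : NtType M, addFn (M := M) a c = b := Iff.rfl

theorem models_base_arithStruc : (arithStruc M).Models PA.base := by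
  have hadd : ∀ x y : NtType M, addFn x (sucFn y) = sucFn (addFn x y) := fun x y => by
    refine Subtype.ext (((add_iff _ _ _).1 ?_).symm)
    exact (add_suc ((suc_iff y _).2 rfl)).2 ⟨_, (add_iff x y _).2 rfl, (suc_iff _ _).2 rfl⟩
  have hmul : ∀ x y : NtType M, mulFn x (sucFn y) = addFn (mulFn x y) x := fun x y => by
    refine Subtype.ext (((mul_iff _ _ _).1 ?_).symm)
    exact (mul_suc ((suc_iff y _).2 rfl)).2 ⟨_, (mul_iff x y _).2 rfl, (add_iff _ _ _).2 rfl⟩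
  intro φ hφ v
  simp only [PA.base, Set.mem_insert_iff, Set.mem_singleton_iff] at hφ
  rcases hφ with rfl | rfl | rfl | rfl | rfl | rfl | rfl | rfl | rfl | rfl
  · intro h
    exact ((suc_iff _ _).2 rfl).ne_zero (congrArg Subtype.val h)
  · intro h
    have h' : (sucFn (M := M) (v (PA.Num, 0))).1 = (sucFn (v (PA.Num, 1))).1 :=
      congrArg Subtype.val h
    exact Subtype.ext (((suc_iff (M := M) (v (PA.Num, 0)) _).2 rfl).left_unique
      (h' ▸ (suc_iff (M := M) (v (PA.Num, 1)) _).2 rfl))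
  · intro h
    simp only [Struc.Sat, PA.val_succ, PA.val_x]
    have hv := (v (PA.Num, 0)).2
    rcases Le.cases hv with h' | ⟨k, hk, hk'⟩
    · exact absurd (Subtype.ext h'.symm) h
    · refine ⟨(⟨k, hk⟩ : NtType M), ?_⟩
      simp [Function.update]
      exact Subtype.ext ((suc_iff ⟨k, hk⟩ _).1 hk')
  · exact Subtype.ext (add_zero.1 ((add_iff (M := M) (v (PA.Num, 0)) ⟨zero M, nt_zero⟩ _).2 rfl))
  · simp only [PA.q5, Struc.Sat, PA.val_succ, PA.val_x, PA.val_add]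
    exact hadd _ _
  · simp only [PA.q6, Struc.Sat, PA.val_zero, PA.val_x, PA.val_mul]
    exact Subtype.ext (mul_zero.1 ((mul_iff (M := M) (v (PA.Num, 0)) ⟨zero M, nt_zero⟩ _).2 rfl))
  · simp only [PA.q7, Struc.Sat, PA.val_succ, PA.val_x, PA.val_add, PA.val_mul]
    exact hmul _ _
  · simp only [PA.q8, Struc.Sat, Struc.sat_iff, PA.sat_le, PA.val_x, PA.val_add]
    simp [Function.update]
    exact le_arithStruc _ _
  · intro F
    simp only [Struc.Sat, Struc.sat_and, PA.sat_mem, PA.val_x, PA.val_zero, PA.val_succ, PA.val_X]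
    simp only [Function.update_self, ne_eq, Prod.mk.injEq, reduceCtorEq, false_and,
      not_false_eq_true, Function.update_of_ne]
    rintro ⟨h₀, h₁⟩ a
    refine Nt.induct (fun a => app1 F.1 a) h₀ (fun m n hm h h' => ?_) a.2
    have := h₁ (⟨m, hm⟩ : NtType M) h
    rw [(suc_iff ⟨m, hm⟩ n).1 h']
    exact this
  · simp only [PA.extensionality, Struc.Sat, Struc.sat_iff, PA.sat_mem, PA.val_x, PA.val_X]
    simp only [Function.update_self, ne_eq, Prod.mk.injEq, reduceCtorEq, false_and,
      not_false_eq_true, Function.update_of_ne]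
    intro h
    refine Subtype.ext (set_ext fun a => ⟨fun ha => ?_, fun ha => ?_⟩)
    · exact (h (⟨a, (v (PA.Sets, 0)).2 a ha⟩ : NtType M)).1 ha
    · exact (h (⟨a, (v (PA.Sets, 1)).2 a ha⟩ : NtType M)).2 ha

/-! ### Definability in the model -/

/-- The variable that represents a given variable. -/
def arithVar : PA.sig.Vrb → sig.Vrb
  | (.num, j) => (Obj, j)
  | (.set, i) => (Rel 0, i)

open Classical in
/-- The number that is represented by an object. -/
noncomputable def toNt (a : M.carrier Obj) : NtType M :=
  if h : Nt a then ⟨a, h⟩ else ⟨zero M, nt_zero⟩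

/-- Objects that are not natural numbers decode to zero. Decoding is therefore total, and translated
quantifiers need no guard. -/
theorem toNt_eq_iff (a b : M.carrier Obj) :
    (toNt a).1 = b ↔ (Nt a ∧ a = b) ∨ (¬ Nt a ∧ zero M = b) := by
  by_cases h : Nt a <;> simp [toNt, h]

theorem toNt_of_nt (a : NtType M) : toNt a.1 = a := by
  rw [toNt, dif_pos a.2]

theorem inter_of_subset (X : {Y : M.carrier (Rel 0) // ∀ a, app1 Y a → Nt a}) : inter X.1 = X :=
  Subtype.ext (set_ext fun a => app1_inter.trans ⟨fun h => h.1, fun h => ⟨h, X.2 a h⟩⟩)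

/-- The number or set that is represented by an object or set. -/
noncomputable def arithDec :
    (p : PA.sig.Vrb) → M.carrier (arithVar p).1 → (arithStruc M).carrier p.1
  | (.num, _) => toNt
  | (.set, _) => inter

/-- The assignment that is represented by an assignment. -/
noncomputable def arithAssign (e : M.Assign) : (arithStruc M).Assign :=
  fun p => arithDec p (e (arithVar p))

theorem arithVar_injective : Function.Injective arithVar := by
  rintro ⟨_ | _, i⟩ ⟨_ | _, j⟩ h <;> simp [arithVar] at h ⊢ <;> exact h

theorem arithDec_surjective (p : PA.sig.Vrb) : Function.Surjective (arithDec (M := M) p) := by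
  obtain ⟨_ | _, i⟩ := p
  · exact fun a => ⟨a.1, toNt_of_nt a⟩
  · exact fun X => ⟨X.1, inter_of_subset X⟩

open Classical in
theorem arithAssign_update (e : M.Assign) (p : PA.sig.Vrb) (a : M.carrier (arithVar p).1) :
    arithAssign (Function.update e (arithVar p) a) =
      Function.update (arithAssign e) p (arithDec p a) := by
  funext q
  by_cases h : q = p
  · subst h
    simp [arithAssign]
  · rw [Function.update_of_ne h, arithAssign, Function.update_of_ne (arithVar_injective.ne h)]
    rfl

theorem exists_arithAssign_eq (v : (arithStruc M).Assign) : ∃ e : M.Assign, arithAssign e = v := by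
  refine ⟨fun p => match p with
    | (.obj, j) => (v (PA.Num, j)).1
    | (.rel 0, i) => (v (PA.Sets, i)).1
    | (.rel (k + 1), _) => (M.nonempty (Rel (k + 1))).some, ?_⟩
  funext ⟨σ, i⟩
  rcases σ with _ | _
  · exact toNt_of_nt (v (PA.Num, i))
  · exact inter_of_subset (v (PA.Sets, i))

theorem term_num_cases {σ : PA.sig.Srt} (t : Term PA.sig σ) :
    (∃ i, t = .var (σ, i)) ∨ σ = PA.Num := by
  cases t with
  | var p => exact Or.inl ⟨p.2, rfl⟩
  | app f ts => exact Or.inr rfl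

theorem term_set (t : Term PA.sig PA.Sets) : ∃ i, t = PA.X i := by
  rcases term_num_cases t with h | h
  · exact h
  · cases h

/-- The arithmetical operations are available in `M` only as graphs, so a nested term is unravelled
by quantifying over the values of its subterms. The equation `hσ` allows induction over terms of
every sort. -/
theorem ar_val {σ : PA.sig.Srt} (t : Term PA.sig σ) : ∀ (hσ : σ = PA.Num)
    (h : M.Assign → M.Assign) (_ : ∀ p : sig.Vrb, Tm M fun e => h e p)
    (f : M.Assign → M.carrier Obj) [Tm M f], Ar M (fun e =>
      Subtype.val (p := Nt)
        ((arithStruc M).val (arithAssign (h e)) (hσ ▸ t : Term PA.sig PA.Num)) = f e) := by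
  have hh' : ∀ h : M.Assign → M.Assign, (∀ p : sig.Vrb, Tm M fun e => h e p) →
      ∀ p : sig.Vrb, Tm M fun e => h e.tail.tail p := fun h hh p =>
    have := hh p
    Tm.reindex (fun e => h e p) fun p => p.2 + 1 + 1
  induction t with
  | var p =>
    intro hσ h hh f _
    obtain ⟨_ | _, i⟩ := p
    · have := hh (Obj, i)
      refine Dfb.congr (P := fun e => (Nt (h e (Obj, i)) ∧ h e (Obj, i) = f e) ∨
        (¬ Nt (h e (Obj, i)) ∧ zero M = f e)) inferInstance fun e => ?_
      exact toNt_eq_iff _ _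
    · cases hσ
  | app g ts ih =>
    intro hσ h hh f hf
    cases g with
    | zero => exact inferInstanceAs (Ar M fun e => zero M = f e)
    | succ =>
      let s : Term PA.sig PA.Num := ts 0
      have h₁ : Ar M (fun e : M.Assign => Subtype.val (p := Nt)
          ((arithStruc M).val (arithAssign (h e.tail)) s) = e (Obj, 0)) :=
        ih 0 rfl (fun e => h e.tail) (fun p =>
          have := hh p
          Tm.reindex (fun e => h e p) fun p => p.2 + 1) (fun e => e (Obj, 0))
      refine Dfb.congr (P := fun e => ∃ y : M.carrier Obj,
        Subtype.val (p := Nt) ((arithStruc M).val (arithAssign (h e)) s) = y ∧ Suc y (f e))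
        inferInstance fun e => ?_
      let a : NtType M := (arithStruc M).val (arithAssign (h e)) s
      change (sucFn a).1 = f e ↔ ∃ y, a.1 = y ∧ Suc y (f e)
      refine eq_comm.trans ((suc_iff a (f e)).symm.trans ?_)
      exact ⟨fun h => ⟨_, rfl, h⟩, fun ⟨y, h, h'⟩ => h ▸ h'⟩
    | add =>
      let s : Term PA.sig PA.Num := ts 0
      let t : Term PA.sig PA.Num := ts 1
      have h₁ : Ar M (fun e : M.Assign => Subtype.val (p := Nt)
          ((arithStruc M).val (arithAssign (h e.tail.tail)) s) = e (Obj, 1)) :=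
        ih 0 rfl (fun e => h e.tail.tail) (hh' h hh) (fun e => e (Obj, 1))
      have h₂ : Ar M (fun e : M.Assign => Subtype.val (p := Nt)
          ((arithStruc M).val (arithAssign (h e.tail.tail)) t) = e (Obj, 0)) :=
        ih 1 rfl (fun e => h e.tail.tail) (hh' h hh) (fun e => e (Obj, 0))
      refine Dfb.congr (P := fun e => ∃ y z : M.carrier Obj,
        Subtype.val (p := Nt) ((arithStruc M).val (arithAssign (h e)) s) = y ∧
        Subtype.val (p := Nt) ((arithStruc M).val (arithAssign (h e)) t) = z ∧ Add y z (f e))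
        inferInstance fun e => ?_
      let a : NtType M := (arithStruc M).val (arithAssign (h e)) s
      let b : NtType M := (arithStruc M).val (arithAssign (h e)) t
      change (addFn a b).1 = f e ↔ ∃ y z, a.1 = y ∧ b.1 = z ∧ Add y z (f e)
      refine eq_comm.trans ((add_iff a b (f e)).symm.trans ?_)
      exact ⟨fun h => ⟨_, _, rfl, rfl, h⟩, fun ⟨y, z, h, h', h''⟩ => h ▸ h' ▸ h''⟩
    | mul =>
      let s : Term PA.sig PA.Num := ts 0
      let t : Term PA.sig PA.Num := ts 1
      have h₁ : Ar M (fun e : M.Assign => Subtype.val (p := Nt)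
          ((arithStruc M).val (arithAssign (h e.tail.tail)) s) = e (Obj, 1)) :=
        ih 0 rfl (fun e => h e.tail.tail) (hh' h hh) (fun e => e (Obj, 1))
      have h₂ : Ar M (fun e : M.Assign => Subtype.val (p := Nt)
          ((arithStruc M).val (arithAssign (h e.tail.tail)) t) = e (Obj, 0)) :=
        ih 1 rfl (fun e => h e.tail.tail) (hh' h hh) (fun e => e (Obj, 0))
      refine Dfb.congr (P := fun e => ∃ y z : M.carrier Obj,
        Subtype.val (p := Nt) ((arithStruc M).val (arithAssign (h e)) s) = y ∧
        Subtype.val (p := Nt) ((arithStruc M).val (arithAssign (h e)) t) = z ∧ Mul y z (f e))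
        inferInstance fun e => ?_
      let a : NtType M := (arithStruc M).val (arithAssign (h e)) s
      let b : NtType M := (arithStruc M).val (arithAssign (h e)) t
      change (mulFn a b).1 = f e ↔ ∃ y z, a.1 = y ∧ b.1 = z ∧ Mul y z (f e)
      refine eq_comm.trans ((mul_iff a b (f e)).symm.trans ?_)
      exact ⟨fun h => ⟨_, _, rfl, rfl, h⟩, fun ⟨y, z, h, h', h''⟩ => h ▸ h' ▸ h''⟩

theorem ar_val_num (t : Term PA.sig PA.Num) (h : M.Assign → M.Assign)
    (hh : ∀ p : sig.Vrb, Tm M fun e => h e p) (f : M.Assign → M.carrier Obj) [Tm M f] :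
    Ar M (fun e => Subtype.val (p := Nt) ((arithStruc M).val (arithAssign (h e)) t) = f e) :=
  ar_val t rfl h hh f

theorem ar_sat_arithStruc {φ : Formula PA.sig} (h : φ.Arithmetical PA.Num) :
    Ar M (fun e => (arithStruc M).Sat (arithAssign e) φ) := by
  refine Dfb.transfer_arith arithAssign arithVar arithDec arithDec_surjective arithAssign_update
    ?_ ?_ ?_ h
  · rintro ⟨σ, i⟩ rfl
    rfl
  · intro σ s t
    rcases σ with _ | _
    · have h₁ := ar_val_num (M := M) s (fun e => e.tail) inferInstance (fun e => e (Obj, 0))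
      have h₂ := ar_val_num (M := M) t (fun e => e.tail) inferInstance (fun e => e (Obj, 0))
      refine Dfb.congr (P := fun e => ∃ y : M.carrier Obj,
        Subtype.val (p := Nt) ((arithStruc M).val (arithAssign e) s) = y ∧
        Subtype.val (p := Nt) ((arithStruc M).val (arithAssign e) t) = y)
        inferInstance fun e => ?_
      exact ⟨fun h => ⟨_, rfl, congrArg Subtype.val h.symm⟩,
        fun ⟨y, h, h'⟩ => Subtype.ext (h.trans h'.symm)⟩
    · obtain ⟨i, rfl⟩ := term_set s
      obtain ⟨j, rfl⟩ := term_set t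
      refine Dfb.congr (P := fun e => ∀ a : M.carrier Obj, Nt a →
        (app1 (e (Rel 0, i)) a ↔ app1 (e (Rel 0, j)) a))
        inferInstance fun e => ?_
      change inter (e (Rel 0, i)) = inter (e (Rel 0, j)) ↔ _
      constructor
      · intro h a ha
        have := app1_inter (X := e (Rel 0, i)) (a := a)
        rw [h, app1_inter] at this
        tauto
      · intro h
        refine Subtype.ext (set_ext fun a => ?_)
        rw [app1_inter, app1_inter]
        have := h a
        tauto
  · intro r ts
    cases r with
    | le =>
      let s : Term PA.sig PA.Num := ts 0
      let t : Term PA.sig PA.Num := ts 1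
      have h₁ := ar_val_num (M := M) s (fun e => e.tail.tail) inferInstance (fun e => e (Obj, 1))
      have h₂ := ar_val_num (M := M) t (fun e => e.tail.tail) inferInstance (fun e => e (Obj, 0))
      refine Dfb.congr (P := fun e => ∃ y z : M.carrier Obj,
        Subtype.val (p := Nt) ((arithStruc M).val (arithAssign e) s) = y ∧
        Subtype.val (p := Nt) ((arithStruc M).val (arithAssign e) t) = z ∧
          ∃ c : M.carrier Obj, Nt c ∧ Add y c z) inferInstance fun e => ?_
      constructor
      · rintro ⟨c, hc⟩
        exact ⟨_, _, rfl, rfl, c.1, c.2, (add_iff _ c _).2 (congrArg Subtype.val hc.symm)⟩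
      · rintro ⟨y, z, rfl, rfl, c, hc, h⟩
        exact ⟨⟨c, hc⟩, Subtype.ext ((add_iff _ ⟨c, hc⟩ _).1 h).symm⟩
    | mem =>
      let s : Term PA.sig PA.Num := ts 0
      obtain ⟨i, hi⟩ := term_set (ts 1)
      have h₁ := ar_val_num (M := M) s (fun e => e.tail) inferInstance (fun e => e (Obj, 0))
      refine Dfb.congr (P := fun e => ∃ y : M.carrier Obj,
        Subtype.val (p := Nt) ((arithStruc M).val (arithAssign e) s) = y ∧
          app1 (e (Rel 0, i)) y ∧ Nt y) inferInstance fun e => ?_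
      change app1 ((arithStruc M).val (arithAssign e) (ts 1)).1
        (Subtype.val (p := Nt) ((arithStruc M).val (arithAssign e) s)) ↔ _
      rw [hi]
      refine app1_inter.trans ⟨fun h => ⟨_, rfl, h⟩, ?_⟩
      rintro ⟨y, rfl, h⟩
      exact h

theorem dfb_sat_arithStruc {c : Option ℕ} {φ : Formula PA.sig} (hφ : φ ∈ cls PA.Num c) :
    Dfb (cls Obj c) M (fun e => (arithStruc M).Sat (arithAssign e) φ) := by
  cases c with
  | none =>
    exact Dfb.transfer_univ arithAssign arithVar arithDec arithDec_surjective arithAssign_update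
      (fun φ h => ar_sat_arithStruc h) φ
  | some m =>
    refine ((Dfb.transfer_pi_sigma arithAssign arithVar arithDec arithDec_surjective
      (fun e p a _ => arithAssign_update e p a) ?_ (fun φ h => ar_sat_arithStruc h) φ) m).1 hφ
    rintro ⟨_ | _, j⟩ hp
    · exact absurd rfl hp
    · simp [arithVar]

theorem models_arithStruc {c : Option ℕ} (hM : M.Models (schema (cls Obj c))) :
    (arithStruc M).Models (PA.base ∪ PA.schema (cls PA.Num c)) := by
  classical
  rintro φ (h | ⟨r, k, φ, hφ, hr, rfl⟩) v
  · exact models_base_arithStruc φ h v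
  obtain ⟨e₀, rfl⟩ := exists_arithAssign_eq v
  obtain ⟨F, hF⟩ := exists_rel_of_schema hM (dfb_sat_arithStruc hφ) (k := 0) (n := fun _ => k)
    (fun i j _ => Subsingleton.elim (α := Fin 1) i j) e₀
  obtain ⟨X, hX⟩ : ∃ X : (arithStruc M).carrier PA.Sets,
      ∀ a : (arithStruc M).carrier PA.Num, a ∈ X ↔ app1 F a.1 ∧ Nt a.1 :=
    ⟨inter F, fun a => app1_inter⟩
  refine ⟨X, fun a => ?_⟩
  rw [Struc.sat_iff, PA.sat_mem, PA.val_x, PA.val_X, Function.update_self,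
    Function.update_of_ne (by simp), Function.update_self]
  refine (hX a).trans ?_
  have h := hF (Function.update e₀ (Obj, k) a.1) fun p hp => Function.update_of_ne (hp 0) _ _
  have h₁ : (fun _ : Fin 1 => Function.update e₀ (Obj, k) a.1 (Obj, k)) = ![a.1] := by
    funext i
    rw [Function.update_self, Fin.fin_one_eq_zero i]
    rfl
  have h₂ : arithAssign (Function.update e₀ (Obj, k) a.1) =
      Function.update (arithAssign e₀) (PA.Num, k) a := by
    exact (arithAssign_update e₀ (PA.Num, k) a.1).trans
      (congrArg (Function.update (arithAssign e₀) (PA.Num, k)) (toNt_of_nt a))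
  rw [h₁, h₂] at h
  refine (and_iff_left a.2).trans (h.trans (Struc.sat_congr fun q hq => ?_))
  have hqr : q ≠ (PA.Sets, r) := fun h => hr (h ▸ hq)
  by_cases hqk : q = (PA.Num, k)
  · subst hqk
    simp
  · rw [Function.update_of_ne hqk, Function.update_of_ne hqk, Function.update_of_ne hqr]

end ArithStruc

end HP

namespace HP

/-! ### The interpretation -/

/-- The object variable number `z` is the number of the empty set. -/
def zeroFormula (z : ℕ) : Formula sig :=
  .ex (Rel 0, 5) <| .and (.all (Obj, 21) (.neg (mem (R 0 5) ![x 21]))) (.eq (card (R 0 5)) (x z))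

/-- The object variable number `z` is a successor of the object variable number `y`. -/
def sucFormula (y z : ℕ) : Formula sig :=
  .ex (Rel 0, 10) <| .ex (Rel 0, 11) <| .ex (Obj, 20) <|
    .and (.and (mem (R 0 10) ![x 20]) <| .all (Obj, 21) <|
      .iff (mem (R 0 11) ![x 21]) (.and (mem (R 0 10) ![x 21]) (.neg (.eq (x 21) (x 20))))) <|
    .and (.eq (card (R 0 10)) (x z)) (.eq (card (R 0 11)) (x y))

/-- The object variable number `j` is a natural number. -/
def natFormula (j : ℕ) : Formula sig :=
  .all (Rel 0, 12) <|
    .imp (.all (Obj, 22) (.imp (zeroFormula 22) (mem (R 0 12) ![x 22]))) <|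
    .imp (.all (Obj, 22) <| .all (Obj, 23) <|
      .imp (mem (R 0 12) ![x 22]) <| .imp (sucFormula 22 23) (mem (R 0 12) ![x 23])) <|
    mem (R 0 12) ![x j]

/-- The graph of a function that is defined by recursion. -/
def recFormula (b : ℕ) (B G : Formula sig) (i j k : ℕ) : Formula sig :=
  .all (Rel 2, b) <| .imp
    (.and (.all (Obj, b) <| .all (Obj, b + 1) <| .all (Obj, b + 2) <|
        .imp B <| .imp (zeroFormula (b + 2)) <| mem (R 2 b) ![x b, x (b + 2), x (b + 1)]) <|
      .all (Obj, b) <| .all (Obj, b + 1) <| .all (Obj, b + 2) <| .all (Obj, b + 3) <|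
        .all (Obj, b + 4) <| .imp (mem (R 2 b) ![x b, x (b + 1), x (b + 2)]) <|
          .imp (sucFormula (b + 1) (b + 3)) <| .imp G <|
            mem (R 2 b) ![x b, x (b + 3), x (b + 4)]) <|
    mem (R 2 b) ![x i, x j, x k]

def addFormula (i j k : ℕ) : Formula sig :=
  recFormula 40 (.eq (x 41) (x 40)) (sucFormula 42 44) i j k

def mulFormula (i j k : ℕ) : Formula sig :=
  recFormula 30 (zeroFormula 31) (addFormula 32 30 34) i j k

section

variable {M : Struc.{u} sig} [IsModel M] {v : M.Assign}

theorem sat_zeroFormula {z : ℕ} : M.Sat v (zeroFormula z) ↔ v (Obj, z) = zero M := by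
  rw [eq_zero_iff]
  simp only [zeroFormula, Struc.Sat, Struc.sat_and, Struc.sat_neg, sat_mem1, val_x, val_R,
    val_card]
  simp [Function.update]

omit [IsModel M] in
theorem sat_sucFormula {y z : ℕ} (hy : y ≠ 20) (hz : z ≠ 20) :
    M.Sat v (sucFormula y z) ↔ Suc (v (Obj, y)) (v (Obj, z)) := by
  simp only [sucFormula, Struc.Sat, Struc.sat_and, Struc.sat_neg, Struc.sat_iff, sat_mem1, val_x,
    val_R, val_card, Suc, IsErase]
  simp [Function.update, hy, hz]

theorem sat_natFormula {j : ℕ} : M.Sat v (natFormula j) ↔ Nt (v (Obj, j)) := by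
  simp only [natFormula, Struc.Sat, sat_mem1, val_x, val_R, sat_zeroFormula,
    sat_sucFormula (y := 22) (z := 23) (by simp) (by simp), Nt, Le]
  simp [Function.update]

/-- The bound on `b` keeps the arguments of the successor formula away from its own bound variable
`20`. No condition on `i`, `j`, `k` is needed, since they occur outside the scope of the object
quantifiers. -/
theorem sat_recFormula {b : ℕ} (hb : 21 ≤ b) {B G : Formula sig}
    {B' : M.carrier Obj → M.carrier Obj → Prop}
    {G' : M.carrier Obj → M.carrier Obj → M.carrier Obj → Prop}
    (hB : ∀ w : M.Assign, M.Sat w B ↔ B' (w (Obj, b)) (w (Obj, b + 1)))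
    (hG : ∀ w : M.Assign, M.Sat w G ↔ G' (w (Obj, b)) (w (Obj, b + 2)) (w (Obj, b + 4)))
    {i j k : ℕ} : M.Sat v (recFormula b B G i j k) ↔
      Rec B' G' (v (Obj, i)) (v (Obj, j)) (v (Obj, k)) := by
  simp only [recFormula, Struc.Sat, Struc.sat_and, sat_mem3, val_x, val_R, sat_zeroFormula, hB, hG,
    sat_sucFormula (y := b + 1) (z := b + 3) (by lia) (by lia), Rec, RecClosed]
  simp [Function.update]

theorem sat_addFormula {i j k : ℕ} : M.Sat v (addFormula i j k) ↔
    Add (v (Obj, i)) (v (Obj, j)) (v (Obj, k)) :=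
  sat_recFormula (b := 40) (by simp) (fun _ => Iff.rfl) fun _ => sat_sucFormula (by simp) (by simp)

theorem sat_mulFormula {i j k : ℕ} : M.Sat v (mulFormula i j k) ↔
    Mul (v (Obj, i)) (v (Obj, j)) (v (Obj, k)) :=
  sat_recFormula (b := 30) (by simp) (B' := fun _ z => z = zero M)
    (G' := fun x z z' => Add z x z') (fun _ => sat_zeroFormula) fun _ => sat_addFormula

theorem sat_natSetFormula : M.Sat v (.all (Obj, 0) (.imp (mem (R 0 0) ![x 0]) (natFormula 0))) ↔
    ∀ a, app1 (v (Rel 0, 0)) a → Nt a := by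
  simp only [Struc.Sat, sat_mem1, val_x, val_R, sat_natFormula]
  simp [Function.update]

theorem sat_leFormula : M.Sat v (.ex (Obj, 5) (.and (natFormula 5) (addFormula 0 5 1))) ↔
    ∃ c, Nt c ∧ Add (v (Obj, 0)) c (v (Obj, 1)) := by
  simp only [Struc.Sat, Struc.sat_and, sat_natFormula, sat_addFormula]
  simp [Function.update]

end

/-- The interpretation of arithmetic in the theory of Hume's Principle. -/
noncomputable def arithScheme : Scheme PA.sig sig :=
  Scheme.ofFormulas.{u} (fun | .num => Obj | .set => Rel 0)
    (fun
      | .num => natFormula 0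
      | .set => .all (Obj, 0) (.imp (mem (R 0 0) ![x 0]) (natFormula 0)))
    (fun
      | .le => .ex (Obj, 5) (.and (natFormula 5) (addFormula 0 5 1))
      | .mem => mem (R 0 1) ![x 0])
    (fun
      | .zero => zeroFormula 0
      | .succ => sucFormula 0 1
      | .add => addFormula 0 1 2
      | .mul => mulFormula 0 1 2)

theorem defines_arithStruc (M : Struc.{u} sig) [IsModel M] :
    arithScheme.{u}.Defines M (arithStruc M) := by
  refine ⟨fun | .num => Subtype.val | .set => Subtype.val, ?_, ?_, ?_, ?_⟩
  · rintro (_ | _)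
    exacts [Subtype.val_injective, Subtype.val_injective]
  · rintro (_ | _) v
    · refine Iff.trans ?_ (Formula.sat_closeTo (fun v => sat_natFormula (v := v))
        (fun v w h hv => ?_) v).symm
      · exact ⟨fun ⟨n, hn⟩ => hn ▸ n.2, fun h => ⟨⟨_, h⟩, rfl⟩⟩
      · rwa [← h _ rfl]
    · refine Iff.trans ?_ (Formula.sat_closeTo (fun v => sat_natSetFormula (v := v))
        (fun v w h hv => ?_) v).symm
      · exact ⟨fun ⟨Y, hY⟩ => hY ▸ Y.2, fun h => ⟨⟨_, h⟩, rfl⟩⟩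
      · rwa [← h _ rfl]
  · rintro (_ | _) a v hv
    · refine Iff.trans ?_ (Formula.sat_closeTo (fun v => sat_leFormula (v := v))
        (fun v w h hv => ?_) v).symm
      · let m : NtType M := a 0
        let n : NtType M := a 1
        have h₀ : v (Obj, 0) = m.1 := hv 0
        have h₁ : v (Obj, 1) = n.1 := hv 1
        rw [h₀, h₁]
        change (∃ c : NtType M, addFn m c = n) ↔ _
        constructor
        · rintro ⟨c, hc⟩
          exact ⟨c.1, c.2, (add_iff m c _).2 (congrArg Subtype.val hc.symm)⟩
        · rintro ⟨c, hc, h⟩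
          exact ⟨⟨c, hc⟩, Subtype.ext ((add_iff m ⟨c, hc⟩ _).1 h).symm⟩
      · have h₀ : v (Obj, 0) = w (Obj, 0) := h _ ⟨0, rfl⟩
        have h₁ : v (Obj, 1) = w (Obj, 1) := h _ ⟨1, rfl⟩
        rwa [← h₀, ← h₁]
    · refine Iff.trans ?_ (Formula.sat_closeTo (P := fun v => app1 (v (Rel 0, 1)) (v (Obj, 0)))
        (fun v => sat_mem1 _ _) (fun v w h hv => ?_) v).symm
      · have h₀ : v (Obj, 0) = (a 0).1 := hv 0
        have h₁ : v (Rel 0, 1) = (a 1).1 := hv 1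
        rw [h₀, h₁]
        rfl
      · have h₀ : v (Obj, 0) = w (Obj, 0) := h _ ⟨0, rfl⟩
        have h₁ : v (Rel 0, 1) = w (Rel 0, 1) := h _ ⟨1, rfl⟩
        rwa [← h₀, ← h₁]
  · rintro (_ | _ | _ | _) a b v hv hb
    · refine Iff.trans ?_ (Formula.sat_closeTo (fun v => sat_zeroFormula (z := 0) (v := v))
        (fun v w h hv => ?_) v).symm
      · let n : NtType M := b
        have h₀ : v (Obj, 0) = n.1 := hb
        rw [h₀]
        change (⟨zero M, nt_zero⟩ : NtType M) = n ↔ _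
        rw [Subtype.ext_iff, eq_comm]
      · have h₀ : v (Obj, 0) = w (Obj, 0) := h _ (Or.inr rfl)
        rwa [← h₀]
    · refine Iff.trans ?_ (Formula.sat_closeTo
        (fun v => sat_sucFormula (y := 0) (z := 1) (v := v) (by lia) (by lia))
        (fun v w h hv => ?_) v).symm
      · let m : NtType M := a 0
        let n : NtType M := b
        have h₀ : v (Obj, 0) = m.1 := hv 0
        have h₁ : v (Obj, 1) = n.1 := hb
        rw [h₀, h₁, suc_iff]
        change sucFn m = n ↔ _
        rw [Subtype.ext_iff, eq_comm]
      · have h₀ : v (Obj, 0) = w (Obj, 0) := h _ (Or.inl ⟨0, rfl⟩)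
        have h₁ : v (Obj, 1) = w (Obj, 1) := h _ (Or.inr rfl)
        rwa [← h₀, ← h₁]
    · refine Iff.trans ?_ (Formula.sat_closeTo
        (fun v => sat_addFormula (i := 0) (j := 1) (k := 2) (v := v)) (fun v w h hv => ?_) v).symm
      · let l : NtType M := a 0
        let m : NtType M := a 1
        let n : NtType M := b
        have h₀ : v (Obj, 0) = l.1 := hv 0
        have h₁ : v (Obj, 1) = m.1 := hv 1
        have h₂ : v (Obj, 2) = n.1 := hb
        rw [h₀, h₁, h₂, add_iff]
        change addFn l m = n ↔ _
        rw [Subtype.ext_iff, eq_comm]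
      · have h₀ : v (Obj, 0) = w (Obj, 0) := h _ (Or.inl ⟨0, rfl⟩)
        have h₁ : v (Obj, 1) = w (Obj, 1) := h _ (Or.inl ⟨1, rfl⟩)
        have h₂ : v (Obj, 2) = w (Obj, 2) := h _ (Or.inr rfl)
        rwa [← h₀, ← h₁, ← h₂]
    · refine Iff.trans ?_ (Formula.sat_closeTo
        (fun v => sat_mulFormula (i := 0) (j := 1) (k := 2) (v := v)) (fun v w h hv => ?_) v).symm
      · let l : NtType M := a 0
        let m : NtType M := a 1
        let n : NtType M := b
        have h₀ : v (Obj, 0) = l.1 := hv 0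
        have h₁ : v (Obj, 1) = m.1 := hv 1
        have h₂ : v (Obj, 2) = n.1 := hb
        rw [h₀, h₁, h₂, mul_iff]
        change mulFn l m = n ↔ _
        rw [Subtype.ext_iff, eq_comm]
      · have h₀ : v (Obj, 0) = w (Obj, 0) := h _ (Or.inl ⟨0, rfl⟩)
        have h₁ : v (Obj, 1) = w (Obj, 1) := h _ (Or.inl ⟨1, rfl⟩)
        have h₂ : v (Obj, 2) = w (Obj, 2) := h _ (Or.inr rfl)
        rwa [← h₀, ← h₁, ← h₂]

theorem interpretable_arith {c : Option ℕ} (hc : c ≠ some 0) :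
    Interpretable.{u} (PA.base ∪ PA.schema (cls PA.Num c)) (base ∪ schema (cls Obj c)) := by
  refine ⟨arithScheme.{u}, fun M hM => ?_⟩
  have := isModel_of_models hc hM
  exact ⟨arithStruc M, models_arithStruc fun φ hφ => hM φ (Or.inr hφ), defines_arithStruc M⟩

end HP

theorem mainTheorem12 :
    MutuallyInterpretable.{u} PA2 HP2 ∧
      ∀ n : ℕ, 0 < n → MutuallyInterpretable.{u} (PiCA n) (PiHP n) := by
  refine ⟨⟨HP.interpretable_arith (c := none) (by simp),
    PA.interpretable_hume (c := none) (by simp)⟩, fun n hn => ?_⟩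
  have hc : some n ≠ some 0 := by simpa using hn.ne'
  exact ⟨HP.interpretable_arith hc, PA.interpretable_hume hc⟩
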